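/- An instance of the weighted popular matching problem with strict preferences consists of a finite set $A$ of applicants, a finite set $J$ of jobs, for every applicant $x$ a strictly ordered preference list of distinct jobs (possibly incomplete or empty), and a weight $w(x) > 0$. Let $n = |A| + |J|$ and let $m$ be the total length of the lists, so that $n$ and $m$ are the numbers of vertices and edges of the bipartite graph in which $x$ is joined to the jobs on its list. A matching is a set of edges of this graph no two of which share a vertex. An applicant prefers a matching $M_1$ over a matching $M_2$ if its job in $M_1$ is earlier on its list than its job in $M_2$, or if it has a job in $M_1$ and none in $M_2$. The satisfaction of $M_1$ with respect to $M_2$ is the total weight of the applicants who prefer $M_1$ over $M_2$ minus the total weight of those who prefer $M_2$ over $M_1$; $M_1$ is more popular than $M_2$ if this is positive; and a matching is popular if no matching is more popular than it. Theorem. There is an algorithm (a fixed program for a random access machine which, in one step, accesses an array cell, takes the successor or predecessor of an integer, or adds, subtracts or compares two weights) that, given such an instance by its preference lists and weights, with the applicants already partitioned by weight into categories $C_1, \dots, C_k$ (i.e. listed in order of non-increasing weight), outputs a popular matching if one exists and reports that there is none otherwise, in $O(n+m)$ steps: that is, in at most $C\,(n+m+1)$ steps for a constant $C$ that does not depend on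 the instance. -/

import Mathlib

namespace WeightedPopular

/-! ### Instances, matchings, popularity -/

/-- An instance with strict (possibly incomplete, possibly empty) preference lists.
`pref x` lists the jobs adjacent to applicant `x`, best first, without repetition, so that the
edges of the bipartite graph are the pairs `(x, p)` with `p ∈ pref x`. -/
structure Instance where
  numApplicants : ℕ
  numJobs : ℕ
  pref : Fin numApplicants → List (Fin numJobs)
  pref_nodup : ∀ x, (pref x).Nodup
  weight : Fin numApplicants → ℝ
  weight_pos : ∀ x, 0 < weight x

namespace Instance

variable (I : Instance)

/-- `n`, the number of vertices of the bipartite graph. -/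
def numVertices : ℕ := I.numApplicants + I.numJobs

/-- `m`, the number of edges of the bipartite graph. -/
def numEdges : ℕ := ∑ x, (I.pref x).length

/-- An assignment of at most one job to each applicant (`none`: the applicant is free). -/
abbrev Assignment : Type := Fin I.numApplicants → Option (Fin I.numJobs)

/-- `M` is a matching: it only uses edges, and no job is given to two applicants. -/
def IsMatching (M : I.Assignment) : Prop :=
  (∀ x p, M x = some p → p ∈ I.pref x) ∧
    ∀ x y p, M x = some p → M y = some p → x = y

/-- The place of an outcome on the list of `x`: listed jobs have places
`0, 1, ..., length - 1`, and being free comes after all of them. -/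
def place (x : Fin I.numApplicants) : Option (Fin I.numJobs) → ℕ
  | some p => (I.pref x).idxOf p
  | none => (I.pref x).length

/-- Applicant `x` prefers `M₁` over `M₂`. -/
abbrev Prefers (x : Fin I.numApplicants) (M₁ M₂ : I.Assignment) : Prop :=
  I.place x (M₁ x) < I.place x (M₂ x)

/-- The satisfaction of `M₁` with respect to `M₂`. -/
noncomputable def satisfaction (M₁ M₂ : I.Assignment) : ℝ :=
  (∑ x with I.Prefers x M₁ M₂, I.weight x) - ∑ x with I.Prefers x M₂ M₁, I.weight x

/-- `M₁` is more popular than `M₂`. -/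
def MorePopular (M₁ M₂ : I.Assignment) : Prop := 0 < I.satisfaction M₁ M₂

/-- `M` is a (weighted) popular matching. -/
def IsPopular (M : I.Assignment) : Prop :=
  I.IsMatching M ∧ ¬ ∃ M', I.IsMatching M' ∧ I.MorePopular M' M

end Instance

/-! ### The machine model

A random access machine with integer variables, integer arrays, weight variables and weight
arrays, programmed by structured programs.  A program names its (finitely many) variables and
arrays by constants.  An array has one cell for every natural number, and any cell can be
accessed in one step.  The only integer arithmetic is
successor and (truncated) predecessor, so that along a run the integers stay below the largest
input integer plus the number of steps plus a constant of the program (words of logarithmic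
length suffice).  Weights can only be copied, added, subtracted and compared; the only weight
constant is `0`. -/

/-- Memory contents. -/
structure State where
  var : ℕ → ℕ
  arr : ℕ → ℕ → ℕ
  wvar : ℕ → ℝ
  warr : ℕ → ℕ → ℝ

/-- Integer expressions; `get k e` is the cell of array `k` with index `e`. -/
inductive IntExp where
  | const (c : ℕ)
  | var (v : ℕ)
  | succ (e : IntExp)
  | pred (e : IntExp)
  | get (k : ℕ) (e : IntExp)

def IntExp.eval (s : State) : IntExp → ℕ
  | .const c => c
  | .var v => s.var v
  | .succ e => e.eval s + 1
  | .pred e => e.eval s - 1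
  | .get k e => s.arr k (e.eval s)

/-- The number of operations in an expression. -/
def IntExp.cost : IntExp → ℕ
  | .const _ => 1
  | .var _ => 1
  | .succ e => e.cost + 1
  | .pred e => e.cost + 1
  | .get _ e => e.cost + 1

/-- Weight expressions. -/
inductive WExp where
  | zero
  | var (v : ℕ)
  | get (k : ℕ) (e : IntExp)
  | add (a b : WExp)
  | sub (a b : WExp)

noncomputable def WExp.eval (s : State) : WExp → ℝ
  | .zero => 0
  | .var v => s.wvar v
  | .get k e => s.warr k (e.eval s)
  | .add a b => a.eval s + b.eval s
  | .sub a b => a.eval s - b.eval s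

def WExp.cost : WExp → ℕ
  | .zero => 1
  | .var _ => 1
  | .get _ e => e.cost + 1
  | .add a b => a.cost + b.cost + 1
  | .sub a b => a.cost + b.cost + 1

/-- Tests. -/
inductive Test where
  | eq (a b : IntExp)
  | lt (a b : IntExp)
  | wlt (a b : WExp)
  | not (t : Test)
  | and (t u : Test)
  | or (t u : Test)

def Test.Holds (s : State) : Test → Prop
  | .eq a b => a.eval s = b.eval s
  | .lt a b => a.eval s < b.eval s
  | .wlt a b => a.eval s < b.eval s
  | .not t => ¬ t.Holds s
  | .and t u => t.Holds s ∧ u.Holds s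
  | .or t u => t.Holds s ∨ u.Holds s

def Test.cost : Test → ℕ
  | .eq a b => a.cost + b.cost + 1
  | .lt a b => a.cost + b.cost + 1
  | .wlt a b => a.cost + b.cost + 1
  | .not t => t.cost + 1
  | .and t u => t.cost + u.cost + 1
  | .or t u => t.cost + u.cost + 1

/-- Programs. -/
inductive Program where
  | skip
  | setVar (v : ℕ) (e : IntExp)
  | setArr (k : ℕ) (i : IntExp) (e : IntExp)
  | setWVar (v : ℕ) (e : WExp)
  | setWArr (k : ℕ) (i : IntExp) (e : WExp)
  | seq (P Q : Program)
  | ite (t : Test) (P Q : Program)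
  | loop (t : Test) (P : Program)

/-- `Runs P s s' c`: started in memory `s`, the program `P` halts in memory `s'` after `c` steps.
(Programs are deterministic: `s'` and `c` are determined by `P` and `s`.) -/
inductive Runs : Program → State → State → ℕ → Prop
  | skip (s : State) : Runs .skip s s 1
  | setVar (v : ℕ) (e : IntExp) (s : State) :
      Runs (.setVar v e) s { s with var := Function.update s.var v (e.eval s) } (e.cost + 1)
  | setArr (k : ℕ) (i e : IntExp) (s : State) :
      Runs (.setArr k i e) s
        { s with arr := Function.update s.arr k
                   (Function.update (s.arr k) (i.eval s) (e.eval s)) }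
        (i.cost + e.cost + 1)
  | setWVar (v : ℕ) (e : WExp) (s : State) :
      Runs (.setWVar v e) s { s with wvar := Function.update s.wvar v (e.eval s) } (e.cost + 1)
  | setWArr (k : ℕ) (i : IntExp) (e : WExp) (s : State) :
      Runs (.setWArr k i e) s
        { s with warr := Function.update s.warr k
                   (Function.update (s.warr k) (i.eval s) (e.eval s)) }
        (i.cost + e.cost + 1)
  | seq (P Q : Program) (s s' s'' : State) (c d : ℕ) :
      Runs P s s' c → Runs Q s' s'' d → Runs (.seq P Q) s s'' (c + d)
  | ite_true (t : Test) (P Q : Program) (s s' : State) (c : ℕ) :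
      t.Holds s → Runs P s s' c → Runs (.ite t P Q) s s' (t.cost + c)
  | ite_false (t : Test) (P Q : Program) (s s' : State) (c : ℕ) :
      ¬ t.Holds s → Runs Q s s' c → Runs (.ite t P Q) s s' (t.cost + c)
  | loop_stop (t : Test) (P : Program) (s : State) :
      ¬ t.Holds s → Runs (.loop t P) s s t.cost
  | loop_step (t : Test) (P : Program) (s s' s'' : State) (c d : ℕ) :
      t.Holds s → Runs P s s' c → Runs (.loop t P) s' s'' d →
        Runs (.loop t P) s s'' (t.cost + c + d)

/-! ### Input and output conventions -/

/-- The applicants in the order in which `σ` lists them are sorted by category: those of largest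
weight come first, then those of the second largest weight, and so on. -/
def Instance.ListsCategories (I : Instance) (σ : Equiv.Perm (Fin I.numApplicants)) : Prop :=
  ∀ i j, i ≤ j → I.weight (σ j) ≤ I.weight (σ i)

/-- The memory that holds the input.
* variable `0`: the number of applicants; variable `1`: the number of jobs;
* integer array `1`: the preference lists of applicants `0, 1, 2, ...`, one after the other;
* integer array `0`: cell `x` is the index in array `1` at which the list of `x` begins,
  for `x` up to and including the number of applicants;
* integer array `2`: the applicants, listed category by category;
* weight array `0`: cell `x` is the weight of applicant `x`.
All other cells are `0`. -/
noncomputable def Instance.input (I : Instance) (σ : Equiv.Perm (Fin I.numApplicants)) :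
    State where
  var v := if v = 0 then I.numApplicants else if v = 1 then I.numJobs else 0
  arr k i :=
    if k = 0 then
      if i ≤ I.numApplicants then ∑ y with y.val < i, (I.pref y).length else 0
    else if k = 1 then (((List.ofFn I.pref).flatten).map Fin.val).getD i 0
    else if k = 2 then
      if h : i < I.numApplicants then (σ ⟨i, h⟩).val else 0
    else 0
  wvar _ := 0
  warr k i := if k = 0 then if h : i < I.numApplicants then I.weight ⟨i, h⟩ else 0 else 0

/-- The final memory `s` reports the assignment `M`: variable `0` is `1`, and cell `x` of integer
array `3` is `0` if applicant `x` is free, and `p + 1` if `x` is given job `p`. -/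
def Instance.Reports (I : Instance) (s : State) (M : I.Assignment) : Prop :=
  s.var 0 = 1 ∧ ∀ x : Fin I.numApplicants, s.arr 3 x.val =
    match M x with
    | none => 0
    | some p => p.val + 1

/-- The final memory `s` reports that there is no popular matching: variable `0` is `0`. -/
def ReportsNone (s : State) : Prop := s.var 0 = 0

/-- `s` is a correct answer for the instance `I`: it reports a popular matching, or it reports
that there is none, and there is none. -/
def Instance.CorrectAnswer (I : Instance) (s : State) : Prop :=
  (∃ M, I.IsPopular M ∧ I.Reports s M) ∨ (ReportsNone s ∧ ¬ ∃ M, I.IsPopular M)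

end WeightedPopular

/-!
The proof gives a characterization of the popular matchings that leaves at most two outcomes for
every applicant, and an algorithm that looks for a matching of this kind.

*First choices.*  In order of non-increasing weight, the first choice `f x` of an applicant `x` is
the best job on its list that is not the first choice of somebody of larger weight.  If a popular
matching did not give such a job to an applicant whose first choice it is, then a promotion of at
most two applicants, at the cost of at most one applicant, would be more popular
(`IsPopular.filled`).  For the same reason an applicant that does not get its first choice gets the
best job that is nobody's first choice, its second choice, or stays free if there is none.

*Vacating costs.*  A matching of this form may still be improved by a chain of promotions, each to
a first choice of larger rank, at the end of which one applicant loses its job.  The least cost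
`lam p` of vacating a first choice `p` is computed from the larger ranks downwards, and does not
depend on the matching: it is determined by the holder of `p`, and when there are several
candidates, those that do not hold `p` envy the holder, which forces `lam p` to be their weight.
An outcome is allowed for `x` if vacating any better job costs enough
(`FirstAllowed`, `SecondAllowed`).  The chains, built in `IsPopular.exists_vacating`, show that
popular matchings use allowed outcomes only (`IsPopular.wellFormed`); conversely the costs `lam`,
read as prices of the jobs, are a dual certificate that proves popularity
(`isPopular_of_price`, `WellFormed.isPopular`).

*Finding the matching.*  With at most two allowed outcomes for everybody, the applicants are the
edges of a multigraph on the jobs, and an assignment is an orientation in which no two edges enter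
the same vertex.  Edges at leaves are oriented towards the leaves.  When there are no leaves left,
either there is a vertex of degree at least three, and then there are more edges than vertices
(`degree_le_two_of_orientation`), or the rest is a disjoint union of cycles.  Finally, applicants
are promoted to first choices that nobody has; this only vacates second choices.

*The running time.*  Programs are verified with one rule for loops, in which a potential pays for
the rounds (`exists_runs_loop`); that a program does not change what it does not write is proved
once and for all (`Runs.sameOutside`).  In the search for an orientation the potential is the total
length of the adjacency lists of the vertices that are not isolated: such a list is searched only
when its vertex is a leaf, and the vertex is isolated from then on.
-/

namespace WeightedPopular

/-! ### Swaps -/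

namespace Instance

variable (I : Instance)

/-- The contribution of `x` to the satisfaction, when it has `o` in the first matching and `o'` in
the second. -/
noncomputable def gain (x : Fin I.numApplicants) (o o' : Option (Fin I.numJobs)) : ℝ :=
  if I.place x o < I.place x o' then I.weight x
  else if I.place x o' < I.place x o then -I.weight x else 0

variable {I}

theorem satisfaction_eq_sum_gain (M M' : I.Assignment) :
    I.satisfaction M M' = ∑ x, I.gain x (M x) (M' x) := by
  unfold satisfaction
  rw [Finset.sum_filter, Finset.sum_filter, ← Finset.sum_sub_distrib]
  refine Finset.sum_congr rfl fun x _ => ?_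
  unfold gain Prefers
  by_cases h : I.place x (M x) < I.place x (M' x)
  · simp [h, h.not_gt]
  · by_cases h' : I.place x (M' x) < I.place x (M x) <;> simp [h, h']

theorem neg_weight_le_gain (x : Fin I.numApplicants) (o o') : -I.weight x ≤ I.gain x o o' := by
  have := I.weight_pos x
  unfold gain
  split_ifs <;> linarith

theorem gain_self (x : Fin I.numApplicants) (o) : I.gain x o o = 0 := by simp [gain]

theorem gain_of_lt {x : Fin I.numApplicants} {o o'} (h : I.place x o < I.place x o') :
    I.gain x o o' = I.weight x := by simp [gain, h]

theorem satisfaction_self (M : I.Assignment) : I.satisfaction M M = 0 := by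
  simp [satisfaction_eq_sum_gain, gain_self]

/-- How the satisfaction changes when one applicant gets another outcome. -/
theorem satisfaction_update (M' M : I.Assignment) (x : Fin I.numApplicants) (o) :
    I.satisfaction (Function.update M' x o) M =
      I.satisfaction M' M - I.gain x (M' x) (M x) + I.gain x o (M x) := by
  classical
  simp only [satisfaction_eq_sum_gain]
  rw [← Finset.add_sum_erase _ _ (Finset.mem_univ x),
    ← Finset.add_sum_erase (a := x) (f := fun y => I.gain y (M' y) (M y)) _ (Finset.mem_univ x)]
  rw [Finset.sum_congr rfl (g := fun y => I.gain y (M' y) (M y))]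
  · simp only [Function.update_self]; ring
  · intro y hy
    rw [Function.update_of_ne (Finset.ne_of_mem_erase hy)]

theorem IsMatching.free {M : I.Assignment} (h : I.IsMatching M) (x : Fin I.numApplicants) :
    I.IsMatching (Function.update M x none) := by
  constructor
  · intro y p hy
    by_cases hyx : y = x
    · subst hyx; simp at hy
    · rw [Function.update_of_ne hyx] at hy; exact h.1 y p hy
  · intro y z p hy hz
    by_cases hyx : y = x
    · subst hyx; simp at hy
    by_cases hzx : z = x
    · subst hzx; simp at hz
    rw [Function.update_of_ne hyx] at hy
    rw [Function.update_of_ne hzx] at hz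
    exact h.2 y z p hy hz

theorem IsMatching.assign {M : I.Assignment} (h : I.IsMatching M) {x : Fin I.numApplicants}
    {p : Fin I.numJobs} (hp : p ∈ I.pref x) (hfree : ∀ y, y ≠ x → M y ≠ some p) :
    I.IsMatching (Function.update M x (some p)) := by
  constructor
  · intro y q hy
    by_cases hyx : y = x
    · subst hyx; simp at hy; exact hy ▸ hp
    · rw [Function.update_of_ne hyx] at hy; exact h.1 y q hy
  · intro y z q hy hz
    by_cases hyx : y = x <;> by_cases hzx : z = x
    · rw [hyx, hzx]
    · subst hyx
      rw [Function.update_of_ne hzx] at hz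
      simp at hy; subst hy
      exact absurd hz (hfree z hzx)
    · subst hzx
      rw [Function.update_of_ne hyx] at hy
      simp at hz; subst hz
      exact absurd hy (hfree y hyx)
    · rw [Function.update_of_ne hyx] at hy
      rw [Function.update_of_ne hzx] at hz
      exact h.2 y z q hy hz

theorem place_some_lt_none {x : Fin I.numApplicants} {p : Fin I.numJobs} (hp : p ∈ I.pref x) :
    I.place x (some p) < I.place x none := List.idxOf_lt_length_of_mem hp

theorem place_injective {x : Fin I.numApplicants} {o o' : Option (Fin I.numJobs)}
    (ho : ∀ p, o = some p → p ∈ I.pref x) (ho' : ∀ p, o' = some p → p ∈ I.pref x)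
    (h : I.place x o = I.place x o') : o = o' := by
  rcases o with _ | p <;> rcases o' with _ | q
  · rfl
  · exact absurd h (place_some_lt_none (ho' q rfl)).ne'
  · exact absurd h (place_some_lt_none (ho p rfl)).ne
  · have := (List.idxOf_inj (ho p rfl)).1 h
    rw [this]

theorem IsPopular.satisfaction_le {M M' : I.Assignment} (h : I.IsPopular M)
    (h' : I.IsMatching M') : I.satisfaction M' M ≤ 0 := by
  by_contra hc
  exact h.2 ⟨M', h', not_le.1 hc⟩

/-- If `x` prefers `p` to what it has in a popular matching `M`, then emptying `p` without touching
`x` costs at least the weight of `x`. -/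
theorem IsPopular.weight_add_satisfaction_le {M M' : I.Assignment} (h : I.IsPopular M)
    (h' : I.IsMatching M') {x : Fin I.numApplicants} {p : Fin I.numJobs} (hp : p ∈ I.pref x)
    (hlt : I.place x (some p) < I.place x (M x)) (hx : M' x = M x)
    (hfree : ∀ y, M' y ≠ some p) : I.weight x + I.satisfaction M' M ≤ 0 := by
  have := h.satisfaction_le (h'.assign hp fun y _ => hfree y)
  rw [satisfaction_update, hx, gain_self, gain_of_lt hlt] at this
  linarith

theorem IsMatching.free_ne {M : I.Assignment} (h : I.IsMatching M) {y : Fin I.numApplicants}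
    {p : Fin I.numJobs} (hy : M y = some p) (z) : Function.update M y none z ≠ some p := by
  by_cases hz : z = y
  · subst hz; simp
  · rw [Function.update_of_ne hz]
    exact fun hc => hz (h.2 z y p hc hy)

theorem neg_weight_le_satisfaction_free (M : I.Assignment) (y : Fin I.numApplicants) :
    -I.weight y ≤ I.satisfaction (Function.update M y none) M := by
  rw [satisfaction_update, satisfaction_self, gain_self]
  linarith [neg_weight_le_gain y none (M y)]

/-- In a popular matching nobody envies the holder of smaller weight. -/
theorem IsPopular.weight_le_holder {M : I.Assignment} (h : I.IsPopular M)
    {x y : Fin I.numApplicants} {p : Fin I.numJobs} (hp : p ∈ I.pref x)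
    (hlt : I.place x (some p) < I.place x (M x)) (hy : M y = some p) :
    I.weight x ≤ I.weight y := by
  have hxy : x ≠ y := by
    rintro rfl
    rw [hy] at hlt; exact lt_irrefl _ hlt
  have := h.weight_add_satisfaction_le (h.1.free y) hp hlt
    (Function.update_of_ne hxy _ _) (h.1.free_ne hy)
  linarith [neg_weight_le_satisfaction_free M y]

theorem IsPopular.exists_holder {M : I.Assignment} (h : I.IsPopular M)
    {x : Fin I.numApplicants} {p : Fin I.numJobs} (hp : p ∈ I.pref x)
    (hlt : I.place x (some p) < I.place x (M x)) : ∃ y, M y = some p := by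
  by_contra hc
  push Not at hc
  have := h.weight_add_satisfaction_le h.1 hp hlt rfl hc
  rw [satisfaction_self] at this
  linarith [I.weight_pos x]

/-- A promotion of `x` to `p` and of the holder `y` of `p` to `q`: the holder of `q`, which loses
its job, weighs at least as much as `x` and `y` together. -/
theorem IsPopular.weight_add_le_holder {M : I.Assignment} (h : I.IsPopular M)
    {x y z : Fin I.numApplicants} {p q : Fin I.numJobs} (hp : p ∈ I.pref x)
    (hlt : I.place x (some p) < I.place x (M x)) (hy : M y = some p) (hq : q ∈ I.pref y)
    (hlt' : I.place y (some q) < I.place y (M y)) (hz : M z = some q) (hxz : x ≠ z) :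
    I.weight x + I.weight y ≤ I.weight z := by
  have hxy : x ≠ y := by rintro rfl; rw [hy] at hlt; exact lt_irrefl _ hlt
  have hyz : y ≠ z := by rintro rfl; rw [hz] at hlt'; exact lt_irrefl _ hlt'
  have hM' := (h.1.free z).assign (x := y) hq fun u _ => h.1.free_ne hz u
  have hpq : p ≠ q := by
    rintro rfl; exact hyz (h.1.2 _ _ _ hy hz)
  have := h.weight_add_satisfaction_le hM' hp hlt
    (by rw [Function.update_of_ne hxy, Function.update_of_ne hxz]) (by
      intro u
      by_cases hu : u = y
      · subst hu; simpa using hpq.symm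
      · rw [Function.update_of_ne hu]
        by_cases huz : u = z
        · subst huz; simp
        · rw [Function.update_of_ne huz]
          exact fun hc => hu (h.1.2 _ _ _ hc hy))
  rw [satisfaction_update, Function.update_of_ne hyz, gain_self, gain_of_lt hlt'] at this
  linarith [neg_weight_le_satisfaction_free M z]

/-- A price for every job, together charging nobody more than the held jobs are worth, certifies
popularity. -/
theorem isPopular_of_price {M : I.Assignment} (hM : I.IsMatching M) (price : Fin I.numJobs → ℝ)
    (hnonneg : ∀ p, 0 ≤ price p) (hheld : ∀ p, price p ≠ 0 → ∃ x, M x = some p)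
    (hle : ∀ x p, M x = some p → price p ≤ I.weight x)
    (hbetter : ∀ x q, q ∈ I.pref x → I.place x (some q) < I.place x (M x) →
      I.weight x + (M x).elim 0 price ≤ price q) : I.IsPopular M := by
  classical
  refine ⟨hM, ?_⟩
  rintro ⟨M', hM', hmore⟩
  refine absurd hmore (not_lt.2 ?_)
  -- nobody gains more than the increase in price of what it holds
  have key : ∀ x, I.gain x (M' x) (M x) ≤ (M' x).elim 0 price - (M x).elim 0 price := by
    intro x
    have h0 : ∀ o : Option (Fin I.numJobs), 0 ≤ o.elim 0 price := by
      rintro (_ | p) <;> simp [hnonneg]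
    have h1 : (M x).elim 0 price ≤ I.weight x := by
      rcases hx : M x with _ | p
      · simpa using (I.weight_pos x).le
      · exact hle x p hx
    rcases lt_trichotomy (I.place x (M' x)) (I.place x (M x)) with h | h | h
    · rw [gain_of_lt h]
      rcases hx : M' x with _ | q
      · exfalso
        rw [hx] at h
        rcases hx' : M x with _ | p
        · rw [hx'] at h; exact lt_irrefl _ h
        · rw [hx'] at h; exact h.not_gt (place_some_lt_none (hM.1 x p hx'))
      · rw [hx] at h
        have := hbetter x q (hM'.1 x q hx) h
        simp only [Option.elim_some]
        linarith
    · rw [place_injective (hM'.1 x) (hM.1 x) h, gain_self]; simp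
    · have : I.gain x (M' x) (M x) = -I.weight x := by simp [gain, h, h.not_gt]
      rw [this]
      linarith [h0 (M' x)]
  -- the total price of what is held is the total price of the held jobs
  have sum_eq : ∀ N : I.Assignment, I.IsMatching N →
      ∑ x, (N x).elim 0 price = ∑ p, if ∃ x, N x = some p then price p else 0 := by
    intro N hN
    have : ∀ x, (N x).elim 0 price = ∑ p, if N x = some p then price p else 0 := by
      intro x
      rcases N x with _ | p <;> simp
    simp only [this]
    rw [Finset.sum_comm]
    refine Finset.sum_congr rfl fun p _ => ?_
    split_ifs with h
    · obtain ⟨x, hx⟩ := h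
      rw [Finset.sum_eq_single x]
      · simp [hx]
      · intro y _ hy
        rw [if_neg]
        exact fun hc => hy (hN.2 _ _ _ hc hx)
      · simp
    · push Not at h
      simp [h]
  rw [satisfaction_eq_sum_gain]
  refine (Finset.sum_le_sum fun x _ => key x).trans ?_
  rw [Finset.sum_sub_distrib, sum_eq M hM, sum_eq M' hM', sub_nonpos]
  refine Finset.sum_le_sum fun p _ => ?_
  by_cases hp : price p = 0
  · simp [hp]
  · rw [if_pos (hheld p hp)]
    split_ifs
    · exact le_rfl
    · exact hnonneg p

end Instance

namespace Instance

/-! ### The characterization of popular matchings -/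

variable (I : Instance)

/-- `f x` is the *first choice* of `x`: the best job on its list that is not the first choice of an
applicant of larger weight (`none` if there is no such job).  The *rank* `F p` is the weight of the
applicants whose first choice is `p`, and `0` if there are none. -/
structure FirstChoice (F : Fin I.numJobs → ℝ) (f : Fin I.numApplicants → Option (Fin I.numJobs)) :
    Prop where
  mem : ∀ x p, f x = some p → p ∈ I.pref x
  rank_eq : ∀ x p, f x = some p → F p = I.weight x
  rank_gt : ∀ x q, q ∈ I.pref x → I.place x (some q) < I.place x (f x) → I.weight x < F q
  exists_of_ne : ∀ p, F p ≠ 0 → ∃ x, f x = some p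

/-- `lam p` is the least cost of vacating the first choice `p` by a chain of promotions that ends
with an applicant losing its job, if `p` is held by one of the applicants with first choice `p`;
`mu x` is this cost if `p` is held by `x`.  When several applicants have first choice `p`, those
not holding it envy the holder, and `lam p` has to be their weight. -/
structure VacatingCost (f : Fin I.numApplicants → Option (Fin I.numJobs))
    (lam : Fin I.numJobs → ℝ) (mu : Fin I.numApplicants → ℝ) : Prop where
  mu_le_weight : ∀ x, mu x ≤ I.weight x
  mu_le : ∀ x q, q ∈ I.pref x → I.place x (some q) < I.place x (f x) → mu x ≤ lam q - I.weight x
  mu_attained : ∀ x, mu x = I.weight x ∨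
    ∃ q ∈ I.pref x, I.place x (some q) < I.place x (f x) ∧ mu x = lam q - I.weight x
  sole : ∀ x p, f x = some p → (∀ y, f y = some p → y = x) → lam p = mu x
  several : ∀ x y p, f x = some p → f y = some p → y ≠ x → lam p = I.weight x
  zero : ∀ p, (∀ x, f x ≠ some p) → lam p = 0

/-- `x` may be given its first choice. -/
def FirstAllowed (f : Fin I.numApplicants → Option (Fin I.numJobs))
    (mu : Fin I.numApplicants → ℝ) (x : Fin I.numApplicants) : Prop :=
  ((∀ y, f y = f x → y = x) ∧ 0 ≤ mu x) ∨ I.weight x ≤ mu x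

/-- `o` is the best outcome for `x` outside the first choices (of all applicants), and `x` may be
given `o`: vacating any job that `x` prefers to `o` costs at least the weight of `x`. -/
structure SecondAllowed (F lam : Fin I.numJobs → ℝ) (x : Fin I.numApplicants)
    (o : Option (Fin I.numJobs)) : Prop where
  mem : ∀ p, o = some p → p ∈ I.pref x
  rank_eq_zero : ∀ p, o = some p → F p = 0
  rank_ne_zero : ∀ q, q ∈ I.pref x → I.place x (some q) < I.place x o → F q ≠ 0
  weight_le : ∀ q, q ∈ I.pref x → I.place x (some q) < I.place x o → I.weight x ≤ lam q

/-- The outcomes that `x` may be given: its first choice and its second choice, where allowed. -/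
def Allowed (F lam : Fin I.numJobs → ℝ) (f : Fin I.numApplicants → Option (Fin I.numJobs))
    (mu : Fin I.numApplicants → ℝ) (x : Fin I.numApplicants) (o : Option (Fin I.numJobs)) : Prop :=
  (o ≠ none ∧ o = f x ∧ I.FirstAllowed f mu x) ∨ I.SecondAllowed F lam x o

/-- Every first choice is held by an applicant whose first choice it is, and every applicant has
an allowed outcome. -/
structure WellFormed (F lam : Fin I.numJobs → ℝ)
    (f : Fin I.numApplicants → Option (Fin I.numJobs)) (mu : Fin I.numApplicants → ℝ)
    (M : I.Assignment) : Prop where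
  filled : ∀ p, F p ≠ 0 → ∃ x, f x = some p ∧ M x = some p
  allowed : ∀ x, I.Allowed F lam f mu x (M x)

variable {I} {F lam : Fin I.numJobs → ℝ} {f : Fin I.numApplicants → Option (Fin I.numJobs)}
  {mu : Fin I.numApplicants → ℝ} {M : I.Assignment}

theorem FirstChoice.rank_nonneg (hF : I.FirstChoice F f) (p) : 0 ≤ F p := by
  by_cases h : F p = 0
  · exact h.ge
  · obtain ⟨x, hx⟩ := hF.exists_of_ne p h
    rw [hF.rank_eq x p hx]
    exact (I.weight_pos x).le

theorem FirstChoice.rank_ne_zero (hF : I.FirstChoice F f) {x p} (h : f x = some p) : F p ≠ 0 := by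
  rw [hF.rank_eq x p h]
  exact (I.weight_pos x).ne'

theorem SecondAllowed.unique {x o o'} (h : I.SecondAllowed F lam x o)
    (h' : I.SecondAllowed F lam x o') : o = o' := by
  refine place_injective h.mem h'.mem ?_
  rcases lt_trichotomy (I.place x o) (I.place x o') with hlt | heq | hlt
  · rcases o with _ | p
    · rcases o' with _ | p'
      · rfl
      · exact absurd hlt (place_some_lt_none (h'.mem p' rfl)).not_gt
    · exact absurd (h.rank_eq_zero p rfl) (h'.rank_ne_zero p (h.mem p rfl) hlt)
  · exact heq
  · rcases o' with _ | p
    · rcases o with _ | p'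
      · rfl
      · exact absurd hlt (place_some_lt_none (h.mem p' rfl)).not_gt
    · exact absurd (h'.rank_eq_zero p rfl) (h.rank_ne_zero p (h'.mem p rfl) hlt)

theorem VacatingCost.le_weight (hl : I.VacatingCost f lam mu) {x p} (h : f x = some p) :
    lam p ≤ I.weight x := by
  by_cases hs : ∀ y, f y = some p → y = x
  · rw [hl.sole x p h hs]; exact hl.mu_le_weight x
  · push Not at hs
    obtain ⟨y, hy, hyx⟩ := hs
    exact (hl.several x y p h hy hyx).le

theorem VacatingCost.le_mu (hl : I.VacatingCost f lam mu) {x p} (h : f x = some p)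
    (ha : I.FirstAllowed f mu x) : lam p ≤ mu x ∧ 0 ≤ lam p := by
  by_cases hs : ∀ y, f y = some p → y = x
  · rw [hl.sole x p h hs]
    refine ⟨le_rfl, ?_⟩
    rcases ha with ha | ha
    · exact ha.2
    · linarith [I.weight_pos x]
  · push Not at hs
    obtain ⟨y, hy, hyx⟩ := hs
    rw [hl.several x y p h hy hyx]
    rcases ha with ha | ha
    · exact absurd (ha.1 y (hy.trans h.symm)) hyx
    · exact ⟨ha, (I.weight_pos x).le⟩

theorem WellFormed.isPopular (hF : I.FirstChoice F f) (hl : I.VacatingCost f lam mu)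
    (hM : I.IsMatching M) (hw : I.WellFormed F lam f mu M) : I.IsPopular M := by
  have hzero : ∀ p, F p = 0 → lam p = 0 := fun p hp =>
    hl.zero p fun x hx => hF.rank_ne_zero hx hp
  have hfirst : ∀ x p, f x = some p → M x = some p → I.FirstAllowed f mu x := by
    intro x p hf hx
    rcases hw.allowed x with h | h
    · exact h.2.2
    · exact absurd (h.rank_eq_zero p hx) (hF.rank_ne_zero hf)
  refine isPopular_of_price hM lam ?_ ?_ ?_ ?_
  · intro p
    by_cases hp : F p = 0
    · exact (hzero p hp).ge
    · obtain ⟨x, hf, hx⟩ := hw.filled p hp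
      exact (hl.le_mu hf (hfirst x p hf hx)).2
  · intro p hp
    obtain ⟨x, -, hx⟩ := hw.filled p fun h => hp (hzero p h)
    exact ⟨x, hx⟩
  · intro x p hx
    rcases hw.allowed x with h | h
    · exact hl.le_weight (h.2.1 ▸ hx)
    · rw [hzero p (h.rank_eq_zero p hx)]
      exact (I.weight_pos x).le
  · intro x q hq hlt
    rcases hw.allowed x with h | h
    · rcases hx : M x with _ | p
      · exact absurd hx h.1
      · have hf : f x = some p := h.2.1 ▸ hx
        rw [h.2.1] at hlt
        have h1 := hl.mu_le x q hq hlt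
        have h2 := (hl.le_mu hf h.2.2).1
        simp only [Option.elim_some]
        linarith
    · have h1 := h.weight_le q hq hlt
      rcases hx : M x with _ | p
      · simpa using h1
      · simp only [Option.elim_some, hzero p (h.rank_eq_zero p hx)]
        linarith

theorem FirstChoice.first_lt (hF : I.FirstChoice F f) {x p} (hp : p ∈ I.pref x)
    (hle : F p ≤ I.weight x) (hne : f x ≠ some p) : I.place x (f x) < I.place x (some p) := by
  rcases lt_trichotomy (I.place x (f x)) (I.place x (some p)) with h | h | h
  · exact h
  · exact absurd (place_injective (hF.mem x) (by rintro q ⟨⟩; exact hp) h) hne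
  · exact absurd (hF.rank_gt x p hp h) hle.not_gt

theorem FirstChoice.exists_first (hF : I.FirstChoice F f) {x p} (hp : p ∈ I.pref x)
    (hle : F p ≤ I.weight x) : ∃ q, f x = some q := by
  rcases hx : f x with _ | q
  · refine absurd (hF.rank_gt x p hp ?_) hle.not_gt
    rw [hx]; exact place_some_lt_none hp
  · exact ⟨q, rfl⟩

/-- In a popular matching, every first choice is held by an applicant whose first choice it is. -/
theorem IsPopular.filled (hF : I.FirstChoice F f) (h : I.IsPopular M) (x) :
    ∀ p, f x = some p → ∃ z, f z = some p ∧ M z = some p := by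
  -- induction on the weight of `x`, from the largest to the smallest
  induction hn : (Finset.univ.filter fun y => I.weight x < I.weight y).card
    using Nat.strong_induction_on generalizing x with
  | _ n ih =>
  subst hn
  have IH : ∀ y, I.weight x < I.weight y → ∀ p, f y = some p →
      ∃ z, f z = some p ∧ M z = some p := by
    intro y hy
    refine ih _ (Finset.card_lt_card ?_) y rfl
    refine ⟨fun u hu => ?_, fun hc => ?_⟩
    · simp only [Finset.mem_filter, Finset.mem_univ, true_and] at hu ⊢
      exact hy.trans hu
    · have := hc (x := y) (by simpa using hy)
      simp at this
  clear ih
  -- an applicant of the weight of `x` that is not given its first choice prefers it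
  have prefers : ∀ y p, I.weight y = I.weight x → f y = some p → M y ≠ some p →
      I.place y (some p) < I.place y (M y) := by
    intro y p hy hf hne
    rcases hM : M y with _ | q
    · exact place_some_lt_none (hF.mem y p hf)
    · have hq := h.1.1 y q hM
      rw [← hf]
      refine hF.first_lt hq ?_ (by rw [hf]; rintro ⟨⟩; exact hne hM)
      by_contra hc
      rw [not_le] at hc
      obtain ⟨u, hu⟩ := hF.exists_of_ne q ((I.weight_pos y).trans hc).ne'
      have hqu := hF.rank_eq u q hu
      obtain ⟨z, hz, hz'⟩ := IH u (by rw [← hqu, ← hy]; exact hc) q hu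
      obtain rfl := h.1.2 _ _ _ hz' hM
      rw [hF.rank_eq z q hz] at hc
      exact lt_irrefl _ hc
  -- applicants of larger weight do not hold the first choices of the weight of `x`
  have not_larger : ∀ y' p y, I.weight y' = I.weight x → f y' = some p → M y = some p →
      I.weight y ≤ I.weight x := by
    intro y' p y hy' hf hy
    by_contra hc
    rw [not_le] at hc
    have hp := h.1.1 y p hy
    have hrank := hF.rank_eq y' p hf
    have hle : F p ≤ I.weight y := by rw [hrank, hy']; exact hc.le
    obtain ⟨q, hq⟩ := hF.exists_first hp hle
    obtain ⟨z, hz, hz'⟩ := IH y hc q hq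
    have hne : M y' ≠ some p := fun hc' => by
      obtain rfl := h.1.2 _ _ _ hc' hy
      rw [hy'] at hc; exact lt_irrefl _ hc
    have hqp : f y ≠ some p := fun hc' => by
      have := hF.rank_eq y p hc'
      rw [hrank, hy'] at this; exact hc.ne this
    have hzy : I.weight z = I.weight y := by
      rw [← hF.rank_eq z q hz, hF.rank_eq y q hq]
    have hlt := hF.first_lt hp hle hqp
    rw [hq, ← hy] at hlt
    have := h.weight_add_le_holder (hF.mem y' p hf) (prefers y' p hy' hf hne) hy (hF.mem y q hq)
      hlt hz' (by rintro rfl; rw [hzy] at hy'; exact hc.ne hy'.symm)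
    linarith [I.weight_pos y']
  intro p hp
  by_cases hx : M x = some p
  · exact ⟨x, hp, hx⟩
  have hlt := prefers x p rfl hp hx
  obtain ⟨y, hy⟩ := h.exists_holder (hF.mem x p hp) hlt
  by_cases hfy : f y = some p
  · exact ⟨y, hfy, hy⟩
  exfalso
  have hwy : I.weight y = I.weight x := le_antisymm (not_larger x p y rfl hp hy)
    (h.weight_le_holder (hF.mem x p hp) hlt hy)
  have hrank := hF.rank_eq x p hp
  have hpy := h.1.1 y p hy
  have hle : F p ≤ I.weight y := by rw [hrank, hwy]
  obtain ⟨q, hq⟩ := hF.exists_first hpy hle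
  have hlt' := hF.first_lt hpy hle hfy
  rw [hq, ← hy] at hlt'
  obtain ⟨z, hz⟩ := h.exists_holder (hF.mem y q hq) hlt'
  have hwz := not_larger y q z hwy hq hz
  by_cases hxz : x = z
  · -- `x` and `y` hold each other's first choice: both gain by exchanging their jobs
    subst hxz
    have hxy : x ≠ y := by rintro rfl; exact hx hy
    have hpq : p ≠ q := by rintro rfl; exact hfy hq
    have hM1 := (h.1.free x).assign (x := y) (hF.mem y q hq) fun u _ => h.1.free_ne hz u
    have hM2 := hM1.assign (x := x) (hF.mem x p hp) (by
      intro u hu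
      by_cases huy : u = y
      · subst huy; simpa using hpq.symm
      · rw [Function.update_of_ne huy, Function.update_of_ne hu]
        exact fun hc => huy (h.1.2 _ _ _ hc hy))
    have := h.satisfaction_le hM2
    rw [satisfaction_update, satisfaction_update, satisfaction_update, satisfaction_self,
      gain_of_lt hlt, Function.update_of_ne hxy, Function.update_of_ne hxy.symm, gain_self,
      gain_self, gain_of_lt hlt', Function.update_self] at this
    linarith [I.weight_pos x, I.weight_pos y]
  · have := h.weight_add_le_holder (hF.mem x p hp) hlt hy (hF.mem y q hq) hlt' hz hxz
    linarith [I.weight_pos x]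

/-- In a popular matching, the job held by `y` can be vacated at cost `lam p`, disturbing besides
`y` only applicants of larger weight. -/
theorem IsPopular.exists_vacating (hF : I.FirstChoice F f) (hl : I.VacatingCost f lam mu)
    (h : I.IsPopular M) (y) : ∀ p, f y = some p → M y = some p →
    ∃ M', I.IsMatching M' ∧ (∀ x, M' x ≠ some p) ∧
      (∀ x, x ≠ y → I.weight x ≤ I.weight y → M' x = M x) ∧
      -lam p ≤ I.satisfaction M' M := by
  induction hn : (Finset.univ.filter fun x => I.weight y < I.weight x).card
    using Nat.strong_induction_on generalizing y with
  | _ n ih =>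
  subst hn
  intro p hp hy
  have demote : I.weight y ≤ lam p → ∃ M', I.IsMatching M' ∧ (∀ x, M' x ≠ some p) ∧
      (∀ x, x ≠ y → I.weight x ≤ I.weight y → M' x = M x) ∧
      -lam p ≤ I.satisfaction M' M := by
    intro hle
    refine ⟨_, h.1.free y, h.1.free_ne hy, fun x hx _ => Function.update_of_ne hx _ _, ?_⟩
    linarith [neg_weight_le_satisfaction_free M y]
  by_cases hs : ∀ x, f x = some p → x = y
  · -- either `y` loses its job, or it is promoted to `q`, which is vacated recursively
    rcases hl.mu_attained y with hmu | ⟨q, hq, hlt, hmu⟩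
    · exact demote (by rw [hl.sole y p hp hs, hmu])
    · have hrank := hF.rank_gt y q hq hlt
      obtain ⟨u, hu⟩ := hF.exists_of_ne q ((I.weight_pos y).trans hrank).ne'
      obtain ⟨z, hz, hz'⟩ := h.filled hF u q hu
      have hyz : I.weight y < I.weight z := by rwa [← hF.rank_eq z q hz]
      obtain ⟨M', hM', hfree, hsame, hsat⟩ := ih _ (Finset.card_lt_card (by
        refine ⟨fun u hu => ?_, fun hc => ?_⟩
        · simp only [Finset.mem_filter, Finset.mem_univ, true_and] at hu ⊢
          exact hyz.trans hu
        · have := hc (x := z) (by simpa using hyz)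
          simp at this)) z rfl q hz hz'
      have hM'y : M' y = M y := hsame y (by rintro rfl; exact lt_irrefl _ hyz) hyz.le
      refine ⟨_, hM'.assign (x := y) hq fun u _ => hfree u, ?_, ?_, ?_⟩
      · intro x
        by_cases hx : x = y
        · subst hx
          simp only [Function.update_self, ne_eq, Option.some.injEq]
          rintro rfl
          rw [hp] at hlt; exact lt_irrefl _ hlt
        · rw [Function.update_of_ne hx]
          exact fun hc => hx (hM'.2 _ _ _ hc (hM'y.trans hy))
      · intro x hx hle
        rw [Function.update_of_ne hx]
        exact hsame x (by rintro rfl; exact hle.not_gt hyz) (hle.trans hyz.le)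
      · rw [satisfaction_update, hM'y, gain_self, hl.sole y p hp hs, hmu,
          gain_of_lt (by rw [hy, ← hp]; exact hlt)]
        linarith
  · push Not at hs
    obtain ⟨x, hx, hxy⟩ := hs
    exact demote (hl.several y x p hp hx hxy).ge

/-- A popular matching satisfies the conditions of `WellFormed`. -/
theorem IsPopular.wellFormed (hF : I.FirstChoice F f) (hl : I.VacatingCost f lam mu)
    (h : I.IsPopular M) : I.WellFormed F lam f mu M := by
  have filled : ∀ p, F p ≠ 0 → ∃ x, f x = some p ∧ M x = some p := fun p hp => by
    obtain ⟨x, hx⟩ := hF.exists_of_ne p hp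
    exact h.filled hF x p hx
  -- what `x` envies costs at least its weight
  have envy : ∀ x q, q ∈ I.pref x → F q ≠ 0 → I.place x (some q) < I.place x (M x) →
      I.weight x ≤ lam q := by
    intro x q hq hFq hlt
    obtain ⟨y, hfy, hy⟩ := filled q hFq
    have hle := h.weight_le_holder hq hlt hy
    obtain ⟨M', hM', hfree, hsame, hsat⟩ := h.exists_vacating hF hl y q hfy hy
    have hxy : x ≠ y := by rintro rfl; rw [hy] at hlt; exact lt_irrefl _ hlt
    linarith [h.weight_add_satisfaction_le hM' hq hlt (hsame x hxy hle) hfree]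
  have second : ∀ x, (M x ≠ f x ∨ M x = none) → I.SecondAllowed F lam x (M x) := by
    intro x hx
    have hzero : ∀ p, M x = some p → F p = 0 := by
      intro p hp
      by_contra hFp
      obtain ⟨z, hz, hz'⟩ := filled p hFp
      obtain rfl := h.1.2 _ _ _ hz' hp
      rcases hx with hx | hx
      · exact hx (hp.trans hz.symm)
      · rw [hp] at hx; cases hx
    have hne : ∀ q, q ∈ I.pref x → I.place x (some q) < I.place x (M x) → F q ≠ 0 := by
      intro q hq hlt hFq
      obtain ⟨y, hy⟩ := h.exists_holder hq hlt
      have hqy := h.1.1 y q hy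
      have hle : F q ≤ I.weight y := hFq ▸ (I.weight_pos y).le
      obtain ⟨r, hr⟩ := hF.exists_first hqy hle
      have hry : f y ≠ some q := fun hc => hF.rank_ne_zero hc hFq
      have hlt' := hF.first_lt hqy hle hry
      rw [hr, ← hy] at hlt'
      obtain ⟨z, hz, hz'⟩ := filled r (hF.rank_ne_zero hr)
      have hxz : x ≠ z := by
        rintro rfl
        rcases hx with hx | hx
        · exact hx (hz'.trans hz.symm)
        · rw [hz'] at hx; cases hx
      have := h.weight_add_le_holder hq hlt hy (hF.mem y r hr) hlt' hz' hxz
      have hw : I.weight z = I.weight y := by rw [← hF.rank_eq z r hz, hF.rank_eq y r hr]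
      linarith [I.weight_pos x]
    exact ⟨h.1.1 x, hzero, hne, fun q hq hlt => envy x q hq (hne q hq hlt) hlt⟩
  refine ⟨filled, fun x => ?_⟩
  by_cases hx : M x ≠ f x ∨ M x = none
  · exact Or.inr (second x hx)
  push Not at hx
  refine Or.inl ⟨hx.2, hx.1, ?_⟩
  obtain ⟨p, hp⟩ := Option.ne_none_iff_exists'.1 hx.2
  have hfp : f x = some p := hx.1 ▸ hp
  by_cases hs : ∀ y, f y = f x → y = x
  · refine Or.inl ⟨hs, ?_⟩
    rcases hl.mu_attained x with hmu | ⟨q, hq, hlt, hmu⟩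
    · rw [hmu]; exact (I.weight_pos x).le
    · have hFq := ((I.weight_pos x).trans (hF.rank_gt x q hq hlt)).ne'
      rw [← hx.1] at hlt
      linarith [envy x q hq hFq hlt]
  · push Not at hs
    obtain ⟨y, hy, hyx⟩ := hs
    rw [hfp] at hy
    refine Or.inr ?_
    rcases hl.mu_attained x with hmu | ⟨q, hq, hlt, hmu⟩
    · exact hmu.ge
    -- `y` could be promoted to `p`, and `x` to `q`
    have hrank := hF.rank_gt x q hq hlt
    have hxy : I.weight x = I.weight y := by rw [← hF.rank_eq x p hfp, hF.rank_eq y p hy]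
    obtain ⟨z, hfz, hz⟩ := filled q ((I.weight_pos x).trans hrank).ne'
    rw [hF.rank_eq z q hfz] at hrank
    obtain ⟨M', hM', hfree, hsame, hsat⟩ := h.exists_vacating hF hl z q hfz hz
    have hxz : x ≠ z := by rintro rfl; exact lt_irrefl _ hrank
    have hyz : y ≠ z := by rintro rfl; rw [hxy] at hrank; exact lt_irrefl _ hrank
    have hM'x := hsame x hxz hrank.le
    have hM'y := hsame y hyz (hxy ▸ hrank.le)
    have hMy : M y ≠ f y := fun hc => hyx (h.1.2 _ _ _ (hc.trans hy) hp)
    have hlty : I.place y (some p) < I.place y (M y) := by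
      rcases hMy' : M y with _ | r
      · exact place_some_lt_none (hF.mem y p hy)
      · rw [← hy]
        refine hF.first_lt (h.1.1 y r hMy') ?_ (by rw [← hMy']; exact hMy.symm)
        rw [(second y (Or.inl hMy)).rank_eq_zero r hMy']
        exact (I.weight_pos y).le
    rw [← hx.1] at hlt
    have hqp : q ≠ p := by rintro rfl; rw [hp] at hlt; exact lt_irrefl _ hlt
    have := h.weight_add_satisfaction_le (hM'.assign (x := x) hq fun u _ => hfree u)
      (hF.mem y p hy) hlty (by rw [Function.update_of_ne hyx, hM'y]) (by
        intro u
        by_cases hu : u = x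
        · subst hu; simpa using hqp
        · rw [Function.update_of_ne hu]
          exact fun hc => hu (hM'.2 _ _ _ hc (hM'x.trans hp)))
    rw [satisfaction_update, hM'x, gain_self, gain_of_lt hlt] at this
    linarith

end Instance

/-! ### Reasoning about programs -/

namespace Program

/-- The integer variables that a program may write. -/
def vars : Program → List ℕ
  | setVar v _ => [v]
  | seq P Q => P.vars ++ Q.vars
  | ite _ P Q => P.vars ++ Q.vars
  | loop _ P => P.vars
  | _ => []

/-- The integer arrays that a program may write. -/
def arrs : Program → List ℕ
  | setArr k _ _ => [k]
  | seq P Q => P.arrs ++ Q.arrs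
  | ite _ P Q => P.arrs ++ Q.arrs
  | loop _ P => P.arrs
  | _ => []

/-- The weight variables that a program may write. -/
def wvars : Program → List ℕ
  | setWVar v _ => [v]
  | seq P Q => P.wvars ++ Q.wvars
  | ite _ P Q => P.wvars ++ Q.wvars
  | loop _ P => P.wvars
  | _ => []

/-- The weight arrays that a program may write. -/
def warrs : Program → List ℕ
  | setWArr k _ _ => [k]
  | seq P Q => P.warrs ++ Q.warrs
  | ite _ P Q => P.warrs ++ Q.warrs
  | loop _ P => P.warrs
  | _ => []

/-- A bound on the number of steps of a program without loops. -/
def size : Program → ℕ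
  | skip => 1
  | setVar _ e => e.cost + 1
  | setArr _ i e => i.cost + e.cost + 1
  | setWVar _ e => e.cost + 1
  | setWArr _ i e => i.cost + e.cost + 1
  | seq P Q => P.size + Q.size
  | ite t P Q => t.cost + (P.size + Q.size)
  | loop _ _ => 0

/-- The weakest precondition of `post`, for programs without loops. -/
def wp : Program → (State → Prop) → State → Prop
  | skip, post, s => post s
  | setVar v e, post, s => post { s with var := Function.update s.var v (e.eval s) }
  | setArr k i e, post, s =>
      post { s with arr := Function.update s.arr k
                      (Function.update (s.arr k) (i.eval s) (e.eval s)) }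
  | setWVar v e, post, s => post { s with wvar := Function.update s.wvar v (e.eval s) }
  | setWArr k i e, post, s =>
      post { s with warr := Function.update s.warr k
                      (Function.update (s.warr k) (i.eval s) (e.eval s)) }
  | seq P Q, post, s => P.wp (Q.wp post) s
  | ite t P Q, post, s => (t.Holds s → P.wp post s) ∧ (¬ t.Holds s → Q.wp post s)
  | loop _ _, _, _ => False

/-- `s` and `s'` differ at most in what `P` may write. -/
structure SameOutside (P : Program) (s s' : State) : Prop where
  var : ∀ v, v ∉ P.vars → s'.var v = s.var v
  arr : ∀ k, k ∉ P.arrs → s'.arr k = s.arr k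
  wvar : ∀ v, v ∉ P.wvars → s'.wvar v = s.wvar v
  warr : ∀ k, k ∉ P.warrs → s'.warr k = s.warr k

theorem SameOutside.refl (P : Program) (s : State) : P.SameOutside s s :=
  ⟨fun _ _ => rfl, fun _ _ => rfl, fun _ _ => rfl, fun _ _ => rfl⟩

theorem SameOutside.trans {P : Program} {s s' s'' : State} (h : P.SameOutside s s')
    (h' : P.SameOutside s' s'') : P.SameOutside s s'' :=
  ⟨fun v hv => (h'.var v hv).trans (h.var v hv), fun v hv => (h'.arr v hv).trans (h.arr v hv),
    fun v hv => (h'.wvar v hv).trans (h.wvar v hv), fun v hv => (h'.warr v hv).trans (h.warr v hv)⟩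

theorem SameOutside.mono {P Q : Program} {s s' : State} (h : P.SameOutside s s')
    (h1 : P.vars ⊆ Q.vars) (h2 : P.arrs ⊆ Q.arrs) (h3 : P.wvars ⊆ Q.wvars)
    (h4 : P.warrs ⊆ Q.warrs) : Q.SameOutside s s' :=
  ⟨fun v hv => h.var v fun hc => hv (h1 hc), fun v hv => h.arr v fun hc => hv (h2 hc),
    fun v hv => h.wvar v fun hc => hv (h3 hc), fun v hv => h.warr v fun hc => hv (h4 hc)⟩

end Program

open Program

theorem Runs.sameOutside {P : Program} {s s' : State} {c : ℕ} (h : Runs P s s' c) :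
    P.SameOutside s s' := by
  induction h with
  | skip s => exact SameOutside.refl _ _
  | setVar v e s =>
    refine ⟨fun u hu => ?_, fun _ _ => rfl, fun _ _ => rfl, fun _ _ => rfl⟩
    exact Function.update_of_ne (by simpa [vars] using hu) _ _
  | setArr k i e s =>
    refine ⟨fun _ _ => rfl, fun u hu => ?_, fun _ _ => rfl, fun _ _ => rfl⟩
    exact Function.update_of_ne (by simpa [arrs] using hu) _ _
  | setWVar v e s =>
    refine ⟨fun _ _ => rfl, fun _ _ => rfl, fun u hu => ?_, fun _ _ => rfl⟩
    exact Function.update_of_ne (by simpa [wvars] using hu) _ _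
  | setWArr k i e s =>
    refine ⟨fun _ _ => rfl, fun _ _ => rfl, fun _ _ => rfl, fun u hu => ?_⟩
    exact Function.update_of_ne (by simpa [warrs] using hu) _ _
  | seq P Q s s' s'' c d _ _ ih ih' =>
    refine SameOutside.trans (ih.mono ?_ ?_ ?_ ?_) (ih'.mono ?_ ?_ ?_ ?_) <;>
      simp [vars, arrs, wvars, warrs]
  | ite_true t P Q s s' c _ _ ih =>
    refine ih.mono ?_ ?_ ?_ ?_ <;> simp [vars, arrs, wvars, warrs]
  | ite_false t P Q s s' c _ _ ih =>
    refine ih.mono ?_ ?_ ?_ ?_ <;> simp [vars, arrs, wvars, warrs]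
  | loop_stop t P s _ => exact SameOutside.refl _ _
  | loop_step t P s s' s'' c d _ _ _ ih ih' =>
    refine SameOutside.trans (ih.mono ?_ ?_ ?_ ?_) ih' <;> simp [vars, arrs, wvars, warrs]

/-- A program without loops establishes `post` if its weakest precondition holds, in at most
`P.size` steps. -/
theorem exists_runs_of_wp {P : Program} {post : State → Prop} {s : State} (h : P.wp post s) :
    ∃ s' c, Runs P s s' c ∧ c ≤ P.size ∧ post s' := by
  induction P generalizing post s with
  | skip => exact ⟨_, _, Runs.skip s, le_rfl, h⟩
  | setVar v e => exact ⟨_, _, Runs.setVar v e s, le_rfl, h⟩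
  | setArr k i e => exact ⟨_, _, Runs.setArr k i e s, le_rfl, h⟩
  | setWVar v e => exact ⟨_, _, Runs.setWVar v e s, le_rfl, h⟩
  | setWArr k i e => exact ⟨_, _, Runs.setWArr k i e s, le_rfl, h⟩
  | seq P Q ihP ihQ =>
    obtain ⟨s', c, hr, hc, h'⟩ := ihP h
    obtain ⟨s'', d, hr', hd, h''⟩ := ihQ h'
    exact ⟨s'', c + d, hr.seq _ _ _ _ _ _ _ hr', Nat.add_le_add hc hd, h''⟩
  | ite t P Q ihP ihQ =>
    by_cases ht : t.Holds s
    · obtain ⟨s', c, hr, hc, h'⟩ := ihP (h.1 ht)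
      exact ⟨s', _, Runs.ite_true t P Q s s' c ht hr, by simp only [size]; omega, h'⟩
    · obtain ⟨s', c, hr, hc, h'⟩ := ihQ (h.2 ht)
      exact ⟨s', _, Runs.ite_false t P Q s s' c ht hr, by simp only [size]; omega, h'⟩
  | loop t P _ => exact h.elim

theorem Test.cost_pos (t : Test) : 0 < t.cost := by
  cases t <;> simp [Test.cost]

/-- The rule for loops: `Inv` is an invariant, and the potential `φ` pays for every round. -/
theorem exists_runs_loop (t : Test) (P : Program) (Inv : State → Prop) (φ : State → ℕ)
    (s₀ : State) (h₀ : Inv s₀)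
    (step : ∀ s, P.SameOutside s₀ s → Inv s → t.Holds s →
      ∃ s' c, Runs P s s' c ∧ Inv s' ∧ t.cost + c + φ s' ≤ φ s) :
    ∃ s' c, Runs (.loop t P) s₀ s' c ∧ P.SameOutside s₀ s' ∧ Inv s' ∧ ¬ t.Holds s' ∧
      c + φ s' ≤ φ s₀ + t.cost := by
  -- tests cost at least one step, so the potential decreases from round to round
  suffices H : ∀ n s, φ s = n → P.SameOutside s₀ s → Inv s →
      ∃ s' c, Runs (.loop t P) s s' c ∧ P.SameOutside s₀ s' ∧ Inv s' ∧ ¬ t.Holds s' ∧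
        c + φ s' ≤ φ s + t.cost from
    H _ s₀ rfl (SameOutside.refl _ _) h₀
  intro n
  induction n using Nat.strong_induction_on with
  | _ n ih =>
  intro s hn hs hI
  by_cases ht : t.Holds s
  · obtain ⟨s', c, hr, hI', hc⟩ := step s hs hI ht
    have := t.cost_pos
    obtain ⟨s'', d, hr', hs'', hI'', ht'', hd⟩ :=
      ih (φ s') (by omega) s' rfl (hs.trans hr.sameOutside) hI'
    exact ⟨s'', _, Runs.loop_step t P s s' s'' c d ht hr hr', hs'', hI'', ht'', by omega⟩
  · exact ⟨s, _, Runs.loop_stop t P s ht, hs, hI, ht, by omega⟩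

/-- `P` for all values `0, 1, …` of variable `2` below the value of `N`. -/
def forLoop (N : IntExp) (P : Program) : Program :=
  .seq (.setVar 2 (.const 0))
    (.loop (.lt (.var 2) N) (.seq P (.setVar 2 (.succ (.var 2)))))

/-- The rule for `forLoop`: `Inv i` holds before round `i`, and round `i` costs at most `K i`,
besides what the potential `φ` pays for. -/
theorem exists_runs_forLoop (v : ℕ) (P : Program) (Inv : ℕ → State → Prop) (φ : State → ℕ)
    (K : ℕ → ℕ) (s₀ : State) (hv : v ∉ P.vars) (hv2 : v ≠ 2) (h2 : 2 ∉ P.vars)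
    (hInv : ∀ i s n, Inv i s → Inv i { s with var := Function.update s.var 2 n })
    (hφ : ∀ s n, φ { s with var := Function.update s.var 2 n } = φ s)
    (h₀ : Inv 0 s₀)
    (step : ∀ i s, (forLoop (.var v) P).SameOutside s₀ s → i < s₀.var v → s.var 2 = i → Inv i s →
      ∃ s' c, Runs P s s' c ∧ Inv (i + 1) s' ∧ c + φ s' ≤ φ s + K i) :
    ∃ s' c, Runs (forLoop (.var v) P) s₀ s' c ∧ Inv (s₀.var v) s' ∧
      c + φ s' ≤ φ s₀ + ∑ i ∈ Finset.range (s₀.var v), K i + 6 * s₀.var v + 5 := by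
  set s₁ : State := { s₀ with var := Function.update s₀.var 2 0 } with hs₁
  have hN : s₁.var v = s₀.var v := by simp [hs₁, Function.update_of_ne hv2]
  have hvs : ∀ u, u ∈ (Program.seq P (.setVar 2 (.succ (.var 2)))).vars ↔ u ∈ P.vars ∨ u = 2 := by
    simp [vars]
  have h01 : (forLoop (.var v) P).SameOutside s₀ s₁ := by
    refine ⟨fun u hu => Function.update_of_ne ?_ _ _, fun _ _ => rfl, fun _ _ => rfl,
      fun _ _ => rfl⟩
    rintro rfl
    simp [forLoop, vars] at hu
  obtain ⟨s', c, hr, hs', hI, ht, hc⟩ := exists_runs_loop (.lt (.var 2) (.var v))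
    (.seq P (.setVar 2 (.succ (.var 2))))
    (fun s => s.var 2 ≤ s₀.var v ∧ Inv (s.var 2) s)
    (fun s => φ s + ∑ i ∈ Finset.Ico (s.var 2) (s₀.var v), (K i + 6)) s₁
    ⟨by simp [hs₁], by
      have : s₁.var 2 = 0 := by simp [hs₁]
      rw [this]; exact hInv 0 s₀ 0 h₀⟩ (by
      rintro s hs ⟨hle, hI⟩ ht
      have hv' : s.var v = s₀.var v := by
        rw [hs.var v (by rw [hvs]; simp [hv, hv2]), hN]
      have hlt : s.var 2 < s₀.var v := by
        simpa [Test.Holds, IntExp.eval, hv'] using ht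
      obtain ⟨s', c, hr, hI', hc⟩ := step (s.var 2) s
        (h01.trans (hs.mono (by simp [forLoop, vars]) (by simp [forLoop, arrs])
          (by simp [forLoop, wvars]) (by simp [forLoop, warrs]))) hlt rfl hI
      have h2' : s'.var 2 = s.var 2 := hr.sameOutside.var 2 h2
      refine ⟨_, _, Runs.seq _ _ _ _ _ _ _ hr (Runs.setVar _ _ _), ?_, ?_⟩
      · simp only [IntExp.eval, Function.update_self, h2']
        exact ⟨hlt, hInv _ _ _ hI'⟩
      · rw [hφ]
        simp only [IntExp.eval, Function.update_self, h2', IntExp.cost, Test.cost]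
        rw [Finset.sum_eq_sum_Ico_succ_bot hlt]
        omega)
  have hv' : s'.var v = s₀.var v := by
    rw [hs'.var v (by rw [hvs]; simp [hv, hv2]), hN]
  have hend : s'.var 2 = s₀.var v := by
    have : ¬ s'.var 2 < s₀.var v := by simpa [Test.Holds, IntExp.eval, hv'] using ht
    omega
  refine ⟨s', _, Runs.seq _ _ _ _ _ _ _ (Runs.setVar _ _ _) hr, hend ▸ hI.2, ?_⟩
  have e1 : s₁.var 2 = 0 := by simp [hs₁]
  simp only [e1, hend, Finset.Ico_self, Finset.sum_empty, Nat.Ico_zero_eq_range,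
    Finset.sum_add_distrib, Finset.sum_const, Finset.card_range, smul_eq_mul, Test.cost,
    IntExp.cost] at hc ⊢
  rw [show φ s₁ = φ s₀ from hφ s₀ 0] at hc
  omega

/-! ### Reading the input -/

namespace Instance

variable (I : Instance)

/-- The index at which the list of applicant `x` begins. -/
def start (x : ℕ) : ℕ := ∑ y with y.val < x, (I.pref y).length

/-- `s` still holds the input. -/
structure HasInput (σ : Equiv.Perm (Fin I.numApplicants)) (s : State) : Prop where
  var_zero : s.var 0 = I.numApplicants
  var_one : s.var 1 = I.numJobs
  starts : s.arr 0 = (I.input σ).arr 0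
  lists : s.arr 1 = (I.input σ).arr 1
  order : s.arr 2 = (I.input σ).arr 2
  weights : s.warr 0 = (I.input σ).warr 0

variable {I} {σ : Equiv.Perm (Fin I.numApplicants)} {s : State}

theorem start_succ (x : Fin I.numApplicants) :
    I.start (x.val + 1) = I.start x + (I.pref x).length := by
  unfold start
  have : (Finset.univ.filter fun y : Fin I.numApplicants => y.val < x.val + 1) =
      insert x (Finset.univ.filter fun y : Fin I.numApplicants => y.val < x.val) := by
    ext y
    simp only [Finset.mem_filter, Finset.mem_univ, true_and, Finset.mem_insert, Fin.ext_iff]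
    omega
  rw [this, Finset.sum_insert (by simp), add_comm]

theorem HasInput.start_eq (h : I.HasInput σ s) {x : ℕ} (hx : x ≤ I.numApplicants) :
    s.arr 0 x = I.start x := by
  rw [h.starts]
  simp [input, start, hx]

theorem HasInput.weight_eq (h : I.HasInput σ s) (x : Fin I.numApplicants) :
    s.warr 0 x.val = I.weight x := by
  rw [h.weights]
  simp [input]

theorem HasInput.order_eq (h : I.HasInput σ s) (x : Fin I.numApplicants) :
    s.arr 2 x.val = (σ x).val := by
  rw [h.order]
  simp [input]

theorem HasInput.list_eq (h : I.HasInput σ s) (x : Fin I.numApplicants) {k : ℕ}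
    (hk : k < (I.pref x).length) :
    s.arr 1 (I.start x + k) = ((I.pref x)[k]).val := by
  -- induction on the number of applicants needs arbitrary families of lists
  have aux : ∀ {n m : ℕ} (g : Fin n → List (Fin m)) (x : Fin n) (k : ℕ) (hk : k < (g x).length),
      ((List.ofFn g).flatten.map Fin.val).getD
        ((∑ y with y.val < x.val, (g y).length) + k) 0 = ((g x)[k]).val := by
    intro n m g
    induction n with
    | zero => exact fun x => x.elim0
    | succ n ih =>
      intro x k hk
      rw [List.ofFn_succ, List.flatten_cons, List.map_append]
      refine Fin.cases (fun k hk => ?_) (fun x k hk => ?_) x k hk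
      · simp only [Fin.val_zero, not_lt_zero, Finset.filter_false, Finset.sum_empty, zero_add]
        rw [List.getD_append _ _ _ _ (by simpa using hk)]
        simp [List.getD_eq_getElem?_getD, hk]
      · have hs : (∑ y with y.val < (Fin.succ x).val, (g y).length) =
            (g 0).length + ∑ y with y.val < x.val, (g (Fin.succ y)).length := by
          rw [Finset.sum_filter, Fin.sum_univ_succ, Finset.sum_filter]
          simp
        rw [hs, List.getD_append_right _ _ _ _ (by simp; omega)]
        rw [List.length_map, show (g 0).length + (∑ y with y.val < x.val, (g (Fin.succ y)).length)
          + k - (g 0).length = (∑ y with y.val < x.val, (g (Fin.succ y)).length) + k by omega]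
        exact ih (fun y => g y.succ) x k hk
  rw [h.lists]
  simpa [input, start] using aux I.pref x k hk

theorem hasInput_input : I.HasInput σ (I.input σ) := by
  refine ⟨?_, ?_, rfl, rfl, rfl, rfl⟩ <;> simp [input]

/-- Programs that do not write the input keep it; for a concrete program the side conditions are
decidable. -/
theorem HasInput.of_sameOutside {P : Program} {s' : State} (h : I.HasInput σ s)
    (hs : P.SameOutside s s') (hv : 0 ∉ P.vars ∧ 1 ∉ P.vars := by decide)
    (ha : 0 ∉ P.arrs ∧ 1 ∉ P.arrs ∧ 2 ∉ P.arrs := by decide) (hw : 0 ∉ P.warrs := by decide) :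
    I.HasInput σ s' :=
  ⟨(hs.var 0 hv.1).trans h.var_zero, (hs.var 1 hv.2).trans h.var_one,
    (hs.arr 0 ha.1).trans h.starts, (hs.arr 1 ha.2.1).trans h.lists,
    (hs.arr 2 ha.2.2).trans h.order, (hs.warr 0 hw).trans h.weights⟩

/-- The entry at the place of a listed job is that job. -/
theorem HasInput.list_place (h : I.HasInput σ s) {x : Fin I.numApplicants} {p : Fin I.numJobs}
    (hp : p ∈ I.pref x) : s.arr 1 (I.start x + I.place x (some p)) = p.val := by
  have := List.idxOf_lt_length_of_mem hp
  rw [h.list_eq x (by exact this)]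
  simp [place]

theorem sum_length_eq (τ : Equiv.Perm (Fin I.numApplicants)) :
    ∑ i ∈ Finset.range I.numApplicants,
      (if h : i < I.numApplicants then (I.pref (τ ⟨i, h⟩)).length else 0) = I.numEdges := by
  rw [Finset.sum_range]
  simp only [Fin.is_lt, dite_true, Fin.eta]
  exact Equiv.sum_comp τ fun x => (I.pref x).length

end Instance

/-- With the list of applicant `x` (variable `3`) ending at index `start[x + 1]`, run `B` and
advance the index (variable `4`) as long as there is a next entry and `t` holds. -/
def scan (t : Test) (B : Program) : Program :=
  .loop (.and (.lt (.var 4) (.get 0 (.succ (.var 3)))) t) (.seq B (.setVar 4 (.succ (.var 4))))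

/-- The rule for `scan`: `Inv k` holds when `k` entries of the list have been passed. -/
theorem exists_runs_scan {I : Instance} {σ : Equiv.Perm (Fin I.numApplicants)}
    (t : Test) (B : Program) (Inv : ℕ → State → Prop)
    (x : Fin I.numApplicants) (s₀ : State) (hs₀ : I.HasInput σ s₀) (hx : s₀.var 3 = x)
    (he : s₀.var 4 = I.start x) (h₀ : Inv 0 s₀)
    (h3 : 3 ∉ B.vars) (h4 : 4 ∉ B.vars) (hA : 0 ∉ B.arrs)
    (hInv : ∀ k s n, Inv k s → Inv k { s with var := Function.update s.var 4 n })
    (step : ∀ k s, (scan t B).SameOutside s₀ s → (hk : k < (I.pref x).length) →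
      s.var 4 = I.start x + k → Inv k s → t.Holds s → B.wp (Inv (k + 1)) s) :
    ∃ s' c k, Runs (scan t B) s₀ s' c ∧ k ≤ (I.pref x).length ∧ s'.var 4 = I.start x + k ∧
      Inv k s' ∧ (k < (I.pref x).length → ¬ t.Holds s') ∧
      c ≤ (t.cost + B.size + 9) * ((I.pref x).length + 1) := by
  have hsucc := Instance.start_succ x
  have hbound : ∀ s, (Program.seq B (.setVar 4 (.succ (.var 4)))).SameOutside s₀ s →
      (IntExp.get 0 (.succ (.var 3))).eval s = I.start x + (I.pref x).length := by
    intro s hs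
    simp only [IntExp.eval]
    rw [hs.arr 0 (by simpa [arrs] using hA), hs.var 3 (by simp [vars, h3]), hx,
      hs₀.start_eq x.2, hsucc]
  obtain ⟨s', c, hr, hs', ⟨k, hk, he', hI⟩, ht, hc⟩ := exists_runs_loop
    (.and (.lt (.var 4) (.get 0 (.succ (.var 3)))) t) (.seq B (.setVar 4 (.succ (.var 4))))
    (fun s => ∃ k, k ≤ (I.pref x).length ∧ s.var 4 = I.start x + k ∧ Inv k s)
    (fun s => (t.cost + B.size + 9) * (I.start x + (I.pref x).length - s.var 4)) s₀
    ⟨0, Nat.zero_le _, he, h₀⟩ (by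
      rintro s hs ⟨k, hk, he, hI⟩ ⟨hlt, ht⟩
      simp only [Test.Holds, hbound s hs] at hlt
      have hk' : k < (I.pref x).length := by simp only [IntExp.eval] at hlt; omega
      obtain ⟨s', c, hr, hc, hI'⟩ := exists_runs_of_wp
        (step k s ⟨hs.var, hs.arr, hs.wvar, hs.warr⟩ hk' he hI ht)
      have he' : s'.var 4 = s.var 4 := hr.sameOutside.var 4 h4
      refine ⟨_, _, Runs.seq _ _ _ _ _ _ _ hr (Runs.setVar _ _ _),
        ⟨k + 1, hk', ?_, hInv _ _ _ hI'⟩, ?_⟩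
      · simp [IntExp.eval, he', he]; omega
      · simp only [IntExp.eval, Function.update_self, he', he, Test.cost, IntExp.cost]
        rw [show I.start x + (I.pref x).length - (I.start x + k) =
          (I.start x + (I.pref x).length - (I.start x + k + 1)) + 1 by omega, Nat.mul_succ]
        omega)
  refine ⟨s', c, k, hr, hk, he', hI, ?_, ?_⟩
  · intro hk' ht'
    refine ht ⟨?_, ht'⟩
    simp only [Test.Holds, hbound s' hs']
    simp only [IntExp.eval]; omega
  · rw [he] at hc
    simp only [Test.cost, IntExp.cost] at hc
    rw [Nat.mul_succ]
    have : I.start x + (I.pref x).length - I.start x = (I.pref x).length := by omega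
    rw [this] at hc
    omega

/-- A scan that only looks for an entry: it stops at the best outcome `o` such that the test fails
at `o` (if it is a job); `C` says of which jobs the test holds. -/
theorem exists_runs_scan_skip {I : Instance} {σ : Equiv.Perm (Fin I.numApplicants)}
    (t : Test) (C : Fin I.numJobs → Prop)
    (x : Fin I.numApplicants) (s₀ : State) (hs₀ : I.HasInput σ s₀) (hx : s₀.var 3 = x)
    (he : s₀.var 4 = I.start x)
    (ht : ∀ s p, (scan t .skip).SameOutside s₀ s → s.arr 1 (s.var 4) = p.val →
      (t.Holds s ↔ C p)) :
    ∃ s' c o, Runs (scan t .skip) s₀ s' c ∧ s'.var 4 = I.start x + I.place x o ∧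
      (∀ p, o = some p → p ∈ I.pref x ∧ ¬ C p) ∧
      (∀ q, q ∈ I.pref x → I.place x (some q) < I.place x o → C q) ∧
      c ≤ (t.cost + 10) * ((I.pref x).length + 1) := by
  have hin : ∀ s, (scan t .skip).SameOutside s₀ s → I.HasInput σ s := fun s hs =>
    hs₀.of_sameOutside hs (by simp [scan, vars]) (by simp [scan, arrs]) (by simp [scan, warrs])
  obtain ⟨s', c, k, hr, hk, he', hI, hend, hc⟩ := exists_runs_scan t .skip
    (fun k _ => ∀ j (_ : j < k) (hj : j < (I.pref x).length), C (I.pref x)[j])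
    x s₀ hs₀ hx he (by simp) (by simp [vars]) (by simp [vars]) (by simp [arrs])
    (fun _ _ _ h => h) (by
      intro k s hs hk hek hI hts j hj hj'
      rcases Nat.lt_succ_iff_lt_or_eq.1 hj with h | rfl
      · exact hI j h hj'
      · refine (ht s _ hs ?_).1 hts
        rw [hek, (hin s hs).list_eq x hk])
  have hplace : ∀ j (hj : j < (I.pref x).length), I.place x (some (I.pref x)[j]) = j :=
    fun j hj => (I.pref_nodup x).idxOf_getElem j hj
  have hbefore : ∀ q, q ∈ I.pref x → I.place x (some q) < k → C q := by
    intro q hq hlt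
    obtain ⟨j, hj, rfl⟩ := List.getElem_of_mem hq
    rw [hplace j hj] at hlt
    exact hI j hlt hj
  have hc' : c ≤ (t.cost + 10) * ((I.pref x).length + 1) := by simpa [size] using hc
  rcases hk.lt_or_eq with hlt | heq
  · refine ⟨s', c, some (I.pref x)[k], hr, by rw [he', hplace k hlt], ?_, ?_, hc'⟩
    · rintro p ⟨⟩
      refine ⟨List.getElem_mem hlt, fun hC => hend hlt ?_⟩
      refine (ht s' _ hr.sameOutside ?_).2 hC
      rw [he', (hin s' hr.sameOutside).list_eq x hlt]
    · intro q hq h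
      rw [hplace k hlt] at h
      exact hbefore q hq h
  · refine ⟨s', c, none, hr, by rw [he', heq]; rfl, by simp, ?_, hc'⟩
    intro q hq h
    refine hbefore q hq ?_
    rw [heq]; exact h

/-! ### Computing the first choices -/

/-- An optional number below `n` as a number: `0` for `none`, and `p + 1` for `some p`. -/
def encode {n : ℕ} : Option (Fin n) → ℕ
  | none => 0
  | some p => p.val + 1

theorem encode_eq_zero {n : ℕ} {o : Option (Fin n)} : encode o = 0 ↔ o = none := by
  cases o <;> simp [encode]

theorem encode_eq_succ {n : ℕ} {o : Option (Fin n)} {p : Fin n} :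
    encode o = p.val + 1 ↔ o = some p := by
  cases o <;> simp [encode, Fin.ext_iff]

namespace Instance

variable {I : Instance}

/-- What is known when the first choices of the applicants in `D` have been determined; `D` is
closed under larger weights, and `several p` says that `p` has been chosen more than once. -/
structure PartialFirstChoice (D : Fin I.numApplicants → Prop) (F : Fin I.numJobs → ℝ)
    (f : Fin I.numApplicants → Option (Fin I.numJobs)) (several : Fin I.numJobs → Prop) :
    Prop where
  undone : ∀ x, ¬ D x → f x = none
  mem : ∀ x p, f x = some p → p ∈ I.pref x
  rank_eq : ∀ x p, f x = some p → F p = I.weight x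
  rank_gt : ∀ x, D x → ∀ q, q ∈ I.pref x → I.place x (some q) < I.place x (f x) →
    I.weight x < F q
  exists_of_ne : ∀ p, F p ≠ 0 → ∃ x, f x = some p
  several_iff : ∀ p, several p ↔ ∃ x y, x ≠ y ∧ f x = some p ∧ f y = some p

theorem PartialFirstChoice.firstChoice {D F f several}
    (h : I.PartialFirstChoice D F f several) (hD : ∀ x, D x) : I.FirstChoice F f :=
  ⟨h.mem, h.rank_eq, fun x => h.rank_gt x (hD x), h.exists_of_ne⟩

theorem PartialFirstChoice.rank_nonneg {D F f several}
    (h : I.PartialFirstChoice D F f several) (p) : 0 ≤ F p := by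
  by_cases hp : F p = 0
  · exact hp.ge
  · obtain ⟨x, hx⟩ := h.exists_of_ne p hp
    rw [h.rank_eq x p hx]
    exact (I.weight_pos x).le

theorem PartialFirstChoice.step_none {D D' F f several} (h : I.PartialFirstChoice D F f several)
    {x : Fin I.numApplicants} (hx : ¬ D x) (hD' : ∀ y, D' y ↔ D y ∨ y = x)
    (hC : ∀ q, q ∈ I.pref x → I.weight x < F q) :
    I.PartialFirstChoice D' F f several := by
  refine ⟨fun y hy => h.undone y fun hc => hy ((hD' y).2 (Or.inl hc)), h.mem, h.rank_eq, ?_,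
    h.exists_of_ne, h.several_iff⟩
  intro y hy q hq hlt
  rcases (hD' y).1 hy with hy | rfl
  · exact h.rank_gt y hy q hq hlt
  · exact hC q hq

theorem PartialFirstChoice.step_some {D D' F f several} (h : I.PartialFirstChoice D F f several)
    {x : Fin I.numApplicants} (hx : ¬ D x) (hD' : ∀ y, D' y ↔ D y ∨ y = x)
    (hsorted : ∀ y, D y → I.weight x ≤ I.weight y) {p : Fin I.numJobs} (hp : p ∈ I.pref x)
    (hle : F p ≤ I.weight x)
    (hC : ∀ q, q ∈ I.pref x → I.place x (some q) < I.place x (some p) → I.weight x < F q) :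
    I.PartialFirstChoice D' (Function.update F p (I.weight x)) (Function.update f x (some p))
      (fun q => several q ∨ (q = p ∧ 0 < F p)) := by
  have hfx : f x = none := h.undone x hx
  have hDf : ∀ y q, f y = some q → D y := by
    intro y q hy
    by_contra hc
    rw [h.undone y hc] at hy; cases hy
  -- a rank is set once: it is that of the applicants of the first category choosing the job
  have hFp : F p = 0 ∨ F p = I.weight x := by
    by_cases hz : F p = 0
    · exact Or.inl hz
    · obtain ⟨y, hy⟩ := h.exists_of_ne p hz
      refine Or.inr (le_antisymm hle ?_)
      rw [h.rank_eq y p hy]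
      exact hsorted y (hDf y p hy)
  constructor
  · intro y hy
    rw [hD', not_or] at hy
    rw [Function.update_of_ne hy.2]
    exact h.undone y hy.1
  · intro y q hy
    by_cases hyx : y = x
    · subst hyx; simp at hy; exact hy ▸ hp
    · rw [Function.update_of_ne hyx] at hy; exact h.mem y q hy
  · intro y q hy
    by_cases hyx : y = x
    · subst hyx
      simp only [Function.update_self, Option.some.injEq] at hy
      subst hy; simp
    · rw [Function.update_of_ne hyx] at hy
      have := h.rank_eq y q hy
      by_cases hqp : q = p
      · subst hqp
        rw [Function.update_self, ← this]
        rcases hFp with h0 | h0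
        · have := I.weight_pos y; linarith
        · exact h0.symm
      · rw [Function.update_of_ne hqp, this]
  · intro y hy q hq hlt
    by_cases hyx : y = x
    · subst hyx
      rw [Function.update_self] at hlt
      have hqp : q ≠ p := by rintro rfl; exact lt_irrefl _ hlt
      rw [Function.update_of_ne hqp]
      exact hC q hq hlt
    · rw [Function.update_of_ne hyx] at hlt
      have hy' := ((hD' y).1 hy).resolve_right hyx
      have := h.rank_gt y hy' q hq hlt
      by_cases hqp : q = p
      · subst hqp
        have h1 := hsorted y hy'
        have h2 := I.weight_pos y
        rcases hFp with h0 | h0 <;> linarith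
      · rwa [Function.update_of_ne hqp]
  · intro q hq
    by_cases hqp : q = p
    · exact ⟨x, by simp [hqp]⟩
    · rw [Function.update_of_ne hqp] at hq
      obtain ⟨y, hy⟩ := h.exists_of_ne q hq
      refine ⟨y, ?_⟩
      rwa [Function.update_of_ne]
      rintro rfl
      rw [hfx] at hy; cases hy
  · intro q
    rw [h.several_iff]
    constructor
    · rintro (⟨y, z, hyz, hy, hz⟩ | ⟨rfl, hpos⟩)
      · refine ⟨y, z, hyz, ?_, ?_⟩
        · rwa [Function.update_of_ne]; rintro rfl; rw [hfx] at hy; cases hy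
        · rwa [Function.update_of_ne]; rintro rfl; rw [hfx] at hz; cases hz
      · obtain ⟨y, hy⟩ := h.exists_of_ne q hpos.ne'
        have hyx : y ≠ x := by rintro rfl; rw [hfx] at hy; cases hy
        exact ⟨x, y, hyx.symm, by simp, by rwa [Function.update_of_ne hyx]⟩
    · rintro ⟨y, z, hyz, hy, hz⟩
      have other : ∀ y, y ≠ x → Function.update f x (some p) y = some q →
          f y = some q := by
        intro y hyx hy
        rwa [Function.update_of_ne hyx] at hy
      have pos : ∀ y, f y = some p → 0 < F p := by
        intro y hy
        rw [h.rank_eq y p hy]; exact I.weight_pos y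
      by_cases hyx : y = x
      · subst hyx
        simp only [Function.update_self, Option.some.injEq] at hy
        subst hy
        exact Or.inr ⟨rfl, pos z (other z hyz.symm hz)⟩
      · by_cases hzx : z = x
        · subst hzx
          simp only [Function.update_self, Option.some.injEq] at hz
          subst hz
          exact Or.inr ⟨rfl, pos y (other y hyx hy)⟩
        · exact Or.inl ⟨y, z, hyz, other y hyx hy, other z hzx hz⟩

/-- The `i`-th applicant in the order `τ` (junk beyond the end) has a list of this length. -/
def listLength (I : Instance) (τ : Equiv.Perm (Fin I.numApplicants)) (i : ℕ) : ℕ :=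
  if h : i < I.numApplicants then (I.pref (τ ⟨i, h⟩)).length else 0

theorem sum_listLength (τ : Equiv.Perm (Fin I.numApplicants)) (C : ℕ) :
    ∑ i ∈ Finset.range I.numApplicants, C * (I.listLength τ i + 1) =
      C * (I.numEdges + I.numApplicants) := by
  rw [← Finset.mul_sum, Finset.sum_add_distrib]
  simp only [listLength, sum_length_eq, Finset.sum_const, Finset.card_range, smul_eq_mul, mul_one]

end Instance

/-- Put the value of `e`, an applicant, into variable `3`, and the index at which its list begins
into variable `4`. -/
def openList (e : IntExp) : Program :=
  .seq (.setVar 3 e) (.setVar 4 (.get 0 (.var 3)))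

/-- The list entry that variable `4` points to. -/
abbrev entry : IntExp := .get 1 (.var 4)

/-- There is an entry at variable `4`: it has not run past the list of the applicant in
variable `3`. -/
abbrev hasEntry : Test := .lt (.var 4) (.get 0 (.succ (.var 3)))

/-- Record the entry at variable `4`, if there is one, as the first choice of the applicant in
variable `3`. -/
def recordFirst : Program :=
  .ite hasEntry
    (.seq (.ite (.wlt .zero (.get 1 entry)) (.setArr 5 entry (.const 1)) .skip)
    (.seq (.setWArr 1 entry (.get 0 (.var 3)))
      (.setArr 4 (.var 3) (.succ entry))))
    .skip

/-- The first choices, in order of non-increasing weight: the first choice of an applicant is the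
first job on its list whose rank so far is at most its weight, as the jobs of rank `0` and those
chosen by applicants of the same weight are.  Integer array `4` receives the encoded first choices,
weight array `1` the ranks, and integer array `5` a mark at every job that is the first choice of
several applicants. -/
def findFirst : Program :=
  forLoop (.var 0)
    (.seq (openList (.get 2 (.var 2)))
    (.seq (scan (.wlt (.get 0 (.var 3)) (.get 1 entry)) .skip) recordFirst))

namespace Instance

variable {I : Instance} {σ : Equiv.Perm (Fin I.numApplicants)}

theorem HasInput.hasEntry_iff {s : State} (h : I.HasInput σ s) {x : Fin I.numApplicants}
    (hx : s.var 3 = x) {o} (he : s.var 4 = I.start x + I.place x o)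
    (ho : ∀ p, o = some p → p ∈ I.pref x) : hasEntry.Holds s ↔ o ≠ none := by
  have hs := start_succ x
  simp only [Test.Holds, IntExp.eval, hx, he]
  rw [h.start_eq x.2, hs]
  rcases o with _ | p
  · simp [place]
  · have := place_some_lt_none (ho p rfl)
    simp only [place] at this ⊢
    simp [this]

theorem exists_runs_openList {s : State} (h : I.HasInput σ s) {x : Fin I.numApplicants}
    {e : IntExp} (he : e.eval s = x) (hcost : e.cost ≤ 5) :
    ∃ s' c, Runs (openList e) s s' c ∧ c ≤ 10 ∧ I.HasInput σ s' ∧ s'.var 3 = x ∧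
      s'.var 4 = I.start x := by
  obtain ⟨s', c, hr, hc, h3, h4⟩ := exists_runs_of_wp (P := openList e) (s := s)
    (post := fun s' => s'.var 3 = x ∧ s'.var 4 = I.start x) (by
      simp [openList, wp, IntExp.eval, he, h.start_eq x.2.le])
  refine ⟨s', c, hr, ?_, ?_, h3, h4⟩
  · simp only [openList, size, IntExp.cost] at hc; omega
  · exact h.of_sameOutside hr.sameOutside (by simp [openList, vars]) (by simp [openList, arrs])
      (by simp [openList, warrs])

theorem exists_runs_findFirst (hσ : I.ListsCategories σ) (s₀ : State) (h₀ : I.HasInput σ s₀)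
    (h4 : ∀ i, s₀.arr 4 i = 0) (h5 : ∀ i, s₀.arr 5 i = 0) (hw1 : ∀ i, s₀.warr 1 i = 0) :
    ∃ s' c F f, Runs findFirst s₀ s' c ∧
      c ≤ 100 * (I.numVertices + I.numEdges + 1) ∧
      I.FirstChoice F f ∧ (∀ p : Fin I.numJobs, s'.warr 1 p = F p) ∧
      (∀ x : Fin I.numApplicants, s'.arr 4 x = encode (f x)) ∧
      (∀ p : Fin I.numJobs, s'.arr 5 p ≠ 0 ↔ ∃ x y, x ≠ y ∧ f x = some p ∧ f y = some p) := by
  have hN := h₀.var_zero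
  obtain ⟨s', c, hr, ⟨f, hf, hP⟩, hc⟩ := exists_runs_forLoop 0
    (.seq (openList (.get 2 (.var 2)))
    (.seq (scan (.wlt (.get 0 (.var 3)) (.get 1 entry)) .skip) recordFirst))
    (fun i s => ∃ f, (∀ x : Fin I.numApplicants, s.arr 4 x = encode (f x)) ∧
      I.PartialFirstChoice (fun x => (σ.symm x).val < i) (fun p => s.warr 1 p.val) f
        (fun p => s.arr 5 p.val ≠ 0))
    (fun _ => 0) (fun i => 70 * (I.listLength σ i + 1)) s₀ (by decide) (by decide) (by decide)
    (fun _ _ _ h => h) (fun _ _ => rfl)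
    ⟨fun _ => none, by simp [encode, h4], by
      constructor <;> simp [h5, hw1]⟩ (by
    rintro i s hs hi hsi ⟨f, hf, hP⟩
    rw [hN] at hi
    have hin : I.HasInput σ s := h₀.of_sameOutside hs
    set x := σ ⟨i, hi⟩ with hxdef
    have hsx : (σ.symm x).val = i := by simp [hxdef]
    have hxD : ¬ (σ.symm x).val < i := by simp [hsx]
    have hD' : ∀ y, (σ.symm y).val < i + 1 ↔ (σ.symm y).val < i ∨ y = x := by
      intro y
      rw [Nat.lt_succ_iff_lt_or_eq, ← hsx, Fin.val_inj, σ.symm.injective.eq_iff]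
    have hsorted : ∀ y, (σ.symm y).val < i → I.weight x ≤ I.weight y := by
      intro y hy
      have := hσ (σ.symm y) (σ.symm x) (by rw [Fin.le_def, hsx]; exact hy.le)
      simpa using this
    obtain ⟨s₁, c₁, hr₁, hc₁, hin₁, h3₁, h4₁⟩ := exists_runs_openList (x := x) hin
      (e := .get 2 (.var 2)) (by simp only [IntExp.eval, hsi]; exact hin.order_eq ⟨i, hi⟩)
      (by simp [IntExp.cost])
    have f₁ := hr₁.sameOutside
    obtain ⟨s₂, c₂, o, hr₂, h4₂, ho, hC, hc₂⟩ := exists_runs_scan_skip (I := I)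
      (.wlt (.get 0 (.var 3)) (.get 1 entry)) (fun q => I.weight x < s.warr 1 q.val) x s₁ hin₁ h3₁
      h4₁ (by
        intro s' p hs' hp
        simp only [Test.Holds, WExp.eval, IntExp.eval, hp]
        rw [hs'.var 3 (by decide), hs'.warr 0 (by decide), hs'.warr 1 (by decide), h3₁,
          hin₁.weight_eq x, f₁.warr 1 (by decide)])
    have f₂ := hr₂.sameOutside
    have hin₂ : I.HasInput σ s₂ := hin₁.of_sameOutside f₂
    have h3₂ : s₂.var 3 = x := by rw [f₂.var 3 (by decide), h3₁]
    have a4 : s₂.arr 4 = s.arr 4 := by rw [f₂.arr 4 (by decide), f₁.arr 4 (by decide)]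
    have a5 : s₂.arr 5 = s.arr 5 := by rw [f₂.arr 5 (by decide), f₁.arr 5 (by decide)]
    have w1 : s₂.warr 1 = s.warr 1 := by rw [f₂.warr 1 (by decide), f₁.warr 1 (by decide)]
    have hent := hin₂.hasEntry_iff h3₂ h4₂ fun p hp => (ho p hp).1
    obtain ⟨s₃, c₃, hr₃, hc₃, hpost⟩ := exists_runs_of_wp (s := s₂)
      (P := recordFirst)
      (post := fun s' => ∃ f, (∀ x : Fin I.numApplicants, s'.arr 4 x = encode (f x)) ∧
        I.PartialFirstChoice (fun x => (σ.symm x).val < i + 1) (fun p => s'.warr 1 p.val) f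
        (fun p => s'.arr 5 p.val ≠ 0)) (by
      rcases o with _ | p
      · refine ⟨fun hc => absurd rfl (hent.1 hc), fun _ => ⟨f, ?_, ?_⟩⟩
        · simpa [a4] using hf
        · simp only [a5, w1]
          refine hP.step_none hxD hD' fun q hq => hC q hq (place_some_lt_none hq)
      · obtain ⟨hp, hle⟩ := ho p rfl
        have hentry : s₂.arr 1 (s₂.var 4) = p.val := by rw [h4₂, hin₂.list_place hp]
        have hstep := hP.step_some hxD hD' hsorted hp (not_lt.1 hle) hC
        refine ⟨fun _ => ?_, fun hc => absurd (by simp) fun h => hc (hent.2 h)⟩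
        simp only [wp, Test.Holds, WExp.eval, IntExp.eval, hentry, h3₂, w1, a4, a5,
          Function.update_self, hin₂.weight_eq]
        constructor
        all_goals
          intro hpos
          refine ⟨Function.update f x (some p), ?_, ?_⟩
          · intro y
            by_cases hyx : y = x
            · subst hyx; simp [encode, hentry]
            · have : y.val ≠ x.val := fun hc => hyx (Fin.ext hc)
              simp [Function.update_of_ne hyx, Function.update_of_ne this, hf, a4]
          · convert hstep using 1
            · funext q
              simp [Function.update_apply, Fin.ext_iff, hentry]
            · funext q
              by_cases hq : q = p
              · subst hq; simp [hpos, a5]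
              · have : q.val ≠ p.val := fun hc => hq (Fin.ext hc)
                simp [hq, this, a5])
    refine ⟨s₃, _, hr₁.seq _ _ _ _ _ _ _ (hr₂.seq _ _ _ _ _ _ _ hr₃), hpost, ?_⟩
    have e : I.listLength σ i = (I.pref x).length := by simp [listLength, hi, hxdef]
    rw [e]
    have hc₃' : c₃ ≤ 40 := hc₃.trans (by decide)
    simp only [Test.cost, WExp.cost, IntExp.cost] at hc₂
    omega)
  rw [hN] at hP
  refine ⟨s', c, _, f, hr, ?_, hP.firstChoice fun x => (σ.symm x).2, fun _ => rfl, hf,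
    hP.several_iff⟩
  rw [hN, sum_listLength] at hc
  unfold numVertices
  omega

end Instance

/-! ### Computing the vacating costs -/

namespace Instance

variable {I : Instance}

/-- What is known when the vacating costs have been determined for the applicants in `D`, which is
closed under larger weights; `first x` says that `x` may be given its first choice. -/
structure PartialVacatingCost (D : Fin I.numApplicants → Prop)
    (f : Fin I.numApplicants → Option (Fin I.numJobs)) (lam : Fin I.numJobs → ℝ)
    (mu : Fin I.numApplicants → ℝ) (first : Fin I.numApplicants → Prop) : Prop where
  mu_le_weight : ∀ x, D x → mu x ≤ I.weight x
  mu_le : ∀ x, D x → ∀ q, q ∈ I.pref x → I.place x (some q) < I.place x (f x) →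
    mu x ≤ lam q - I.weight x
  mu_attained : ∀ x, D x → mu x = I.weight x ∨
    ∃ q ∈ I.pref x, I.place x (some q) < I.place x (f x) ∧ mu x = lam q - I.weight x
  sole : ∀ x, D x → ∀ p, f x = some p → (∀ y, f y = some p → y = x) → lam p = mu x
  several : ∀ x, D x → ∀ y p, f x = some p → f y = some p → y ≠ x → lam p = I.weight x
  zero : ∀ p, (∀ x, f x ≠ some p) → lam p = 0
  first_iff : ∀ x, first x ↔ D x ∧ f x ≠ none ∧ I.FirstAllowed f mu x

theorem PartialVacatingCost.vacatingCost {D f lam mu first}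
    (h : I.PartialVacatingCost D f lam mu first) (hD : ∀ x, D x) : I.VacatingCost f lam mu :=
  ⟨fun x => h.mu_le_weight x (hD x), fun x => h.mu_le x (hD x), fun x => h.mu_attained x (hD x),
    fun x => h.sole x (hD x), fun x => h.several x (hD x), h.zero⟩

theorem firstAllowed_update_of_ne {f : Fin I.numApplicants → Option (Fin I.numJobs)}
    {mu : Fin I.numApplicants → ℝ} {x y : Fin I.numApplicants} (hyx : y ≠ x) (v : ℝ) :
    I.FirstAllowed f (Function.update mu x v) y ↔ I.FirstAllowed f mu y := by
  unfold FirstAllowed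
  rw [Function.update_of_ne hyx]

/-- One more applicant `x`, with vacating cost `m`; `lam'` is the updated `lam`. -/
theorem PartialVacatingCost.step {D D' F f lam mu first}
    (h : I.PartialVacatingCost D f lam mu first) (hF : I.FirstChoice F f)
    {x : Fin I.numApplicants} (hx : ¬ D x) (hD' : ∀ y, D' y ↔ D y ∨ y = x)
    (hsorted : ∀ y, D y → I.weight x ≤ I.weight y) {m : ℝ} (hm : m ≤ I.weight x)
    (hmle : ∀ q, q ∈ I.pref x → I.place x (some q) < I.place x (f x) → m ≤ lam q - I.weight x)
    (hatt : m = I.weight x ∨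
      ∃ q ∈ I.pref x, I.place x (some q) < I.place x (f x) ∧ m = lam q - I.weight x)
    {lam' : Fin I.numJobs → ℝ} {first' : Fin I.numApplicants → Prop}
    (hne : ∀ q, f x ≠ some q → lam' q = lam q)
    (hsole : ∀ p, f x = some p → (∀ y, f y = some p → y = x) → lam' p = m)
    (hseveral : ∀ p y, f x = some p → f y = some p → y ≠ x → lam' p = I.weight x)
    (hfirst : ∀ y, y ≠ x → (first' y ↔ first y))
    (hfirstx : first' x ↔ f x ≠ none ∧ I.FirstAllowed f (Function.update mu x m) x) :
    I.PartialVacatingCost D' f lam' (Function.update mu x m) first' := by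
  -- `lam` does not change at the jobs that matter for the applicants considered so far
  have keep : ∀ y q, (D y ∨ y = x) → q ∈ I.pref y → I.place y (some q) < I.place y (f y) →
      lam' q = lam q := by
    intro y q hy hq hlt
    refine hne q fun hc => ?_
    have h1 := hF.rank_gt y q hq hlt
    rw [hF.rank_eq x q hc] at h1
    rcases hy with hy | rfl
    · exact (hsorted y hy).not_gt h1
    · exact lt_irrefl _ h1
  have neq : ∀ y, D y → y ≠ x := by rintro y hy rfl; exact hx hy
  constructor
  · intro y hy
    rcases (hD' y).1 hy with hy | rfl
    · rw [Function.update_of_ne (neq y hy)]; exact h.mu_le_weight y hy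
    · rwa [Function.update_self]
  · intro y hy q hq hlt
    rw [keep y q ((hD' y).1 hy) hq hlt]
    rcases (hD' y).1 hy with hy | rfl
    · rw [Function.update_of_ne (neq y hy)]; exact h.mu_le y hy q hq hlt
    · rw [Function.update_self]; exact hmle q hq hlt
  · intro y hy
    rcases (hD' y).1 hy with hy | rfl
    · rw [Function.update_of_ne (neq y hy)]
      refine (h.mu_attained y hy).imp id ?_
      rintro ⟨q, hq, hlt, he⟩
      exact ⟨q, hq, hlt, by rw [keep y q (Or.inl hy) hq hlt, he]⟩
    · rw [Function.update_self]
      refine hatt.imp id ?_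
      rintro ⟨q, hq, hlt, he⟩
      exact ⟨q, hq, hlt, by rw [keep y q (Or.inr rfl) hq hlt, he]⟩
  · intro y hy p hp hs
    rcases (hD' y).1 hy with hy | rfl
    · rw [Function.update_of_ne (neq y hy),
        hne p fun hc => neq y hy (hs x hc).symm]
      exact h.sole y hy p hp hs
    · rw [Function.update_self]; exact hsole p hp hs
  · intro y hy z p hp hz hzy
    rcases (hD' y).1 hy with hy | rfl
    · by_cases hc : f x = some p
      · rw [hseveral p y hc hp (neq y hy), ← hF.rank_eq x p hc, hF.rank_eq y p hp]
      · rw [hne p hc]; exact h.several y hy z p hp hz hzy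
    · exact hseveral p z hp hz hzy
  · intro p hp
    rw [hne p (hp x)]; exact h.zero p hp
  · intro y
    by_cases hyx : y = x
    · subst hyx
      rw [hfirstx, hD']
      simp
    · rw [hfirst y hyx, h.first_iff, hD', firstAllowed_update_of_ne hyx]
      simp [hyx]

end Instance

/-- The decision whether the applicant in variable `3` may be given its first choice, with its
vacating cost in weight variable `0`; this is also where the vacating cost of the job is set. -/
def decideFirst : Program :=
  .ite (.eq (.get 4 (.var 3)) (.const 0)) .skip
    (.ite (.eq (.get 5 (.pred (.get 4 (.var 3)))) (.const 0))
      (.seq (.setWArr 2 (.pred (.get 4 (.var 3))) (.var 0))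
        (.ite (.wlt (.var 0) .zero) .skip (.setArr 6 (.var 3) (.const 1))))
      (.seq (.setWArr 2 (.pred (.get 4 (.var 3))) (.get 0 (.var 3)))
        (.ite (.wlt (.var 0) (.get 0 (.var 3))) .skip (.setArr 6 (.var 3) (.const 1)))))

/-- The test that the first choice of the applicant in variable `3` has not been reached. -/
def notFirst : Test := .not (.eq (.succ entry) (.get 4 (.var 3)))

/-- Lower the vacating cost in weight variable `0`, where promoting the applicant in variable `3`
to the job at hand is cheaper. -/
def lowerCost : Program :=
  .ite (.wlt (.sub (.get 2 entry) (.get 0 (.var 3))) (.var 0))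
    (.setWVar 0 (.sub (.get 2 entry) (.get 0 (.var 3)))) .skip

/-- The vacating costs, in order of non-increasing weight.  Weight array `2` receives the vacating
costs of the jobs, and integer array `6` a mark at every applicant that may be given its first
choice. -/
def findCosts : Program :=
  forLoop (.var 0)
    (.seq (openList (.get 2 (.var 2)))
    (.seq (.setWVar 0 (.get 0 (.var 3)))
    (.seq (scan notFirst lowerCost) decideFirst)))

namespace Instance

variable {I : Instance} {σ : Equiv.Perm (Fin I.numApplicants)}

/-- The scan leaves the vacating cost of `x` in weight variable `0`, relative to the vacating costs
of the jobs as stored so far. -/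
theorem exists_runs_scan_lowerCost {f : Fin I.numApplicants → Option (Fin I.numJobs)}
    {F : Fin I.numJobs → ℝ} (hF : I.FirstChoice F f) {x : Fin I.numApplicants} {s₀ : State}
    (h₀ : I.HasInput σ s₀) (h3 : s₀.var 3 = x) (h4 : s₀.var 4 = I.start x)
    (hf : s₀.arr 4 x = encode (f x)) (hw : s₀.wvar 0 = I.weight x) :
    ∃ s' c, Runs (scan notFirst lowerCost) s₀ s' c ∧ c ≤ 50 * ((I.pref x).length + 1) ∧
      s'.wvar 0 ≤ I.weight x ∧
      (∀ q : Fin I.numJobs, q ∈ I.pref x → I.place x (some q) < I.place x (f x) →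
        s'.wvar 0 ≤ s₀.warr 2 q - I.weight x) ∧
      (s'.wvar 0 = I.weight x ∨ ∃ q ∈ I.pref x, I.place x (some q) < I.place x (f x) ∧
        s'.wvar 0 = s₀.warr 2 (q : Fin I.numJobs) - I.weight x) := by
  have hplace : ∀ j (hj : j < (I.pref x).length), I.place x (some (I.pref x)[j]) = j :=
    fun j hj => (I.pref_nodup x).idxOf_getElem j hj
  have htest : ∀ s, (scan notFirst lowerCost).SameOutside s₀ s → ∀ k,
      (hk : k < (I.pref x).length) → s.var 4 = I.start x + k →
      (notFirst.Holds s ↔ f x ≠ some (I.pref x)[k]) := by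
    intro s hs k hk he
    have hin : I.HasInput σ s := h₀.of_sameOutside hs
    simp only [notFirst, Test.Holds, IntExp.eval]
    rw [he, hin.list_eq x hk, hs.arr 4 (by decide), hs.var 3 (by decide), h3, hf]
    exact not_congr (eq_comm.trans encode_eq_succ)
  obtain ⟨s', c, k, hr, hk, he', ⟨hI₁, hI₂, hI₃, hI₄⟩, hlast, hc⟩ :=
    exists_runs_scan (I := I) notFirst lowerCost
    (fun k s => s.wvar 0 ≤ I.weight x ∧
      (∀ j (_ : j < k) (hj : j < (I.pref x).length),
        s.wvar 0 ≤ s₀.warr 2 (I.pref x)[j] - I.weight x) ∧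
      (s.wvar 0 = I.weight x ∨ ∃ j, ∃ (_ : j < k) (hj : j < (I.pref x).length),
        s.wvar 0 = s₀.warr 2 (I.pref x)[j] - I.weight x) ∧
      ∀ j (_ : j < k) (hj : j < (I.pref x).length), f x ≠ some (I.pref x)[j])
    x s₀ h₀ h3 h4 ⟨hw.le, by simp, Or.inl hw, by simp⟩ (by decide) (by decide) (by decide)
    (fun _ _ _ h => h) (by
      rintro k s hs hk he ⟨h1, h2, h5, h6⟩ ht
      have hin : I.HasInput σ s := h₀.of_sameOutside hs
      have hentry := hin.list_eq x hk
      have hs3 : s.var 3 = x := by rw [hs.var 3 (by decide), h3]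
      have h6' : ∀ j (_ : j < k + 1) (hj : j < (I.pref x).length), f x ≠ some (I.pref x)[j] := by
        intro j hj hj'
        rcases Nat.lt_succ_iff_lt_or_eq.1 hj with h | rfl
        · exact h6 j h hj'
        · exact (htest s hs _ hk he).1 ht
      simp only [lowerCost, wp, Test.Holds, WExp.eval, IntExp.eval, he, hentry, hs3,
        hs.warr 2 (by decide), hin.weight_eq, Function.update_self]
      refine ⟨fun hlt => ⟨hlt.le.trans h1, ?_, Or.inr ⟨k, Nat.lt_succ_self k, hk, rfl⟩, h6'⟩,
        fun hlt => ⟨h1, ?_, ?_, h6'⟩⟩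
      · intro j hj hj'
        rcases Nat.lt_succ_iff_lt_or_eq.1 hj with h | rfl
        · exact hlt.le.trans (h2 j h hj')
        · exact le_rfl
      · intro j hj hj'
        rcases Nat.lt_succ_iff_lt_or_eq.1 hj with h | rfl
        · exact h2 j h hj'
        · exact not_lt.1 hlt
      · refine h5.imp id ?_
        rintro ⟨j, hj, hj', h⟩
        exact ⟨j, hj.trans (Nat.lt_succ_self k), hj', h⟩)
  have hend : I.place x (f x) = k := by
    rcases hk.lt_or_eq with hlt | rfl
    · have := hlast hlt
      rw [htest s' hr.sameOutside k hlt he', not_not] at this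
      rw [this, hplace k hlt]
    · rcases hfx : f x with _ | p
      · rfl
      · obtain ⟨j, hj, rfl⟩ := List.getElem_of_mem (hF.mem x p hfx)
        exact absurd hfx (hI₄ j hj hj)
  refine ⟨s', c, hr, ?_, hI₁, ?_, ?_⟩
  · refine hc.trans (Nat.mul_le_mul_right _ ?_)
    decide
  · intro q hq hlt
    obtain ⟨j, hj, rfl⟩ := List.getElem_of_mem hq
    rw [hplace j hj, hend] at hlt
    exact hI₂ j hlt hj
  · refine hI₃.imp id ?_
    rintro ⟨j, hj, hj', h⟩
    exact ⟨_, List.getElem_mem hj', by rw [hplace j hj', hend]; exact hj, h⟩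

theorem exists_runs_findCosts (hσ : I.ListsCategories σ) {F : Fin I.numJobs → ℝ}
    {f : Fin I.numApplicants → Option (Fin I.numJobs)} (hF : I.FirstChoice F f)
    (s₀ : State) (h₀ : I.HasInput σ s₀)
    (h4 : ∀ x : Fin I.numApplicants, s₀.arr 4 x = encode (f x))
    (h5 : ∀ p : Fin I.numJobs, s₀.arr 5 p ≠ 0 ↔ ∃ x y, x ≠ y ∧ f x = some p ∧ f y = some p)
    (h6 : ∀ i, s₀.arr 6 i = 0) (hw2 : ∀ i, s₀.warr 2 i = 0) :
    ∃ s' c lam mu, Runs findCosts s₀ s' c ∧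
      c ≤ 200 * (I.numVertices + I.numEdges + 1) ∧
      I.VacatingCost f lam mu ∧ (∀ p : Fin I.numJobs, s'.warr 2 p = lam p) ∧
      (∀ x : Fin I.numApplicants, s'.arr 6 x ≠ 0 ↔ f x ≠ none ∧ I.FirstAllowed f mu x) := by
  have hN := h₀.var_zero
  obtain ⟨s', c, hr, ⟨mu, hP⟩, hc⟩ := exists_runs_forLoop 0
    (.seq (openList (.get 2 (.var 2)))
    (.seq (.setWVar 0 (.get 0 (.var 3)))
    (.seq (scan notFirst lowerCost) decideFirst)))
    (fun i s => ∃ mu, I.PartialVacatingCost (fun x => (σ.symm x).val < i) f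
      (fun p => s.warr 2 p.val) mu (fun x => s.arr 6 x.val ≠ 0))
    (fun _ => 0) (fun i => 150 * (I.listLength σ i + 1)) s₀ (by decide) (by decide) (by decide)
    (fun _ _ _ h => h) (fun _ _ => rfl)
    ⟨fun _ => 0, by constructor <;> simp [h6, hw2]⟩ (by
    rintro i s hs hi hsi ⟨mu, hP⟩
    rw [hN] at hi
    have hin : I.HasInput σ s := h₀.of_sameOutside hs
    set x := σ ⟨i, hi⟩ with hxdef
    have hsx : (σ.symm x).val = i := by simp [hxdef]
    have hxD : ¬ (σ.symm x).val < i := by simp [hsx]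
    have hD' : ∀ y, (σ.symm y).val < i + 1 ↔ (σ.symm y).val < i ∨ y = x := by
      intro y
      rw [Nat.lt_succ_iff_lt_or_eq, ← hsx, Fin.val_inj, σ.symm.injective.eq_iff]
    have hsorted : ∀ y, (σ.symm y).val < i → I.weight x ≤ I.weight y := by
      intro y hy
      have := hσ (σ.symm y) (σ.symm x) (by rw [Fin.le_def, hsx]; exact hy.le)
      simpa using this
    obtain ⟨s₁, c₁, hr₁, hc₁, hin₁, h3₁, h4₁⟩ := exists_runs_openList (x := x) hin
      (e := .get 2 (.var 2)) (by simp only [IntExp.eval, hsi]; exact hin.order_eq ⟨i, hi⟩)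
      (by simp [IntExp.cost])
    have f₁ := hr₁.sameOutside
    obtain ⟨s₂, c₂, hr₂, hc₂, hw₂⟩ := exists_runs_of_wp (s := s₁)
      (P := .setWVar 0 (.get 0 (.var 3))) (post := fun s' => s'.wvar 0 = I.weight x) (by
        simp only [wp, WExp.eval, IntExp.eval, Function.update_self, h3₁, hin₁.weight_eq])
    have f₂ := hr₂.sameOutside
    have hin₂ : I.HasInput σ s₂ := hin₁.of_sameOutside f₂
    obtain ⟨s₃, c₃, hr₃, hc₃, hle, hmle, hatt⟩ := exists_runs_scan_lowerCost hF (x := x) hin₂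
      (by rw [f₂.var 3 (by decide), h3₁]) (by rw [f₂.var 4 (by decide), h4₁])
      (by rw [f₂.arr 4 (by decide), f₁.arr 4 (by decide), hs.arr 4 (by decide), h4]) hw₂
    have f₃ := hr₃.sameOutside
    have hin₃ : I.HasInput σ s₃ := hin₂.of_sameOutside f₃
    have h3₃ : s₃.var 3 = x := by
      rw [f₃.var 3 (by decide), f₂.var 3 (by decide), h3₁]
    have a4 : s₃.arr 4 = s₀.arr 4 := by
      rw [f₃.arr 4 (by decide), f₂.arr 4 (by decide), f₁.arr 4 (by decide), hs.arr 4 (by decide)]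
    have a5 : s₃.arr 5 = s₀.arr 5 := by
      rw [f₃.arr 5 (by decide), f₂.arr 5 (by decide), f₁.arr 5 (by decide), hs.arr 5 (by decide)]
    have a6 : s₃.arr 6 = s.arr 6 := by
      rw [f₃.arr 6 (by decide), f₂.arr 6 (by decide), f₁.arr 6 (by decide)]
    have w2 : s₂.warr 2 = s.warr 2 := by
      rw [f₂.warr 2 (by decide), f₁.warr 2 (by decide)]
    have w2' : s₃.warr 2 = s.warr 2 := by rw [f₃.warr 2 (by decide), w2]
    rw [w2] at hmle hatt
    set m := s₃.wvar 0 with hmdef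
    have hstep := fun {lam' first'} => hP.step hF hxD hD' hsorted (m := m) hle hmle hatt
      (lam' := lam') (first' := first')
    obtain ⟨s₄, c₄, hr₄, hc₄, hpost⟩ := exists_runs_of_wp (s := s₃) (P := decideFirst)
      (post := fun s' => I.PartialVacatingCost (fun x => (σ.symm x).val < i + 1) f
        (fun p => s'.warr 2 p.val) (Function.update mu x m) (fun x => s'.arr 6 x.val ≠ 0)) (by
      have h6x : s.arr 6 x.val = 0 := by
        by_contra hc
        exact hxD ((hP.first_iff x).1 hc).1
      have hw := I.weight_pos x
      simp only [decideFirst, wp, Test.Holds, WExp.eval, IntExp.eval, h3₃, a4, h4,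
        Function.update_self, hin₃.weight_eq]
      rcases hfx : f x with _ | p
      · refine ⟨fun _ => ?_, fun hc => absurd rfl hc⟩
        simp only [a6, w2']
        apply hstep <;> simp [hfx, h6x]
      · simp only [encode, Nat.add_sub_cancel, a5]
        refine ⟨fun hc => absurd hc (Nat.succ_ne_zero _), fun _ => ⟨fun hs' => ?_, fun hs' => ?_⟩⟩
        · -- `x` is the only applicant with first choice `p`: its vacating cost is that of `p`
          have hsole : ∀ y, f y = some p → y = x := by
            intro y hy
            by_contra hyx
            exact (h5 p).2 ⟨y, x, hyx, hy, hfx⟩ hs'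
          have hall : I.FirstAllowed f (Function.update mu x m) x ↔ 0 ≤ m := by
            unfold FirstAllowed
            rw [Function.update_self, hfx]
            exact ⟨fun h => h.elim And.right fun h => hw.le.trans h, fun h => Or.inl ⟨hsole, h⟩⟩
          have hval : ∀ q : Fin I.numJobs, q ≠ p → q.val ≠ p.val :=
            fun q hq hc => hq (Fin.ext hc)
          refine ⟨fun hneg => ?_, fun hneg => ?_⟩
          all_goals
            apply hstep
            · intro q hq
              have : q ≠ p := by rintro rfl; exact hq hfx
              simp [Function.update_of_ne (hval q this), w2']
            · rintro q hq -
              rw [hfx] at hq; cases hq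
              simp [hmdef]
            · rintro q y hq hy hyx
              rw [hfx] at hq; cases hq
              exact absurd (hsole y hy) hyx
            · intro y hyx
              have : y.val ≠ x.val := fun hc => hyx (Fin.ext hc)
              simp [this, a6]
          · simp only [a6, h6x, hall, ← hmdef] at hneg ⊢
            simpa using fun _ => hneg
          · simp only [hall, ← hmdef] at hneg ⊢
            simpa [hfx] using hneg
        · -- `p` has several applicants, and its vacating cost is their weight
          obtain ⟨y, z, hyz, hy, hz⟩ := (h5 p).1 hs'
          have hother : ∃ y, y ≠ x ∧ f y = some p := by
            by_cases hyx : y = x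
            · exact ⟨z, by rw [← hyx]; exact hyz.symm, hz⟩
            · exact ⟨y, hyx, hy⟩
          obtain ⟨y, hyx, hy⟩ := hother
          have hall : I.FirstAllowed f (Function.update mu x m) x ↔ I.weight x ≤ m := by
            unfold FirstAllowed
            rw [Function.update_self, hfx]
            exact ⟨fun h => h.elim (fun h => absurd (h.1 y hy) hyx) id, Or.inr⟩
          have hval : ∀ q : Fin I.numJobs, q ≠ p → q.val ≠ p.val :=
            fun q hq hc => hq (Fin.ext hc)
          refine ⟨fun hneg => ?_, fun hneg => ?_⟩
          all_goals
            apply hstep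
            · intro q hq
              have : q ≠ p := by rintro rfl; exact hq hfx
              simp [Function.update_of_ne (hval q this), w2']
            · rintro q hq hs
              rw [hfx] at hq; cases hq
              exact absurd (hs y hy) hyx
            · rintro q y hq hy hyx
              rw [hfx] at hq; cases hq
              simp
            · intro y hyx
              have : y.val ≠ x.val := fun hc => hyx (Fin.ext hc)
              simp [this, a6]
          · simp only [a6, h6x, hall, ← hmdef] at hneg ⊢
            simpa [hin₃.weight_eq] using fun _ => hneg
          · simp only [hall, ← hmdef] at hneg ⊢
            simpa [hfx, hin₃.weight_eq] using hneg)
    refine ⟨s₄, _, hr₁.seq _ _ _ _ _ _ _ (hr₂.seq _ _ _ _ _ _ _ (hr₃.seq _ _ _ _ _ _ _ hr₄)),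
      ⟨_, hpost⟩, ?_⟩
    have e : I.listLength σ i = (I.pref x).length := by simp [listLength, hi, hxdef]
    rw [e]
    have hc₄' : c₄ ≤ 80 := hc₄.trans (by decide)
    have hc₂' : c₂ ≤ 4 := hc₂.trans (by decide)
    omega)
  rw [hN] at hP
  have hD : ∀ x, (σ.symm x).val < I.numApplicants := fun x => (σ.symm x).2
  refine ⟨s', c, _, mu, hr, ?_, hP.vacatingCost hD, fun _ => rfl, fun x => ?_⟩
  · rw [hN, sum_listLength] at hc
    unfold numVertices
    omega
  · rw [hP.first_iff]
    simp [hD x]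

end Instance

/-! ### Computing the allowed outcomes -/

/-- The test, in the search for the second choice, that the job at hand is a first choice that is
not too cheap to vacate. -/
def passesOver : Test :=
  .and (.wlt .zero (.get 1 entry)) (.not (.wlt (.get 2 entry) (.get 0 (.var 3))))

/-- With the first entry at which `passesOver` fails at variable `4`, record the one or two jobs
that the applicant in variable `3` may be given in integer arrays `7` and `8`, and mark the
applicant in integer array `9`; set variable `9` if there is no such job.  Nothing is recorded for
an applicant that may be left free. -/
def recordOptions : Program :=
  .ite hasEntry
    (.ite (.wlt .zero (.get 1 entry))
      (.ite (.eq (.get 6 (.var 3)) (.const 0))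
        (.setVar 9 (.const 1))
        (.seq (.setArr 7 (.var 3) (.pred (.get 4 (.var 3))))
        (.seq (.setArr 8 (.var 3) (.pred (.get 4 (.var 3)))) (.setArr 9 (.var 3) (.const 1)))))
      (.seq (.ite (.eq (.get 6 (.var 3)) (.const 0))
          (.setArr 7 (.var 3) entry) (.setArr 7 (.var 3) (.pred (.get 4 (.var 3)))))
        (.seq (.setArr 8 (.var 3) entry) (.setArr 9 (.var 3) (.const 1)))))
    .skip

/-- The allowed outcomes of all applicants. -/
def findOptions : Program :=
  forLoop (.var 0) (.seq (openList (.var 2)) (.seq (scan passesOver .skip) recordOptions))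

namespace Instance

variable {I : Instance} {σ : Equiv.Perm (Fin I.numApplicants)}

/-- In memory `s`, either `x` may be left free and is not marked, or it is marked, and the one or
two outcomes that it may have are jobs, recorded in the integer arrays `7` and `8`. -/
def OptionsRecorded (allowed : Fin I.numApplicants → Option (Fin I.numJobs) → Prop) (s : State)
    (x : Fin I.numApplicants) : Prop :=
  (s.arr 9 x = 0 ∧ allowed x none) ∨
    (s.arr 9 x = 1 ∧ ∃ p q : Fin I.numJobs, s.arr 7 x = p ∧ s.arr 8 x = q ∧
      allowed x (some p) ∧ allowed x (some q) ∧ ∀ o, allowed x o → o = some p ∨ o = some q)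

theorem OptionsRecorded.congr {allowed : Fin I.numApplicants → Option (Fin I.numJobs) → Prop}
    {s s' : State} {x : Fin I.numApplicants} (h : OptionsRecorded allowed s x)
    (h7 : s'.arr 7 x = s.arr 7 x) (h8 : s'.arr 8 x = s.arr 8 x) (h9 : s'.arr 9 x = s.arr 9 x) :
    OptionsRecorded allowed s' x := by
  unfold OptionsRecorded
  rw [h7, h8, h9]
  exact h

/-- If the first job that is not passed over is a first choice, then there is no second choice. -/
theorem not_secondAllowed {F lam : Fin I.numJobs → ℝ} {x : Fin I.numApplicants} {p : Fin I.numJobs}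
    (hp : p ∈ I.pref x) (hFp : F p ≠ 0) (hlam : lam p < I.weight x)
    (hC : ∀ q, q ∈ I.pref x → I.place x (some q) < I.place x (some p) → F q ≠ 0) (o) :
    ¬ I.SecondAllowed F lam x o := by
  intro h
  rcases lt_trichotomy (I.place x (some p)) (I.place x o) with hlt | heq | hlt
  · exact (h.weight_le p hp hlt).not_gt hlam
  · have := place_injective (by rintro q ⟨⟩; exact hp) h.mem heq
    exact hFp (h.rank_eq_zero p this.symm)
  · rcases o with _ | q
    · exact (place_some_lt_none hp).not_gt hlt
    · exact hC q (h.mem q rfl) hlt (h.rank_eq_zero q rfl)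

theorem wp_recordOptions {F lam : Fin I.numJobs → ℝ}
    {f : Fin I.numApplicants → Option (Fin I.numJobs)} {mu : Fin I.numApplicants → ℝ}
    (hF : I.FirstChoice F f) {x : Fin I.numApplicants} {s : State} (hin : I.HasInput σ s)
    (h3 : s.var 3 = x) (h4 : s.arr 4 x = encode (f x))
    (h6 : s.arr 6 x ≠ 0 ↔ f x ≠ none ∧ I.FirstAllowed f mu x)
    (h9 : s.arr 9 x = 0) (hw1 : ∀ p : Fin I.numJobs, s.warr 1 p = F p) {o}
    (he : s.var 4 = I.start x + I.place x o)
    (ho : ∀ p, o = some p → p ∈ I.pref x ∧ ¬ (0 < F p ∧ ¬ lam p < I.weight x))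
    (hC : ∀ q, q ∈ I.pref x → I.place x (some q) < I.place x o → 0 < F q ∧ ¬ lam q < I.weight x) :
    recordOptions.wp (fun s' =>
      ((s'.var 9 = s.var 9 ∧ OptionsRecorded (I.Allowed F lam f mu) s' x) ∨
        (s'.var 9 = 1 ∧ ∀ o, ¬ I.Allowed F lam f mu x o)) ∧
      ∀ y, y ≠ x.val → s'.arr 7 y = s.arr 7 y ∧ s'.arr 8 y = s.arr 8 y ∧ s'.arr 9 y = s.arr 9 y)
      s := by
  have hent := hin.hasEntry_iff h3 he fun p hp => (ho p hp).1
  have second : (∀ p, o = some p → F p = 0) → I.SecondAllowed F lam x o := fun h =>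
    ⟨fun p hp => (ho p hp).1, h, fun q hq hlt => (hC q hq hlt).1.ne',
      fun q hq hlt => not_lt.1 (hC q hq hlt).2⟩
  have first : s.arr 6 x ≠ 0 → ∃ r, f x = some r ∧ s.arr 4 x = r.val + 1 ∧
      I.Allowed F lam f mu x (some r) := by
    intro h
    obtain ⟨hne, hall⟩ := h6.1 h
    obtain ⟨r, hr⟩ := Option.ne_none_iff_exists'.1 hne
    exact ⟨r, hr, by rw [h4, hr]; rfl, Or.inl ⟨by simp, hr.symm, hall⟩⟩
  have allowed_cases : ∀ o', I.Allowed F lam f mu x o' →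
      (s.arr 6 x ≠ 0 ∧ o' = f x) ∨ I.SecondAllowed F lam x o' := by
    rintro o' (h | h)
    · exact Or.inl ⟨h6.2 ⟨h.2.1 ▸ h.1, h.2.2⟩, h.2.1⟩
    · exact Or.inr h
  rcases o with _ | p
  · refine ⟨fun hc => absurd rfl (hent.1 hc), fun _ => ⟨Or.inl ⟨rfl, Or.inl ⟨h9, Or.inr ?_⟩⟩, ?_⟩⟩
    · exact second (by simp)
    · exact fun _ _ => ⟨rfl, rfl, rfl⟩
  · obtain ⟨hp, hnot⟩ := ho p rfl
    have hentry : s.arr 1 (s.var 4) = p.val := by rw [he, hin.list_place hp]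
    refine ⟨fun _ => ?_, fun hc => absurd (hent.2 (by simp)) hc⟩
    simp only [wp, Test.Holds, WExp.eval, IntExp.eval, h3, hentry, hw1]
    refine ⟨fun hpos => ?_, fun hpos => ?_⟩
    · have hlam : lam p < I.weight x := by
        by_contra hc; exact hnot ⟨hpos, hc⟩
      have hno := not_secondAllowed hp hpos.ne' hlam fun q hq hlt => (hC q hq hlt).1.ne'
      refine ⟨fun hz => ⟨Or.inr ⟨by simp, fun o' ho' => ?_⟩, by simp⟩,
        fun hz => ?_⟩
      · rcases allowed_cases o' ho' with h | h
        · exact h.1 hz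
        · exact hno o' h
      · obtain ⟨r, hr, h4r, hall⟩ := first hz
        refine ⟨Or.inl ⟨by simp, Or.inr ⟨by simp, r, r, ?_, ?_, hall, hall, ?_⟩⟩, ?_⟩
        · simp [h4r]
        · simp [h4r]
        · intro o' ho'
          rcases allowed_cases o' ho' with h | h
          · exact Or.inl (h.2.trans hr)
          · exact absurd h (hno o')
        · intro y hy
          simp [Function.update_of_ne hy]
    · have hFp : F p = 0 := le_antisymm (not_lt.1 hpos) (hF.rank_nonneg p)
      have hsec : I.SecondAllowed F lam x (some p) := second (by rintro q ⟨⟩; exact hFp)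
      refine ⟨fun hz => ?_, fun hz => ?_⟩
      · refine ⟨Or.inl ⟨by simp, Or.inr ⟨by simp, p, p, ?_, ?_, Or.inr hsec, Or.inr hsec, ?_⟩⟩, ?_⟩
        · simp
        · simp [hentry]
        · intro o' ho'
          rcases allowed_cases o' ho' with h | h
          · exact absurd hz h.1
          · exact Or.inl (h.unique hsec)
        · intro y hy
          simp [Function.update_of_ne hy]
      · obtain ⟨r, hr, h4r, hall⟩ := first hz
        refine ⟨Or.inl ⟨by simp, Or.inr ⟨by simp, r, p, ?_, ?_, hall, Or.inr hsec, ?_⟩⟩, ?_⟩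
        · simp [h4r]
        · simp [hentry]
        · intro o' ho'
          rcases allowed_cases o' ho' with h | h
          · exact Or.inl (h.2.trans hr)
          · exact Or.inr (h.unique hsec)
        · intro y hy
          simp [Function.update_of_ne hy]

theorem exists_runs_findOptions {F lam : Fin I.numJobs → ℝ}
    {f : Fin I.numApplicants → Option (Fin I.numJobs)} {mu : Fin I.numApplicants → ℝ}
    (hF : I.FirstChoice F f) (s₀ : State) (h₀ : I.HasInput σ s₀)
    (h4 : ∀ x : Fin I.numApplicants, s₀.arr 4 x = encode (f x))
    (h6 : ∀ x : Fin I.numApplicants, s₀.arr 6 x ≠ 0 ↔ f x ≠ none ∧ I.FirstAllowed f mu x)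
    (h9 : ∀ i, s₀.arr 9 i = 0) (hv9 : s₀.var 9 = 0)
    (hw1 : ∀ p : Fin I.numJobs, s₀.warr 1 p = F p)
    (hw2 : ∀ p : Fin I.numJobs, s₀.warr 2 p = lam p) :
    ∃ s' c, Runs findOptions s₀ s' c ∧ c ≤ 200 * (I.numVertices + I.numEdges + 1) ∧
      (s'.var 9 = 0 → ∀ x, OptionsRecorded (I.Allowed F lam f mu) s' x) ∧
      (s'.var 9 ≠ 0 → ∃ x, ∀ o, ¬ I.Allowed F lam f mu x o) ∧
      (∀ i, I.numApplicants ≤ i → s'.arr 9 i = 0) := by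
  have hN := h₀.var_zero
  obtain ⟨s', c, hr, ⟨hI₁, hI₂, hI₃⟩, hc⟩ := exists_runs_forLoop 0
    (.seq (openList (.var 2)) (.seq (scan passesOver .skip) recordOptions))
    (fun i s => (s.var 9 = 0 → ∀ x, x.val < i → OptionsRecorded (I.Allowed F lam f mu) s x) ∧
      (s.var 9 ≠ 0 → ∃ x, ∀ o, ¬ I.Allowed F lam f mu x o) ∧
      (∀ j, i ≤ j → s.arr 9 j = 0))
    (fun _ => 0) (fun i => 150 * (I.listLength 1 i + 1)) s₀ (by decide) (by decide) (by decide)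
    (fun _ _ _ h => h) (fun _ _ => rfl)
    ⟨by simp, fun h => absurd hv9 h, fun j _ => h9 j⟩ (by
    rintro i s hs hi hsi ⟨hI₁, hI₂, hI₃⟩
    rw [hN] at hi
    have hin : I.HasInput σ s := h₀.of_sameOutside hs
    set x : Fin I.numApplicants := ⟨i, hi⟩ with hxdef
    obtain ⟨s₁, c₁, hr₁, hc₁, hin₁, h3₁, h4₁⟩ := exists_runs_openList (x := x) hin
      (e := .var 2) hsi (by simp [IntExp.cost])
    have f₁ := hr₁.sameOutside
    obtain ⟨s₂, c₂, o, hr₂, h4₂, ho, hC, hc₂⟩ := exists_runs_scan_skip (I := I)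
      passesOver (fun q => 0 < F q ∧ ¬ lam q < I.weight x) x s₁ hin₁ h3₁ h4₁ (by
        intro s' p hs' hp
        simp only [passesOver, Test.Holds, WExp.eval, IntExp.eval, hp]
        rw [hs'.var 3 (by decide), hs'.warr 0 (by decide), hs'.warr 1 (by decide),
          hs'.warr 2 (by decide), h3₁, hin₁.weight_eq x, f₁.warr 1 (by decide),
          f₁.warr 2 (by decide), hs.warr 1 (by decide), hs.warr 2 (by decide), hw1, hw2])
    have f₂ := hr₂.sameOutside
    have hin₂ : I.HasInput σ s₂ := hin₁.of_sameOutside f₂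
    have a7 : s₂.arr 7 = s.arr 7 := by rw [f₂.arr 7 (by decide), f₁.arr 7 (by decide)]
    have a8 : s₂.arr 8 = s.arr 8 := by rw [f₂.arr 8 (by decide), f₁.arr 8 (by decide)]
    have a9 : s₂.arr 9 = s.arr 9 := by rw [f₂.arr 9 (by decide), f₁.arr 9 (by decide)]
    have v9 : s₂.var 9 = s.var 9 := by rw [f₂.var 9 (by decide), f₁.var 9 (by decide)]
    obtain ⟨s₃, c₃, hr₃, hc₃, hpost, hother⟩ := exists_runs_of_wp
      (wp_recordOptions (lam := lam) hF (s := s₂) (x := x) hin₂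
        (by rw [f₂.var 3 (by decide), h3₁])
        (by rw [f₂.arr 4 (by decide), f₁.arr 4 (by decide), hs.arr 4 (by decide), h4])
        (by rw [f₂.arr 6 (by decide), f₁.arr 6 (by decide), hs.arr 6 (by decide), h6])
        (by rw [a9]; exact hI₃ i le_rfl)
        (fun p => by
          rw [f₂.warr 1 (by decide), f₁.warr 1 (by decide), hs.warr 1 (by decide), hw1])
        h4₂ ho hC)
    rw [a7, a8, a9] at hother
    rw [v9] at hpost
    refine ⟨s₃, _, hr₁.seq _ _ _ _ _ _ _ (hr₂.seq _ _ _ _ _ _ _ hr₃), ⟨?_, ?_, ?_⟩, ?_⟩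
    · intro hz y hy
      rcases hpost with ⟨h9', hx⟩ | ⟨h9', -⟩
      · by_cases hyx : y = x
        · rw [hyx]; exact hx
        · have hne : y.val ≠ x.val := fun hc => hyx (Fin.ext hc)
          have hlt : y.val < i := by
            have : y.val ≠ i := hne
            omega
          obtain ⟨b7, b8, b9⟩ := hother y hne
          exact (hI₁ (h9' ▸ hz) y hlt).congr b7 b8 b9
      · rw [h9'] at hz; cases hz
    · intro hz
      rcases hpost with ⟨h9', -⟩ | ⟨-, hx⟩
      · exact hI₂ (h9' ▸ hz)
      · exact ⟨x, hx⟩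
    · intro j hj
      rw [(hother j (by simp only [hxdef]; omega)).2.2]
      exact hI₃ j (by omega)
    · have e : I.listLength 1 i = (I.pref x).length := by simp [listLength, hi, hxdef]
      rw [e]
      have hc₃' : c₃ ≤ 100 := hc₃.trans (by decide)
      have hc₂' : c₂ ≤ 40 * ((I.pref x).length + 1) :=
        hc₂.trans (Nat.mul_le_mul_right _ (by decide))
      omega)
  rw [hN] at hI₁ hI₃
  refine ⟨s', c, hr, ?_, fun h x => hI₁ h x x.2, hI₂, hI₃⟩
  rw [hN, sum_listLength] at hc
  unfold numVertices
  omega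

end Instance

/-! ### Orientations of multigraphs

Applicants with one or two possible jobs are seen as the edges of a multigraph on the jobs:
the edge `x` joins `a x` and `b x` (a loop if there is one possible job only).  Giving every
applicant a job of its own means orienting every edge so that no two edges enter the same vertex. -/

/-- The degree of the vertex `v` in the multigraph with edge set `S`; loops count twice. -/
def degree (a b : ℕ → ℕ) (S : Finset ℕ) (v : ℕ) : ℕ :=
  (S.filter fun x => a x = v).card + (S.filter fun x => b x = v).card

section Degree

variable {a b : ℕ → ℕ} {S T : Finset ℕ}

theorem degree_mono (h : S ⊆ T) (v : ℕ) : degree a b S v ≤ degree a b T v :=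
  Nat.add_le_add (Finset.card_le_card (Finset.filter_subset_filter _ h))
    (Finset.card_le_card (Finset.filter_subset_filter _ h))

theorem degree_erase {x : ℕ} (hx : x ∈ S) (v : ℕ) :
    degree a b (S.erase x) v + ((if a x = v then 1 else 0) + (if b x = v then 1 else 0)) =
      degree a b S v := by
  have aux : ∀ e : ℕ → ℕ, ((S.erase x).filter fun x => e x = v).card + (if e x = v then 1 else 0) =
      (S.filter fun x => e x = v).card := by
    intro e
    rw [Finset.filter_erase]
    split_ifs with h
    · exact Finset.card_erase_add_one (by simp [hx, h])
    · rw [Finset.erase_eq_of_notMem (by simp [h]), add_zero]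
  have h1 := aux a
  have h2 := aux b
  unfold degree
  omega

theorem degree_insert {x : ℕ} (hx : x ∉ S) (v : ℕ) :
    degree a b (insert x S) v =
      degree a b S v + ((if a x = v then 1 else 0) + (if b x = v then 1 else 0)) := by
  rw [← degree_erase (Finset.mem_insert_self x S) v, Finset.erase_insert hx]

theorem degree_pos_of_mem {x : ℕ} (hx : x ∈ S) :
    0 < degree a b S (a x) ∧ 0 < degree a b S (b x) := by
  have h1 := degree_erase (a := a) (b := b) hx (a x)
  have h2 := degree_erase (a := a) (b := b) hx (b x)
  simp only [if_true] at h1 h2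
  omega

theorem exists_mem_of_degree_ne_zero {v : ℕ} (h : degree a b S v ≠ 0) :
    ∃ x ∈ S, a x = v ∨ b x = v := by
  by_contra hc
  push Not at hc
  refine h ?_
  unfold degree
  rw [Finset.filter_false_of_mem fun x hx => (hc x hx).1,
    Finset.filter_false_of_mem fun x hx => (hc x hx).2]
  rfl

/-- The handshaking lemma. -/
theorem sum_degree {m : ℕ} (h : ∀ x ∈ S, a x < m ∧ b x < m) :
    ∑ v ∈ Finset.range m, degree a b S v = 2 * S.card := by
  unfold degree
  rw [Finset.sum_add_distrib,
    ← Finset.card_eq_sum_card_fiberwise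
      (fun x hx => Finset.mem_coe.2 (Finset.mem_range.2 (h x hx).1)),
    ← Finset.card_eq_sum_card_fiberwise
      (fun x hx => Finset.mem_coe.2 (Finset.mem_range.2 (h x hx).2))]
  ring

theorem degree_eq_zero_of_le {m v : ℕ} (h : ∀ x ∈ S, a x < m ∧ b x < m) (hv : m ≤ v) :
    degree a b S v = 0 := by
  by_contra hc
  obtain ⟨x, hx, h' | h'⟩ := exists_mem_of_degree_ne_zero hc
  · have := (h x hx).1; omega
  · have := (h x hx).2; omega

/-- If there are no leaves and a vertex of degree at least `3`, then there are more edges than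
vertices, and no orientation. -/
theorem degree_le_two_of_orientation {m : ℕ} (h : ∀ x ∈ S, a x < m ∧ b x < m)
    (hleaf : ∀ v, degree a b S v ≠ 1) {g : ℕ → ℕ} (hg : ∀ x ∈ S, g x = a x ∨ g x = b x)
    (hinj : ∀ x ∈ S, ∀ y ∈ S, g x = g y → x = y) (v : ℕ) : degree a b S v ≤ 2 := by
  by_contra hv
  push Not at hv
  set V := (Finset.range m).filter fun v => degree a b S v ≠ 0 with hV
  have hvm : v < m := by
    by_contra hc
    rw [degree_eq_zero_of_le h (not_lt.1 hc)] at hv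
    omega
  -- `g` maps the edges injectively to the vertices that are not isolated
  have hcard : S.card ≤ V.card := by
    refine Finset.card_le_card_of_injOn g ?_ (fun x hx y hy => hinj x hx y hy)
    intro x hx
    have hx' : x ∈ S := hx
    have hpos := degree_pos_of_mem (a := a) (b := b) hx'
    simp only [hV, Finset.coe_filter, Finset.mem_range, Set.mem_ofPred_eq]
    rcases hg x hx' with e | e <;> rw [e]
    · exact ⟨(h x hx').1, hpos.1.ne'⟩
    · exact ⟨(h x hx').2, hpos.2.ne'⟩
  have hsum : ∑ v ∈ V, degree a b S v = 2 * S.card := by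
    rw [← sum_degree h, hV, Finset.sum_filter_ne_zero]
  have : ∑ _v ∈ V, 2 < ∑ v ∈ V, degree a b S v := by
    refine Finset.sum_lt_sum (fun u hu => ?_) ⟨v, ?_, hv⟩
    · have h0 := (Finset.mem_filter.1 hu).2
      have h1 := hleaf u
      omega
    · simp only [hV, Finset.mem_filter, Finset.mem_range]
      exact ⟨hvm, by omega⟩
  rw [Finset.sum_const, smul_eq_mul] at this
  omega

/-- A partial orientation: the edges of `E` outside `S` have been oriented, `out x = v + 1` saying
that `x` enters `v`.  The vertices that have been entered are isolated in the rest of the graph,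
with the possible exception of `r`, which is not entered again. -/
structure Oriented (a b : ℕ → ℕ) (E S : Finset ℕ) (out : ℕ → ℕ) (r : ℕ) : Prop where
  subset : S ⊆ E
  out_eq : ∀ x ∈ E, x ∉ S → out x = a x + 1 ∨ out x = b x + 1
  out_zero : ∀ x, x ∉ E → out x = 0
  inj : ∀ x ∈ E, ∀ y ∈ E, x ∉ S → y ∉ S → out x = out y → x = y
  isolated : ∀ x ∈ E, x ∉ S → ∀ v, out x = v + 1 → v = r ∨ degree a b S v = 0
  exception : degree a b S r ≤ 1

variable {E : Finset ℕ} {out : ℕ → ℕ} {r : ℕ}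

/-- Orient the edge `x` towards its end `v`, which must not have been entered: as an end of `x` it
is not isolated, and it is not the exception `r`.  The exception may change to `r'` if `r` is
isolated. -/
theorem Oriented.orient {r' v x : ℕ} (h : Oriented a b E S out r) (hx : x ∈ S)
    (hv : v = a x ∨ v = b x) (hr : r' = r ∨ degree a b S r = 0)
    (hvr : v ≠ r) (hv0 : v = r' ∨ degree a b (S.erase x) v = 0)
    (hexc : degree a b (S.erase x) r' ≤ 1) :
    Oriented a b E (S.erase x) (Function.update out x (v + 1)) r' := by
  have hxE := h.subset hx
  have hmem : ∀ y, y ∉ S.erase x → y = x ∨ y ∉ S := by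
    intro y hy
    rw [Finset.mem_erase] at hy
    by_cases hyx : y = x
    · exact Or.inl hyx
    · exact Or.inr fun hc => hy ⟨hyx, hc⟩
  have hpos : degree a b S v ≠ 0 := by
    have := degree_pos_of_mem (a := a) (b := b) hx
    rcases hv with rfl | rfl
    · exact this.1.ne'
    · exact this.2.ne'
  have hnew : ∀ y ∈ E, y ∉ S → out y ≠ v + 1 := by
    intro y hy hyS hc
    rcases h.isolated y hy hyS v hc with h' | h'
    · exact hvr h'
    · exact hpos h'
  constructor
  · exact (Finset.erase_subset _ _).trans h.subset
  · intro y hy hyS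
    by_cases hyx : y = x
    · subst hyx
      rw [Function.update_self]
      rcases hv with rfl | rfl
      · exact Or.inl rfl
      · exact Or.inr rfl
    · rw [Function.update_of_ne hyx]
      exact h.out_eq y hy ((hmem y hyS).resolve_left hyx)
  · intro y hy
    rw [Function.update_of_ne (by rintro rfl; exact hy hxE)]
    exact h.out_zero y hy
  · intro y hy z hz hyS hzS
    by_cases hyx : y = x <;> by_cases hzx : z = x
    · intro; rw [hyx, hzx]
    · subst hyx
      rw [Function.update_self, Function.update_of_ne hzx]
      exact fun hc => absurd hc.symm (hnew z hz ((hmem z hzS).resolve_left hzx))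
    · subst hzx
      rw [Function.update_self, Function.update_of_ne hyx]
      exact fun hc => absurd hc (hnew y hy ((hmem y hyS).resolve_left hyx))
    · rw [Function.update_of_ne hyx, Function.update_of_ne hzx]
      exact h.inj y hy z hz ((hmem y hyS).resolve_left hyx) ((hmem z hzS).resolve_left hzx)
  · intro y hy hyS u hu
    by_cases hyx : y = x
    · subst hyx
      rw [Function.update_self, Nat.add_right_cancel_iff] at hu
      subst hu
      exact hv0
    · rw [Function.update_of_ne hyx] at hu
      have hle := degree_mono (a := a) (b := b) (Finset.erase_subset x S) u
      rcases h.isolated y hy ((hmem y hyS).resolve_left hyx) u hu with h' | h'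
      · rcases hr with hr | hr
        · exact Or.inl (h'.trans hr.symm)
        · subst h'; exact Or.inr (by omega)
      · exact Or.inr (by omega)
  · exact hexc

theorem Oriented.change_exception {r' : ℕ} (h : Oriented a b E S out r) (hr : degree a b S r = 0)
    (hr' : degree a b S r' ≤ 1) : Oriented a b E S out r' :=
  ⟨h.subset, h.out_eq, h.out_zero, h.inj, fun x hx hxS v hv => by
    rcases h.isolated x hx hxS v hv with rfl | h'
    · exact Or.inr hr
    · exact Or.inr h', hr'⟩

/-- If all degrees are `0` or `2`, except perhaps for one that is at most `1`, then that one
is `0`, because the sum of the degrees is even. -/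
theorem degree_eq_zero_of_parity {m r : ℕ} (h : ∀ x ∈ S, a x < m ∧ b x < m)
    (hdeg : ∀ v, v ≠ r → degree a b S v = 0 ∨ degree a b S v = 2) (hr : degree a b S r ≤ 1) :
    degree a b S r = 0 := by
  by_cases hrm : r < m
  · have hsum := sum_degree h
    rw [← Finset.add_sum_erase _ _ (Finset.mem_range.2 hrm)] at hsum
    have heven : 2 ∣ ∑ v ∈ (Finset.range m).erase r, degree a b S v := by
      refine Finset.dvd_sum fun v hv => ?_
      rcases hdeg v (Finset.ne_of_mem_erase hv) with e | e <;> simp [e]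
    omega
  · exact degree_eq_zero_of_le h (not_lt.1 hrm)

end Degree

/-- The largest `x < k` in `E` with `e x = v`, plus one, and `0` if there is none: the head of the
linked list of these `x`. -/
def lastEdge (E : Finset ℕ) (e : ℕ → ℕ) (v : ℕ) : ℕ → ℕ
  | 0 => 0
  | k + 1 => if k ∈ E ∧ e k = v then k + 1 else lastEdge E e v k

/-- `lastEdge E e v k - 1` is an edge of the list, unless this is empty, and no edge of the list
lies between it and `k`. -/
theorem lastEdge_spec (E : Finset ℕ) (e : ℕ → ℕ) (v k : ℕ) :
    (∀ x ∈ E, e x = v → x < k → x < lastEdge E e v k) ∧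
      lastEdge E e v k ≤ k ∧
      (lastEdge E e v k = 0 ∨
        lastEdge E e v k - 1 ∈ E ∧ e (lastEdge E e v k - 1) = v) := by
  induction k with
  | zero => simp [lastEdge]
  | succ k ih =>
    unfold lastEdge
    split_ifs with h
    · exact ⟨fun x _ _ hx => hx, le_rfl, Or.inr h⟩
    · refine ⟨fun x hx hv hxk => ?_, ih.2.1.trans (Nat.le_succ k), ih.2.2⟩
      rcases Nat.lt_succ_iff_lt_or_eq.1 hxk with h' | rfl
      · exact ih.1 x hx hv h'
      · exact absurd ⟨hx, hv⟩ h

/-! ### Orienting the multigraph of options -/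

/-- The memory holds, in the integer arrays `10` to `13`, for every vertex the linked lists of the
edges of `E` of which it is the first and the second end; array entries are increased by one. -/
structure Adjacency (a b : ℕ → ℕ) (E : Finset ℕ) (n : ℕ) (s : State) : Prop where
  fst : s.arr 7 = a
  snd : s.arr 8 = b
  head_fst : ∀ v, s.arr 10 v = lastEdge E a v n
  next_fst : ∀ x ∈ E, s.arr 11 x = lastEdge E a (a x) x
  head_snd : ∀ v, s.arr 12 v = lastEdge E b v n
  next_snd : ∀ x ∈ E, s.arr 13 x = lastEdge E b (b x) x

theorem Adjacency.of_sameOutside {a b : ℕ → ℕ} {E : Finset ℕ} {n : ℕ} {s s' : State} {P : Program}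
    (h : Adjacency a b E n s) (hs : P.SameOutside s s')
    (hP : 7 ∉ P.arrs ∧ 8 ∉ P.arrs ∧ 10 ∉ P.arrs ∧ 11 ∉ P.arrs ∧ 12 ∉ P.arrs ∧ 13 ∉ P.arrs := by
      decide) : Adjacency a b E n s' := by
  obtain ⟨h7, h8, h10, h11, h12, h13⟩ := hP
  refine ⟨(hs.arr 7 h7).trans h.fst, (hs.arr 8 h8).trans h.snd, ?_, ?_, ?_, ?_⟩
  · rw [hs.arr 10 h10]; exact h.head_fst
  · rw [hs.arr 11 h11]; exact h.next_fst
  · rw [hs.arr 12 h12]; exact h.head_snd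
  · rw [hs.arr 13 h13]; exact h.next_snd

/-- The memory holds the set `S` of the edges not yet oriented and their degrees. -/
structure Remaining (a b : ℕ → ℕ) (S : Finset ℕ) (s : State) : Prop where
  mark : ∀ x, s.arr 9 x = if x ∈ S then 1 else 0
  deg : ∀ v, s.arr 14 v = degree a b S v

theorem Remaining.of_arr_eq {a b : ℕ → ℕ} {S : Finset ℕ} {s s' : State}
    (h : Remaining a b S s) (h9 : s'.arr 9 = s.arr 9) (h14 : s'.arr 14 = s.arr 14) :
    Remaining a b S s' :=
  ⟨by rw [h9]; exact h.mark, by rw [h14]; exact h.deg⟩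

theorem Remaining.mem_iff {a b : ℕ → ℕ} {S : Finset ℕ} {s : State} (h : Remaining a b S s) (x : ℕ) :
    x ∈ S ↔ s.arr 9 x ≠ 0 := by
  rw [h.mark]; split_ifs with hx <;> simp [hx]

/-- Remove an edge with ends `u` and `w`. -/
theorem Remaining.erase {a b : ℕ → ℕ} {S : Finset ℕ} {s s' : State} (h : Remaining a b S s)
    {x u w : ℕ} (hx : x ∈ S) (huw : (a x = u ∧ b x = w) ∨ (b x = u ∧ a x = w))
    (h9 : s'.arr 9 = Function.update (s.arr 9) x 0)
    (h14 : s'.arr 14 = Function.update (Function.update (s.arr 14) u (s.arr 14 u - 1)) w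
      (Function.update (s.arr 14) u (s.arr 14 u - 1) w - 1)) :
    Remaining a b (S.erase x) s' := by
  constructor
  · intro y
    rw [h9]
    by_cases hy : y = x
    · simp [hy]
    · simp [hy, h.mark]
  · intro v
    have := degree_erase (a := a) (b := b) hx v
    have hd := h.deg
    rw [h14]
    simp only [Function.update_apply, hd]
    rcases huw with ⟨rfl, rfl⟩ | ⟨rfl, rfl⟩ <;>
      by_cases h1 : v = a x <;> by_cases h2 : v = b x <;>
      simp_all [eq_comm] <;> omega

/-- Walk along the linked list with heads in array `H` and links in array `N` at the vertex in
variable `6` to an edge not yet oriented, and put it, plus one, into variable `7` (`0` if there is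
none). -/
def search (H N : ℕ) : Program :=
  .seq (.setVar 7 (.get H (.var 6)))
    (.loop (.and (.not (.eq (.var 7) (.const 0))) (.eq (.get 9 (.pred (.var 7))) (.const 0)))
      (.setVar 7 (.get N (.pred (.var 7)))))

theorem exists_runs_search {H N n cur : ℕ} {e : ℕ → ℕ} {E S : Finset ℕ} (hE : ∀ x ∈ E, x < n)
    (hSE : S ⊆ E) (s₀ : State) (hcur : s₀.var 6 = cur) (hH : s₀.arr H cur = lastEdge E e cur n)
    (hN : ∀ x ∈ E, s₀.arr N x = lastEdge E e (e x) x)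
    (h9 : ∀ x, x ∈ S ↔ s₀.arr 9 x ≠ 0) :
    ∃ s' c, Runs (search H N) s₀ s' c ∧ c ≤ 14 * ((E.filter fun x => e x = cur).card + 1) ∧
      (s'.var 7 = 0 → ∀ x ∈ S, e x ≠ cur) ∧
      (s'.var 7 ≠ 0 → s'.var 7 - 1 ∈ S ∧ e (s'.var 7 - 1) = cur) := by
  obtain ⟨hl₁, hl₂, hl₃⟩ := lastEdge_spec E e cur n
  obtain ⟨s₁, c₁, hr₁, hc₁, hs₁⟩ := exists_runs_of_wp (P := .setVar 7 (.get H (.var 6)))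
    (s := s₀) (post := fun s => s.var 7 = lastEdge E e cur n) (by
      simp [wp, IntExp.eval, hcur, hH])
  have f₁ := hr₁.sameOutside
  obtain ⟨s', c, hr, hs, ⟨hI₁, hI₂⟩, ht, hc⟩ := exists_runs_loop
    (.and (.not (.eq (.var 7) (.const 0))) (.eq (.get 9 (.pred (.var 7))) (.const 0)))
    (.setVar 7 (.get N (.pred (.var 7))))
    (fun s => (s.var 7 = 0 ∨ s.var 7 - 1 ∈ E ∧ e (s.var 7 - 1) = cur) ∧
      ∀ x ∈ S, e x = cur → x < s.var 7)
    (fun s => 14 * (E.filter fun x => e x = cur ∧ x < s.var 7).card) s₁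
    ⟨by rw [hs₁]; exact hl₃, by
      rw [hs₁]; exact fun x hx hv => hl₁ x (hSE hx) hv (hE x (hSE hx))⟩ (by
    rintro s hs ⟨hI₁, hI₂⟩ ⟨ht₁, ht₂⟩
    simp only [Test.Holds, IntExp.eval] at ht₁ ht₂
    obtain ⟨hzE, hzv⟩ := hI₁.resolve_left ht₁
    have hzS : s.var 7 - 1 ∉ S := by
      rw [h9, not_not, ← ht₂, hs.arr 9 (by simp [arrs]), f₁.arr 9 (by simp [arrs])]
    have hnext : (IntExp.get N (.pred (.var 7))).eval s = lastEdge E e cur (s.var 7 - 1) := by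
      simp only [IntExp.eval]
      rw [hs.arr N (by simp [arrs]), f₁.arr N (by simp [arrs]), hN _ hzE, hzv]
    obtain ⟨hm₁, hm₂, hm₃⟩ := lastEdge_spec E e cur (s.var 7 - 1)
    refine ⟨_, _, Runs.setVar _ _ _, ⟨?_, ?_⟩, ?_⟩
    · simp only [Function.update_self, hnext]; exact hm₃
    · intro x hx hv
      simp only [Function.update_self, hnext]
      have hne : x ≠ s.var 7 - 1 := by rintro rfl; exact hzS hx
      have := hI₂ x hx hv
      exact hm₁ x (hSE hx) hv (by omega)
    · simp only [Function.update_self, hnext, Test.cost, IntExp.cost]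
      have : (E.filter fun x => e x = cur ∧ x < lastEdge E e cur (s.var 7 - 1)).card <
          (E.filter fun x => e x = cur ∧ x < s.var 7).card := by
        refine Finset.card_lt_card ⟨fun x hx => ?_, fun hc => ?_⟩
        · simp only [Finset.mem_filter] at hx ⊢
          exact ⟨hx.1, hx.2.1, by omega⟩
        · have hz : s.var 7 - 1 ∈ E.filter fun x => e x = cur ∧ x < s.var 7 := by
            simp only [Finset.mem_filter]
            exact ⟨hzE, hzv, by omega⟩
          have := hc hz
          simp only [Finset.mem_filter] at this
          omega
      omega)
  refine ⟨s', _, hr₁.seq _ _ _ _ _ _ _ hr, ?_, ?_, ?_⟩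
  · have hle : (E.filter fun x => e x = cur ∧ x < s₁.var 7).card ≤
        (E.filter fun x => e x = cur).card :=
      Finset.card_le_card fun x hx => by
        simp only [Finset.mem_filter] at hx ⊢
        exact ⟨hx.1, hx.2.1⟩
    simp only [Test.cost, IntExp.cost, size] at hc hc₁
    omega
  · intro hz x hx hv
    have := hI₂ x hx hv
    omega
  · intro hz
    obtain ⟨hzE, hzv⟩ := hI₁.resolve_left hz
    refine ⟨?_, hzv⟩
    rw [h9]
    intro hc'
    refine ht ⟨hz, ?_⟩
    simp only [Test.Holds, IntExp.eval]
    rw [hs.arr 9 (by simp [arrs]), f₁.arr 9 (by simp [arrs])]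
    exact hc'

/-- Orient the edge in variable `7` (plus one) towards the vertex in variable `6`, and move to its
other end, given in variable `8`. -/
def enter : Program :=
  .seq (.setArr 9 (.pred (.var 7)) (.const 0))
  (.seq (.setArr 3 (.pred (.var 7)) (.succ (.var 6)))
  (.seq (.setArr 14 (.var 6) (.pred (.get 14 (.var 6))))
  (.seq (.setArr 14 (.var 8) (.pred (.get 14 (.var 8)))) (.setVar 6 (.var 8)))))

/-- Orient the only edge at the leaf in variable `6` towards the leaf, and move to its other end. -/
def walkStep : Program :=
  .seq (search 10 11)
  (.seq (.ite (.eq (.var 7) (.const 0))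
      (.seq (search 12 13) (.setVar 8 (.get 7 (.pred (.var 7)))))
      (.setVar 8 (.get 8 (.pred (.var 7)))))
    enter)

/-- Remove the vertex in variable `6` if it is a leaf, and go on, as long as the other end of the
edge at the last leaf becomes a leaf. -/
def walk : Program := .loop (.eq (.get 14 (.var 6)) (.const 1)) walkStep

theorem exists_runs_enter {a b : ℕ → ℕ} {S : Finset ℕ} {s : State} {x u w : ℕ}
    (h : Remaining a b S s) (hx : x ∈ S) (huw : (a x = u ∧ b x = w) ∨ (b x = u ∧ a x = w))
    (h7 : s.var 7 - 1 = x) (h6 : s.var 6 = u) (h8 : s.var 8 = w) :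
    ∃ s' c, Runs enter s s' c ∧ c ≤ 30 ∧ Remaining a b (S.erase x) s' ∧
      s'.arr 3 = Function.update (s.arr 3) x (u + 1) ∧ s'.var 6 = w := by
  obtain ⟨s', c, hr, hc, ⟨h9, h14⟩, h3, h6'⟩ := exists_runs_of_wp (P := enter) (s := s)
    (post := fun s' => (s'.arr 9 = Function.update (s.arr 9) x 0 ∧
      s'.arr 14 = Function.update (Function.update (s.arr 14) u (s.arr 14 u - 1)) w
        (Function.update (s.arr 14) u (s.arr 14 u - 1) w - 1)) ∧
      s'.arr 3 = Function.update (s.arr 3) x (u + 1) ∧ s'.var 6 = w) (by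
    simp [enter, wp, IntExp.eval, h7, h6, h8])
  exact ⟨s', c, hr, hc.trans (by decide), h.erase hx huw h9 h14, h3, h6'⟩

theorem exists_runs_walkStep {a b : ℕ → ℕ} {E S : Finset ℕ} {n : ℕ} {s : State} {cur : ℕ}
    (hE : ∀ x ∈ E, x < n) (hSE : S ⊆ E) (hadj : Adjacency a b E n s)
    (hrem : Remaining a b S s) (h6 : s.var 6 = cur) (hdeg : degree a b S cur ≠ 0) :
    ∃ s' c x w, Runs walkStep s s' c ∧ c ≤ 70 * (degree a b E cur + 1) ∧
      x ∈ S ∧ ((a x = cur ∧ b x = w) ∨ (b x = cur ∧ a x = w)) ∧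
      Remaining a b (S.erase x) s' ∧ s'.arr 3 = Function.update (s.arr 3) x (cur + 1) ∧
      s'.var 6 = w := by
  obtain ⟨s₁, c₁, hr₁, hc₁, hno₁, hyes₁⟩ := exists_runs_search (H := 10) (N := 11) hE hSE s h6
    (hadj.head_fst cur) hadj.next_fst hrem.mem_iff
  have f₁ := hr₁.sameOutside
  have hadj₁ : Adjacency a b E n s₁ := hadj.of_sameOutside f₁
  have hrem₁ : Remaining a b S s₁ := hrem.of_arr_eq (f₁.arr 9 (by decide)) (f₁.arr 14 (by decide))
  have h6₁ : s₁.var 6 = cur := by rw [f₁.var 6 (by decide), h6]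
  have a3 : s₁.arr 3 = s.arr 3 := f₁.arr 3 (by decide)
  by_cases hz : s₁.var 7 = 0
  · obtain ⟨s₂, c₂, hr₂, hc₂, hno₂, hyes₂⟩ := exists_runs_search (H := 12) (N := 13) hE hSE s₁ h6₁
      (hadj₁.head_snd cur) hadj₁.next_snd hrem₁.mem_iff
    have f₂ := hr₂.sameOutside
    have hz₂ : s₂.var 7 ≠ 0 := by
      intro hz'
      obtain ⟨x, hx, hxa | hxb⟩ := exists_mem_of_degree_ne_zero hdeg
      · exact hno₁ hz x hx hxa
      · exact hno₂ hz' x hx hxb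
    obtain ⟨hxS, hxb⟩ := hyes₂ hz₂
    obtain ⟨s₃, c₃, hr₃, hc₃, h8₃⟩ := exists_runs_of_wp (s := s₂)
      (P := .setVar 8 (.get 7 (.pred (.var 7)))) (post := fun s' => s'.var 8 = a (s₂.var 7 - 1)) (by
        simp only [wp, IntExp.eval, Function.update_self]
        rw [f₂.arr 7 (by decide), hadj₁.fst])
    have f₃ := hr₃.sameOutside
    have hrem₃ : Remaining a b S s₃ := hrem₁.of_arr_eq
      (by rw [f₃.arr 9 (by decide), f₂.arr 9 (by decide)])
      (by rw [f₃.arr 14 (by decide), f₂.arr 14 (by decide)])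
    obtain ⟨s₄, c₄, hr₄, hc₄, hrem₄, h3₄, h6₄⟩ := exists_runs_enter hrem₃ hxS
      (Or.inr ⟨hxb, rfl⟩) (by rw [f₃.var 7 (by decide)])
      (by rw [f₃.var 6 (by decide), f₂.var 6 (by decide), h6₁]) h8₃
    refine ⟨s₄, _, _, _, hr₁.seq _ _ _ _ _ _ _ ((Runs.ite_true (.eq (.var 7) (.const 0))
      _ _ _ _ _ hz (hr₂.seq _ _ _ _ _ _ _ hr₃)).seq _ _ _ _ _ _ _ hr₄), ?_, hxS,
      Or.inr ⟨hxb, rfl⟩, hrem₄, ?_,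
      h6₄⟩
    · have hc₃' : c₃ ≤ 4 := hc₃.trans (by decide)
      simp only [Test.cost, IntExp.cost, degree]
      omega
    · rw [h3₄, f₃.arr 3 (by decide), f₂.arr 3 (by decide), a3]
  · obtain ⟨hxS, hxa⟩ := hyes₁ hz
    obtain ⟨s₃, c₃, hr₃, hc₃, h8₃⟩ := exists_runs_of_wp (s := s₁)
      (P := .setVar 8 (.get 8 (.pred (.var 7)))) (post := fun s' => s'.var 8 = b (s₁.var 7 - 1)) (by
        simp only [wp, IntExp.eval, Function.update_self]
        rw [hadj₁.snd])
    have f₃ := hr₃.sameOutside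
    have hrem₃ : Remaining a b S s₃ := hrem₁.of_arr_eq
      (by rw [f₃.arr 9 (by decide)]) (by rw [f₃.arr 14 (by decide)])
    obtain ⟨s₄, c₄, hr₄, hc₄, hrem₄, h3₄, h6₄⟩ := exists_runs_enter hrem₃ hxS
      (Or.inl ⟨hxa, rfl⟩) (by rw [f₃.var 7 (by decide)])
      (by rw [f₃.var 6 (by decide), h6₁]) h8₃
    refine ⟨s₄, _, _, _, hr₁.seq _ _ _ _ _ _ _ ((Runs.ite_false (.eq (.var 7) (.const 0))
      _ _ _ _ _ hz hr₃).seq _ _ _ _ _ _ _ hr₄), ?_, hxS, Or.inl ⟨hxa, rfl⟩, hrem₄, ?_, h6₄⟩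
    · have hc₃' : c₃ ≤ 4 := hc₃.trans (by decide)
      simp only [Test.cost, IntExp.cost, degree]
      omega
    · rw [h3₄, f₃.arr 3 (by decide), a3]

/-- The potential that pays for the walks: a vertex is searched when it is a leaf, and is isolated
from then on. -/
def potential (a b : ℕ → ℕ) (E : Finset ℕ) (m : ℕ) (s : State) : ℕ :=
  100 * ∑ v ∈ Finset.range m, if s.arr 14 v = 0 then 0 else degree a b E v + 1

theorem potential_le {a b : ℕ → ℕ} {E S S' : Finset ℕ} {m : ℕ} {s s' : State} (hss : S' ⊆ S)
    (h : Remaining a b S s) (h' : Remaining a b S' s') :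
    potential a b E m s' ≤ potential a b E m s := by
  unfold potential
  refine Nat.mul_le_mul_left _ (Finset.sum_le_sum fun v _ => ?_)
  have := degree_mono (a := a) (b := b) hss v
  rw [h.deg, h'.deg]
  split_ifs <;> omega

theorem potential_add_le {a b : ℕ → ℕ} {E S S' : Finset ℕ} {m : ℕ} {s s' : State} (hss : S' ⊆ S)
    (h : Remaining a b S s) (h' : Remaining a b S' s') {v : ℕ} (hv : v < m)
    (h1 : degree a b S v ≠ 0) (h2 : degree a b S' v = 0) :
    potential a b E m s' + 100 * (degree a b E v + 1) ≤ potential a b E m s := by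
  unfold potential
  rw [← Nat.mul_add]
  refine Nat.mul_le_mul_left _ ?_
  rw [← Finset.add_sum_erase _ _ (Finset.mem_range.2 hv),
    ← Finset.add_sum_erase (Finset.range m) (fun v => if s.arr 14 v = 0 then 0 else _)
      (Finset.mem_range.2 hv)]
  rw [h.deg, h'.deg, if_pos h2, if_neg h1, zero_add, add_comm]
  refine Nat.add_le_add_left (Finset.sum_le_sum fun u _ => ?_) _
  have := degree_mono (a := a) (b := b) hss u
  rw [h.deg, h'.deg]
  split_ifs <;> omega

theorem potential_le_linear {a b : ℕ → ℕ} {E : Finset ℕ} {n m : ℕ}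
    (hE : ∀ x ∈ E, x < n) (hab : ∀ x ∈ E, a x < m ∧ b x < m) (s : State) :
    potential a b E m s ≤ 100 * (2 * n + m) := by
  unfold potential
  refine Nat.mul_le_mul_left _ ?_
  calc _ ≤ ∑ v ∈ Finset.range m, (degree a b E v + 1) :=
        Finset.sum_le_sum fun v _ => by split_ifs <;> omega
    _ = 2 * E.card + m := by
        rw [Finset.sum_add_distrib, sum_degree hab]; simp
    _ ≤ 2 * n + m := by
        have : E.card ≤ (Finset.range n).card :=
          Finset.card_le_card fun x hx => Finset.mem_range.2 (hE x hx)
        rw [Finset.card_range] at this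
        omega

/-- A walk makes no new leaves: if all leaves in `U` are the start of the walk or the exceptional
vertex, then only the exceptional vertex can be a leaf afterwards. -/
theorem exists_runs_walk {a b : ℕ → ℕ} {E S₀ : Finset ℕ} {n m r : ℕ} {s₀ : State}
    (hE : ∀ x ∈ E, x < n) (hab : ∀ x ∈ E, a x < m ∧ b x < m) (hadj : Adjacency a b E n s₀)
    (hrem : Remaining a b S₀ s₀) (hor : Oriented a b E S₀ (s₀.arr 3) r)
    (hr0 : s₀.var 6 = r → degree a b S₀ r = 0) (U : Set ℕ)
    (hU : ∀ u ∈ U, degree a b S₀ u = 1 → u = s₀.var 6 ∨ u = r) :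
    ∃ s' c S, Runs walk s₀ s' c ∧ S ⊆ S₀ ∧ Remaining a b S s' ∧
      Oriented a b E S (s'.arr 3) r ∧ (∀ u ∈ U, degree a b S u = 1 → u = r) ∧
      c + potential a b E m s' ≤ potential a b E m s₀ + 5 := by
  obtain ⟨s', c, hr, hs, ⟨S, hSS, hremS, horS, hr0S, hUS⟩, ht, hc⟩ := exists_runs_loop
    (.eq (.get 14 (.var 6)) (.const 1)) walkStep
    (fun s => ∃ S, S ⊆ S₀ ∧ Remaining a b S s ∧ Oriented a b E S (s.arr 3) r ∧
      (s.var 6 = r → degree a b S r = 0) ∧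
      ∀ u ∈ U, degree a b S u = 1 → u = s.var 6 ∨ u = r)
    (potential a b E m) s₀ ⟨S₀, subset_rfl, hrem, hor, hr0, hU⟩ (by
    rintro s hs ⟨S, hSS, hremS, horS, hr0S, hUS⟩ ht
    simp only [Test.Holds, IntExp.eval, hremS.deg] at ht
    obtain ⟨s', c, x, w, hr, hc, hxS, huw, hrem', h3, h6⟩ := exists_runs_walkStep hE horS.subset
      (hadj.of_sameOutside hs) hremS rfl (by omega)
    have hcr : s.var 6 ≠ r := by
      intro hc'
      have := hr0S hc'
      rw [hc'] at ht; omega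
    have hdeg := fun v => degree_erase (a := a) (b := b) hxS v
    have hcur0 : degree a b (S.erase x) (s.var 6) = 0 := by
      have := hdeg (s.var 6)
      rcases huw with ⟨h1, h2⟩ | ⟨h1, h2⟩ <;> simp only [h1, if_true] at this <;> omega
    have hw : degree a b (S.erase x) w < degree a b S w := by
      have := hdeg w
      rcases huw with ⟨h1, h2⟩ | ⟨h1, h2⟩ <;> simp only [h2, if_true] at this <;> omega
    have hexc := horS.exception
    have hm : s.var 6 < m := by
      have := hab x (horS.subset hxS)
      rcases huw with ⟨h1, h2⟩ | ⟨h1, h2⟩ <;> omega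
    refine ⟨s', c, hr, ⟨S.erase x, (Finset.erase_subset _ _).trans hSS, hrem', ?_, ?_, ?_⟩, ?_⟩
    · rw [h3]
      refine horS.orient hxS ?_ (Or.inl rfl) hcr (Or.inr hcur0)
        ((degree_mono (Finset.erase_subset _ _) r).trans hexc)
      exact huw.imp (fun h => h.1.symm) fun h => h.1.symm
    · rw [h6]
      rintro rfl
      omega
    · intro u hu hdu
      rw [h6]
      by_cases huw' : u = w
      · exact Or.inl huw'
      right
      have huc : u ≠ s.var 6 := by rintro rfl; omega
      have h1 := hdeg u
      have : degree a b S u = 1 := by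
        rcases huw with ⟨h2, h3⟩ | ⟨h2, h3⟩ <;>
          simp only [h2, h3, if_neg (Ne.symm huw'), if_neg (Ne.symm huc)] at h1 <;> omega
      exact (hUS u hu this).resolve_left huc
    · -- the lists of the leaf have been searched, and the leaf is isolated now
      have := potential_add_le (E := E) (Finset.erase_subset x S) hremS hrem' hm (by omega) hcur0
      simp only [Test.cost, IntExp.cost]
      omega)
  have ht' : degree a b S (s'.var 6) ≠ 1 := by
    simpa only [Test.Holds, IntExp.eval, hremS.deg] using ht
  refine ⟨s', c, S, hr, hSS, hremS, horS, fun u hu hdu => ?_, ?_⟩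
  · rcases hUS u hu hdu with rfl | h
    · exact absurd hdu ht'
    · exact h
  · simp only [Test.cost, IntExp.cost] at hc
    omega

/-- If the edge in variable `2` is present, put it in front of the lists of its two ends, and count
it in their degrees. -/
def linkEdge : Program :=
  .ite (.eq (.get 9 (.var 2)) (.const 0)) .skip
    (.seq (.setArr 11 (.var 2) (.get 10 (.get 7 (.var 2))))
    (.seq (.setArr 10 (.get 7 (.var 2)) (.succ (.var 2)))
    (.seq (.setArr 13 (.var 2) (.get 12 (.get 8 (.var 2))))
    (.seq (.setArr 12 (.get 8 (.var 2)) (.succ (.var 2)))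
    (.seq (.setArr 14 (.get 7 (.var 2)) (.succ (.get 14 (.get 7 (.var 2)))))
      (.setArr 14 (.get 8 (.var 2)) (.succ (.get 14 (.get 8 (.var 2))))))))))

/-- The linked lists, in the integer arrays `10` to `13`, and the degrees, in integer array `14`. -/
def buildLists : Program := forLoop (.var 0) linkEdge

/-- Walks from all vertices, after which there are no leaves. -/
def peel : Program := forLoop (.var 1) (.seq (.setVar 6 (.var 2)) walk)

/-- Set variable `9` if there is a vertex of degree at least `3`. -/
def checkDegrees : Program :=
  forLoop (.var 1) (.ite (.lt (.const 2) (.get 14 (.var 2))) (.setVar 9 (.const 1)) .skip)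

/-- Orient the edge in variable `2` towards its first end and move to its second end. -/
def breakCycle : Program :=
  .seq (.setVar 7 (.succ (.var 2))) (.seq (.setVar 6 (.get 7 (.var 2)))
    (.seq (.setVar 8 (.get 8 (.var 2))) enter))

/-- Orient a disjoint union of cycles: break every cycle at its first edge, and walk around it. -/
def orientCycles : Program :=
  forLoop (.var 0)
    (.ite (.eq (.get 9 (.var 2)) (.const 0)) .skip (.seq breakCycle walk))

/-- Orient the multigraph of options so that no two edges enter the same vertex, or set
variable `9`. -/
def orient : Program :=
  .seq buildLists (.seq peel (.seq checkDegrees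
    (.ite (.eq (.var 9) (.const 0)) orientCycles .skip)))

section Orient

variable {a b : ℕ → ℕ} {E : Finset ℕ} {n m : ℕ} {s₀ : State}

theorem exists_runs_buildLists (hn : s₀.var 0 = n) (ha : s₀.arr 7 = a) (hb : s₀.arr 8 = b)
    (hE : ∀ x ∈ E, x < n) (h9 : ∀ x, s₀.arr 9 x = if x ∈ E then 1 else 0)
    (h10 : ∀ v, s₀.arr 10 v = 0) (h12 : ∀ v, s₀.arr 12 v = 0) (h14 : ∀ v, s₀.arr 14 v = 0) :
    ∃ s' c, Runs buildLists s₀ s' c ∧ c ≤ 100 * (n + 1) ∧ Adjacency a b E n s' ∧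
      Remaining a b E s' := by
  obtain ⟨s', c, hr, ⟨hI₁, hI₂, hI₃, hI₄, hI₅⟩, hc⟩ := exists_runs_forLoop 0
    linkEdge
    (fun i s => (∀ v, s.arr 10 v = lastEdge E a v i) ∧
      (∀ x ∈ E, x < i → s.arr 11 x = lastEdge E a (a x) x) ∧
      (∀ v, s.arr 12 v = lastEdge E b v i) ∧
      (∀ x ∈ E, x < i → s.arr 13 x = lastEdge E b (b x) x) ∧
      ∀ v, s.arr 14 v = degree a b (E.filter fun x => x < i) v)
    (fun _ => 0) (fun _ => 60) s₀ (by decide) (by decide) (by decide)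
    (fun _ _ _ h => h) (fun _ _ => rfl)
    ⟨by simp [h10, lastEdge], by simp, by simp [h12, lastEdge], by simp, by simp [h14, degree]⟩ (by
    rintro i s hs hi hsi ⟨hI₁, hI₂, hI₃, hI₄, hI₅⟩
    have a7 : s.arr 7 = a := by rw [hs.arr 7 (by decide), ha]
    have a8 : s.arr 8 = b := by rw [hs.arr 8 (by decide), hb]
    have a9 : s.arr 9 = s₀.arr 9 := hs.arr 9 (by decide)
    obtain ⟨s', c, hr, hc, hpost⟩ := exists_runs_of_wp (s := s)
      (P := linkEdge) (post := fun s => (∀ v, s.arr 10 v = lastEdge E a v (i + 1)) ∧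
        (∀ x ∈ E, x < i + 1 → s.arr 11 x = lastEdge E a (a x) x) ∧
        (∀ v, s.arr 12 v = lastEdge E b v (i + 1)) ∧
        (∀ x ∈ E, x < i + 1 → s.arr 13 x = lastEdge E b (b x) x) ∧
        ∀ v, s.arr 14 v = degree a b (E.filter fun x => x < i + 1) v) (by
      by_cases hiE : i ∈ E
      · have hfilter : (E.filter fun x => x < i + 1) = insert i (E.filter fun x => x < i) := by
          ext x
          simp only [Finset.mem_filter, Finset.mem_insert]
          constructor
          · rintro ⟨hx, hlt⟩
            rcases Nat.lt_succ_iff_lt_or_eq.1 hlt with h | h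
            · exact Or.inr ⟨hx, h⟩
            · exact Or.inl h
          · rintro (rfl | ⟨hx, hlt⟩)
            · exact ⟨hiE, Nat.lt_succ_self _⟩
            · exact ⟨hx, hlt.trans (Nat.lt_succ_self _)⟩
        refine ⟨fun hc => ?_, fun _ => ?_⟩
        · simp [Test.Holds, IntExp.eval, hsi, a9, h9, hiE] at hc
        · simp only [wp, IntExp.eval, hsi, a7, a8, Function.update_self, ne_eq,
            not_false_eq_true, Function.update_of_ne, Nat.reduceEqDiff]
          refine ⟨fun v => ?_, fun x hx hlt => ?_, fun v => ?_, fun x hx hlt => ?_, fun v => ?_⟩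
          · by_cases hv : v = a i
            · simp [lastEdge, hv, hiE]
            · simp [lastEdge, hv, Ne.symm hv, hI₁]
          · by_cases hxi : x = i
            · subst hxi; simp [hI₁]
            · simp only [Function.update_of_ne hxi]
              exact hI₂ x hx (by omega)
          · by_cases hv : v = b i
            · simp [lastEdge, hv, hiE]
            · simp [lastEdge, hv, Ne.symm hv, hI₃]
          · by_cases hxi : x = i
            · subst hxi; simp [hI₃]
            · simp only [Function.update_of_ne hxi]
              exact hI₄ x hx (by omega)
          · rw [hfilter, degree_insert (by simp)]
            simp only [Function.update_apply, hI₅]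
            by_cases h1 : v = a i <;> by_cases h2 : v = b i <;> simp_all [eq_comm]
      · have hfilter : (E.filter fun x => x < i + 1) = E.filter fun x => x < i := by
          refine Finset.filter_congr fun x hx => ?_
          have : x ≠ i := by rintro rfl; exact hiE hx
          omega
        refine ⟨fun _ => ⟨fun v => ?_, fun x hx hlt => ?_, fun v => ?_, fun x hx hlt => ?_,
          fun v => ?_⟩, fun hc => ?_⟩
        · simp [lastEdge, hiE, hI₁]
        · have : x ≠ i := by rintro rfl; exact hiE hx
          exact hI₂ x hx (by omega)
        · simp [lastEdge, hiE, hI₃]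
        · have : x ≠ i := by rintro rfl; exact hiE hx
          exact hI₄ x hx (by omega)
        · rw [hfilter]; exact hI₅ v
        · simp [Test.Holds, IntExp.eval, hsi, a9, h9, hiE] at hc)
    exact ⟨s', c, hr, hpost, by have := hc.trans (show _ ≤ 60 by decide); omega⟩)
  rw [hn] at hI₁ hI₂ hI₃ hI₄ hI₅ hc
  have f := hr.sameOutside
  have hfilter : (E.filter fun x => x < n) = E := Finset.filter_true_of_mem hE
  rw [hfilter] at hI₅
  refine ⟨s', c, hr, ?_, ⟨?_, ?_, hI₁, fun x hx => hI₂ x hx (hE x hx), hI₃,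
    fun x hx => hI₄ x hx (hE x hx)⟩, ⟨?_, hI₅⟩⟩
  · simp at hc; omega
  · rw [f.arr 7 (by decide), ha]
  · rw [f.arr 8 (by decide), hb]
  · rw [f.arr 9 (by decide)]; exact h9

/-- After `peel` there are no leaves.  The vertex `m`, which is no end of any edge, serves as the
exception, meaning that there is none. -/
theorem exists_runs_peel (hm : s₀.var 1 = m) (hE : ∀ x ∈ E, x < n)
    (hab : ∀ x ∈ E, a x < m ∧ b x < m) (hadj : Adjacency a b E n s₀) (hrem : Remaining a b E s₀)
    (h3 : ∀ x, s₀.arr 3 x = 0) :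
    ∃ s' c S, Runs peel s₀ s' c ∧ c ≤ 300 * (n + m + 1) ∧ Remaining a b S s' ∧
      Oriented a b E S (s'.arr 3) m ∧ ∀ v, degree a b S v ≠ 1 := by
  have hzero : ∀ S, S ⊆ E → degree a b S m = 0 := fun S hS =>
    degree_eq_zero_of_le (fun x hx => hab x (hS hx)) le_rfl
  obtain ⟨s', c, hr, ⟨S, hremS, horS, hleaf⟩, hc⟩ := exists_runs_forLoop 1
    (.seq (.setVar 6 (.var 2)) walk)
    (fun i s => ∃ S, Remaining a b S s ∧ Oriented a b E S (s.arr 3) m ∧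
      ∀ v < i, degree a b S v ≠ 1)
    (potential a b E m) (fun _ => 20) s₀ (by decide) (by decide) (by decide)
    (fun _ _ _ ⟨S, h1, h2, h3⟩ => ⟨S, ⟨h1.mark, h1.deg⟩, h2, h3⟩) (fun _ _ => rfl)
    ⟨E, hrem, ⟨subset_rfl, fun x hx h => absurd hx h, fun x _ => h3 x,
      fun x hx _ _ h => absurd hx h, fun x hx h => absurd hx h, by rw [hzero E subset_rfl]; omega⟩,
      by simp⟩ (by
    rintro i s hs hi hsi ⟨S, hremS, horS, hleaf⟩
    rw [hm] at hi
    obtain ⟨s₁, c₁, hr₁, hc₁, h6₁⟩ := exists_runs_of_wp (P := .setVar 6 (.var 2)) (s := s)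
      (post := fun s' => s'.var 6 = i) (by simp [wp, IntExp.eval, hsi])
    have f₁ := hr₁.sameOutside
    have hadj₁ : Adjacency a b E n s₁ := (hadj.of_sameOutside hs).of_sameOutside f₁
    have hrem₁ := hremS.of_arr_eq (f₁.arr 9 (by decide)) (f₁.arr 14 (by decide))
    obtain ⟨s₂, c₂, S', hr₂, hSS, hrem₂, hor₂, hU, hc₂⟩ := exists_runs_walk hE hab hadj₁ hrem₁
      (by rw [f₁.arr 3 (by decide)]; exact horS) (fun _ => hzero S horS.subset) {u | u ≤ i} (by
        intro u hu hdu
        rw [h6₁]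
        left
        by_contra hne
        exact hleaf u (lt_of_le_of_ne hu hne) hdu)
    refine ⟨s₂, _, hr₁.seq _ _ _ _ _ _ _ hr₂, ⟨S', hrem₂, hor₂, fun v hv hdv => ?_⟩, ?_⟩
    · have := hU v (Nat.lt_succ_iff.1 hv) hdv
      omega
    · have hp : potential a b E m s₁ ≤ potential a b E m s := potential_le subset_rfl hremS hrem₁
      have hc₁' : c₁ ≤ 2 := hc₁.trans (by decide)
      omega)
  rw [hm] at hleaf hc
  refine ⟨s', c, S, hr, ?_, hremS, horS, fun v => ?_⟩
  · have := potential_le_linear hE hab s₀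
    simp at hc
    omega
  · by_cases hv : v < m
    · exact hleaf v hv
    · rw [degree_eq_zero_of_le (fun x hx => hab x (horS.subset hx)) (not_lt.1 hv)]
      omega

theorem exists_runs_checkDegrees {S : Finset ℕ} (hm : s₀.var 1 = m) (h9 : s₀.var 9 = 0)
    (hrem : Remaining a b S s₀) :
    ∃ s' c, Runs checkDegrees s₀ s' c ∧ c ≤ 100 * (m + 1) ∧
      (s'.var 9 = 0 ↔ ∀ v < m, degree a b S v ≤ 2) := by
  obtain ⟨s', c, hr, hI, hc⟩ := exists_runs_forLoop 1
    (.ite (.lt (.const 2) (.get 14 (.var 2))) (.setVar 9 (.const 1)) .skip)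
    (fun i s => s.var 9 = 0 ↔ ∀ v < i, degree a b S v ≤ 2)
    (fun _ => 0) (fun _ => 20) s₀ (by decide) (by decide) (by decide)
    (fun i s n h => by simpa using h) (fun _ _ => rfl) (by simp [h9]) (by
    rintro i s hs hi hsi hI
    have hd : s.arr 14 i = degree a b S i := by rw [hs.arr 14 (by decide), hrem.deg]
    obtain ⟨s', c, hr, hc, hpost⟩ := exists_runs_of_wp (s := s)
      (P := .ite (.lt (.const 2) (.get 14 (.var 2))) (.setVar 9 (.const 1)) .skip)
      (post := fun s => s.var 9 = 0 ↔ ∀ v < i + 1, degree a b S v ≤ 2) (by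
      simp only [wp, Test.Holds, IntExp.eval, hsi, hd, Function.update_self,
        Nat.forall_lt_succ_right]
      refine ⟨fun h => ?_, fun h => ?_⟩
      · simp only [one_ne_zero, false_iff, not_and]
        intro _; omega
      · rw [hI]
        exact ⟨fun h' => ⟨h', not_lt.1 h⟩, And.left⟩)
    exact ⟨s', c, hr, hpost, by have := hc.trans (show _ ≤ 20 by decide); omega⟩)
  rw [hm] at hI hc
  refine ⟨s', c, hr, ?_, hI⟩
  simp at hc; omega

theorem exists_runs_breakCycle {S : Finset ℕ} {x : ℕ} (hrem : Remaining a b S s₀) (hx : x ∈ S)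
    (h2 : s₀.var 2 = x) (hadj : Adjacency a b E n s₀) :
    ∃ s' c, Runs breakCycle s₀ s' c ∧ c ≤ 50 ∧ Remaining a b (S.erase x) s' ∧
      s'.arr 3 = Function.update (s₀.arr 3) x (a x + 1) ∧ s'.var 6 = b x := by
  obtain ⟨s₁, c₁, hr₁, hc₁, h1⟩ := exists_runs_of_wp (P := .setVar 7 (.succ (.var 2))) (s := s₀)
    (post := fun s => s.var 7 = x + 1) (by simp [wp, IntExp.eval, h2])
  have f₁ := hr₁.sameOutside
  obtain ⟨s₂, c₂, hr₂, hc₂, h2'⟩ := exists_runs_of_wp (P := .setVar 6 (.get 7 (.var 2))) (s := s₁)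
    (post := fun s => s.var 6 = a x) (by
      simp [wp, IntExp.eval, f₁.var 2 (by decide), h2, f₁.arr 7 (by decide), hadj.fst])
  have f₂ := hr₂.sameOutside
  obtain ⟨s₃, c₃, hr₃, hc₃, h3⟩ := exists_runs_of_wp (P := .setVar 8 (.get 8 (.var 2))) (s := s₂)
    (post := fun s => s.var 8 = b x) (by
      simp [wp, IntExp.eval, f₂.var 2 (by decide), f₁.var 2 (by decide), h2,
        f₂.arr 8 (by decide), f₁.arr 8 (by decide), hadj.snd])
  have f₃ := hr₃.sameOutside
  have hrem₃ : Remaining a b S s₃ := hrem.of_arr_eq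
    (by rw [f₃.arr 9 (by decide), f₂.arr 9 (by decide), f₁.arr 9 (by decide)])
    (by rw [f₃.arr 14 (by decide), f₂.arr 14 (by decide), f₁.arr 14 (by decide)])
  obtain ⟨s₄, c₄, hr₄, hc₄, hrem₄, h34, h64⟩ := exists_runs_enter hrem₃ hx (Or.inl ⟨rfl, rfl⟩)
    (by rw [f₃.var 7 (by decide), f₂.var 7 (by decide), h1]; rfl)
    (by rw [f₃.var 6 (by decide), h2']) h3
  refine ⟨s₄, _, hr₁.seq _ _ _ _ _ _ _ (hr₂.seq _ _ _ _ _ _ _ (hr₃.seq _ _ _ _ _ _ _ hr₄)), ?_,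
    hrem₄, ?_, h64⟩
  · have := hc₁.trans (show _ ≤ 5 by decide)
    have := hc₂.trans (show _ ≤ 5 by decide)
    have := hc₃.trans (show _ ≤ 5 by decide)
    omega
  · rw [h34, f₃.arr 3 (by decide), f₂.arr 3 (by decide), f₁.arr 3 (by decide)]

/-- When a cycle is broken at an edge, the entered end is left with degree at most `1` and is the
exception; the walk from the other end cannot stop before it has come round, by parity. -/
theorem exists_runs_orientCycles {S₀ : Finset ℕ} (hn : s₀.var 0 = n) (hE : ∀ x ∈ E, x < n)
    (hab : ∀ x ∈ E, a x < m ∧ b x < m) (hadj : Adjacency a b E n s₀) (hrem : Remaining a b S₀ s₀)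
    (hor : Oriented a b E S₀ (s₀.arr 3) m)
    (hdeg : ∀ v, degree a b S₀ v = 0 ∨ degree a b S₀ v = 2) :
    ∃ s' c, Runs orientCycles s₀ s' c ∧ c ≤ 500 * (n + m + 1) ∧
      Oriented a b E ∅ (s'.arr 3) m := by
  have hzero : ∀ S, S ⊆ E → degree a b S m = 0 := fun S hS =>
    degree_eq_zero_of_le (fun x hx => hab x (hS hx)) le_rfl
  obtain ⟨s', c, hr, ⟨S, hremS, horS, -, hdone⟩, hc⟩ := exists_runs_forLoop 0
    (.ite (.eq (.get 9 (.var 2)) (.const 0)) .skip (.seq breakCycle walk))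
    (fun i s => ∃ S, Remaining a b S s ∧ Oriented a b E S (s.arr 3) m ∧
      (∀ v, degree a b S v = 0 ∨ degree a b S v = 2) ∧ ∀ x < i, x ∉ S)
    (potential a b E m) (fun _ => 100) s₀ (by decide) (by decide) (by decide)
    (fun _ _ _ ⟨S, h1, h2, h3, h4⟩ => ⟨S, ⟨h1.mark, h1.deg⟩, h2, h3, h4⟩) (fun _ _ => rfl)
    ⟨S₀, hrem, hor, hdeg, by simp⟩ (by
    rintro i s hs hi hsi ⟨S, hremS, horS, hdegS, hdone⟩
    have htest : (Test.eq (.get 9 (.var 2)) (.const 0)).Holds s ↔ i ∉ S := by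
      simp only [Test.Holds, IntExp.eval, hsi]
      rw [hremS.mem_iff, not_not]
    by_cases hiS : i ∈ S
    · have hadjS : Adjacency a b E n s := hadj.of_sameOutside hs
      obtain ⟨s₁, c₁, hr₁, hc₁, hrem₁, h3₁, h6₁⟩ := exists_runs_breakCycle hremS hiS hsi hadjS
      have hdi := fun v => degree_erase (a := a) (b := b) hiS v
      have hda : degree a b (S.erase i) (a i) ≤ 1 := by
        have h1 := hdi (a i)
        have h2 := hdegS (a i)
        simp only [if_true] at h1
        omega
      have ham := hab i (horS.subset hiS)
      have hor₁ : Oriented a b E (S.erase i) (s₁.arr 3) (a i) := by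
        rw [h3₁]
        exact horS.orient hiS (Or.inl rfl) (Or.inr (hzero S horS.subset)) (by omega)
          (Or.inl rfl) hda
      obtain ⟨s₂, c₂, S', hr₂, hSS, hrem₂, hor₂, hU, hc₂⟩ := exists_runs_walk hE hab
        (hadjS.of_sameOutside hr₁.sameOutside) hrem₁ hor₁ (by
          intro hc
          rw [h6₁] at hc
          have h1 := hdi (a i)
          have h2 := hdegS (a i)
          simp only [hc, if_true] at h1
          omega) Set.univ (by
          intro u _ hdu
          rw [h6₁]
          by_contra hc
          push Not at hc
          have h1 := hdi u
          have h2 := hdegS u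
          simp only [if_neg hc.1.symm, if_neg hc.2.symm] at h1
          omega)
      have hSE : ∀ x ∈ S', a x < m ∧ b x < m := fun x hx => hab x (hor₂.subset hx)
      have hmono : ∀ v, degree a b S' v ≤ degree a b S v := fun v =>
        degree_mono (hSS.trans (Finset.erase_subset _ _)) v
      have hother : ∀ v, v ≠ a i → degree a b S' v = 0 ∨ degree a b S' v = 2 := by
        intro v hv
        have h1 := hmono v
        have h2 := hdegS v
        have h3 : degree a b S' v ≠ 1 := fun h => hv (hU v (Set.mem_univ v) h)
        omega
      have ha0 := degree_eq_zero_of_parity hSE hother hor₂.exception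
      refine ⟨s₂, _, Runs.ite_false _ _ _ _ _ _ (by rw [htest, not_not]; exact hiS)
        (hr₁.seq _ _ _ _ _ _ _ hr₂), ⟨S', hrem₂, ?_, ?_, ?_⟩, ?_⟩
      · exact hor₂.change_exception ha0 (by rw [hzero S' hor₂.subset]; omega)
      · intro v
        by_cases hv : v = a i
        · rw [hv]; exact Or.inl ha0
        · exact hother v hv
      · intro x hx hxS
        have h1 := Finset.mem_erase.1 (hSS hxS)
        exact hdone x (by omega) h1.2
      · have hp : potential a b E m s₁ ≤ potential a b E m s :=
          potential_le (Finset.erase_subset _ _) hremS hrem₁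
        simp only [Test.cost, IntExp.cost]
        omega
    · refine ⟨s, _, Runs.ite_true _ _ _ _ _ _ (htest.2 hiS) (Runs.skip s),
        ⟨S, hremS, horS, hdegS, fun x hx => ?_⟩, ?_⟩
      · rcases Nat.lt_succ_iff_lt_or_eq.1 hx with h | rfl
        · exact hdone x h
        · exact hiS
      · simp only [Test.cost, IntExp.cost]
        omega)
  rw [hn] at hdone hc
  have hempty : S = ∅ := by
    refine Finset.eq_empty_of_forall_notMem fun x hx => ?_
    exact hdone x (hE x (horS.subset hx)) hx
  subst hempty
  refine ⟨s', c, hr, ?_, horS⟩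
  have := potential_le_linear hE hab s₀
  simp at hc
  omega

/-- The orientation stage either gives every edge one of its ends, no two edges the same, or
reports truthfully that this is impossible. -/
theorem exists_runs_orient (hn : s₀.var 0 = n) (hm : s₀.var 1 = m) (hv9 : s₀.var 9 = 0)
    (ha : s₀.arr 7 = a) (hb : s₀.arr 8 = b)
    (hE : ∀ x ∈ E, x < n) (hab : ∀ x ∈ E, a x < m ∧ b x < m)
    (h9 : ∀ x, s₀.arr 9 x = if x ∈ E then 1 else 0) (h3 : ∀ v, s₀.arr 3 v = 0)
    (h10 : ∀ v, s₀.arr 10 v = 0) (h12 : ∀ v, s₀.arr 12 v = 0) (h14 : ∀ v, s₀.arr 14 v = 0) :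
    ∃ s' c, Runs orient s₀ s' c ∧ c ≤ 1100 * (n + m + 1) ∧
      (s'.var 9 = 0 → (∀ x ∈ E, s'.arr 3 x = a x + 1 ∨ s'.arr 3 x = b x + 1) ∧
        (∀ x, x ∉ E → s'.arr 3 x = 0) ∧
        ∀ x ∈ E, ∀ y ∈ E, s'.arr 3 x = s'.arr 3 y → x = y) ∧
      (s'.var 9 ≠ 0 → ∀ g : ℕ → ℕ, (∀ x ∈ E, g x = a x ∨ g x = b x) →
        ¬ ∀ x ∈ E, ∀ y ∈ E, g x = g y → x = y) := by
  obtain ⟨s₁, c₁, hr₁, hc₁, hadj₁, hrem₁⟩ := exists_runs_buildLists hn ha hb hE h9 h10 h12 h14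
  have f₁ := hr₁.sameOutside
  obtain ⟨s₂, c₂, S, hr₂, hc₂, hrem₂, hor₂, hleaf⟩ := exists_runs_peel
    (by rw [f₁.var 1 (by decide), hm]) hE hab hadj₁ hrem₁
    (by rw [f₁.arr 3 (by decide)]; exact h3)
  have f₂ := hr₂.sameOutside
  obtain ⟨s₃, c₃, hr₃, hc₃, hcheck⟩ := exists_runs_checkDegrees (m := m)
    (by rw [f₂.var 1 (by decide), f₁.var 1 (by decide), hm])
    (by rw [f₂.var 9 (by decide), f₁.var 9 (by decide), hv9]) hrem₂
  have f₃ := hr₃.sameOutside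
  have hSab : ∀ x ∈ S, a x < m ∧ b x < m := fun x hx => hab x (hor₂.subset hx)
  by_cases hv : s₃.var 9 = 0
  · have hle := hcheck.1 hv
    obtain ⟨s₄, c₄, hr₄, hc₄, hor₄⟩ := exists_runs_orientCycles
      (by rw [f₃.var 0 (by decide), f₂.var 0 (by decide), f₁.var 0 (by decide), hn]) hE hab
      ((hadj₁.of_sameOutside f₂).of_sameOutside f₃)
      (hrem₂.of_arr_eq (f₃.arr 9 (by decide)) (f₃.arr 14 (by decide)))
      (by rw [f₃.arr 3 (by decide)]; exact hor₂) (by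
        intro v
        have h1 := hleaf v
        by_cases hvm : v < m
        · have := hle v hvm; omega
        · exact Or.inl (degree_eq_zero_of_le hSab (not_lt.1 hvm)))
    have f₄ := hr₄.sameOutside
    refine ⟨s₄, _, hr₁.seq _ _ _ _ _ _ _ (hr₂.seq _ _ _ _ _ _ _ (hr₃.seq _ _ _ _ _ _ _
      (Runs.ite_true _ _ _ _ _ _ hv hr₄))), ?_, fun _ => ⟨?_, hor₄.out_zero, ?_⟩, fun hne => ?_⟩
    · simp only [Test.cost, IntExp.cost]
      omega
    · exact fun x hx => hor₄.out_eq x hx (by simp)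
    · exact fun x hx y hy => hor₄.inj x hx y hy (by simp) (by simp)
    · exact absurd (by rw [f₄.var 9 (by decide)]; exact hv) hne
  · refine ⟨s₃, _, hr₁.seq _ _ _ _ _ _ _ (hr₂.seq _ _ _ _ _ _ _ (hr₃.seq _ _ _ _ _ _ _
      (Runs.ite_false _ _ _ _ _ _ hv (Runs.skip _)))), ?_,
      fun h => absurd h hv, fun _ g hg hinj => ?_⟩
    · simp only [Test.cost, IntExp.cost]
      omega
    · refine hv (hcheck.2 fun v _ => ?_)
      exact degree_le_two_of_orientation hSab hleaf (fun x hx => hg x (hor₂.subset hx))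
        (fun x hx y hy => hinj x (hor₂.subset hx) y (hor₂.subset hy)) v

end Orient

/-! ### Filling the first choices -/

/-- Mark the job of the applicant in variable `2`. -/
def markStep : Program :=
  .ite (.eq (.get 3 (.var 2)) (.const 0)) .skip
    (.setArr 15 (.pred (.get 3 (.var 2))) (.const 1))

/-- Mark the jobs that have been given in integer array `15`. -/
def markTaken : Program := forLoop (.var 0) markStep

/-- Promote the applicant in variable `2` to its first choice, where allowed, if that is not
taken. -/
def promoteStep : Program :=
  .ite (.and (.not (.eq (.get 6 (.var 2)) (.const 0)))
      (.eq (.get 15 (.pred (.get 4 (.var 2)))) (.const 0)))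
    (.seq (.setArr 15 (.pred (.get 4 (.var 2))) (.const 1))
      (.setArr 3 (.var 2) (.get 4 (.var 2))))
    .skip

/-- Promote applicants to their first choices.  The mark at the job that a promoted applicant gives
up stays, which is harmless as that job is nobody's first choice. -/
def promote : Program := forLoop (.var 0) promoteStep

/-- Set variable `9` if the first choice of the applicant in variable `2` is not taken. -/
def checkStep : Program :=
  .ite (.and (.not (.eq (.get 4 (.var 2)) (.const 0)))
      (.eq (.get 15 (.pred (.get 4 (.var 2)))) (.const 0)))
    (.setVar 9 (.const 1)) .skip

/-- Set variable `9` if there is a first choice that is not taken. -/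
def checkFilled : Program := forLoop (.var 0) checkStep

/-- Turn an assignment of allowed outcomes into a popular matching, or set variable `9`. -/
def fill : Program := .seq markTaken (.seq promote checkFilled)

namespace Instance

variable {I : Instance} {F lam : Fin I.numJobs → ℝ}
  {f : Fin I.numApplicants → Option (Fin I.numJobs)} {mu : Fin I.numApplicants → ℝ}
  {M : I.Assignment} {s₀ : State}

theorem Allowed.mem (hF : I.FirstChoice F f) {x p} (h : I.Allowed F lam f mu x (some p)) :
    p ∈ I.pref x := by
  rcases h with h | h
  · exact hF.mem x p h.2.1.symm
  · exact h.mem p rfl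

theorem Allowed.first {x p} (h : I.Allowed F lam f mu x (some p)) (hp : F p ≠ 0) :
    f x = some p ∧ I.FirstAllowed f mu x := by
  rcases h with h | h
  · exact ⟨h.2.1.symm, h.2.2⟩
  · exact absurd (h.rank_eq_zero p rfl) hp

theorem exists_runs_markTaken (hn : s₀.var 0 = I.numApplicants)
    (h3 : ∀ x : Fin I.numApplicants, s₀.arr 3 x = encode (M x)) (h15 : ∀ i, s₀.arr 15 i = 0) :
    ∃ s' c, Runs markTaken s₀ s' c ∧ c ≤ 100 * (I.numApplicants + 1) ∧
      ∀ p : Fin I.numJobs, s'.arr 15 p ≠ 0 ↔ ∃ x, M x = some p := by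
  obtain ⟨s', c, hr, hI, hc⟩ := exists_runs_forLoop 0
    markStep
    (fun i s => ∀ p : Fin I.numJobs, s.arr 15 p ≠ 0 ↔ ∃ x, x.val < i ∧ M x = some p)
    (fun _ => 0) (fun _ => 20) s₀ (by decide) (by decide) (by decide)
    (fun _ _ _ h => h) (fun _ _ => rfl) (by simp [h15]) (by
    rintro i s hs hi hsi hI
    rw [hn] at hi
    have h3i : s.arr 3 i = encode (M ⟨i, hi⟩) := by rw [hs.arr 3 (by decide)]; exact h3 ⟨i, hi⟩
    have hsucc : ∀ p, (∃ x : Fin I.numApplicants, x.val < i + 1 ∧ M x = some p) ↔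
        (∃ x : Fin I.numApplicants, x.val < i ∧ M x = some p) ∨ M ⟨i, hi⟩ = some p := by
      intro p
      constructor
      · rintro ⟨x, hx, hp⟩
        rcases Nat.lt_succ_iff_lt_or_eq.1 hx with h | rfl
        · exact Or.inl ⟨x, h, hp⟩
        · exact Or.inr hp
      · rintro (⟨x, hx, hp⟩ | hp)
        · exact ⟨x, hx.trans (Nat.lt_succ_self i), hp⟩
        · exact ⟨_, Nat.lt_succ_self i, hp⟩
    obtain ⟨s', c, hr, hc, hpost⟩ := exists_runs_of_wp (s := s)
      (P := markStep)
      (post := fun s => ∀ p : Fin I.numJobs, s.arr 15 p ≠ 0 ↔ ∃ x, x.val < i + 1 ∧ M x = some p) (by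
      simp only [markStep, wp, Test.Holds, IntExp.eval, hsi, h3i, Function.update_self, hsucc]
      rcases hM : M ⟨i, hi⟩ with _ | q
      · refine ⟨fun _ p => ?_, fun hc => absurd rfl hc⟩
        rw [hI]; simp
      · refine ⟨fun hc => absurd hc (Nat.succ_ne_zero _), fun _ p => ?_⟩
        by_cases hpq : p = q
        · subst hpq; simp [encode]
        · have : p.val ≠ q.val := fun hc => hpq (Fin.ext hc)
          simp only [encode, Nat.add_sub_cancel, Function.update_of_ne this]
          rw [hI]
          simp [Ne.symm hpq])
    exact ⟨s', c, hr, hpost, by have := hc.trans (show _ ≤ 20 by decide); omega⟩)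
  rw [hn] at hI hc
  refine ⟨s', c, hr, ?_, fun p => ?_⟩
  · simp at hc; omega
  · rw [hI]
    exact ⟨fun ⟨x, _, hx⟩ => ⟨x, hx⟩, fun ⟨x, hx⟩ => ⟨x, x.2, hx⟩⟩

theorem exists_runs_promote (hF : I.FirstChoice F f) (hn : s₀.var 0 = I.numApplicants)
    (h4 : ∀ x : Fin I.numApplicants, s₀.arr 4 x = encode (f x))
    (h6 : ∀ x : Fin I.numApplicants, s₀.arr 6 x ≠ 0 ↔ f x ≠ none ∧ I.FirstAllowed f mu x)
    (hM : I.IsMatching M) (hall : ∀ x, I.Allowed F lam f mu x (M x))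
    (h3 : ∀ x : Fin I.numApplicants, s₀.arr 3 x = encode (M x))
    (h15 : ∀ p : Fin I.numJobs, s₀.arr 15 p ≠ 0 ↔ ∃ x, M x = some p) :
    ∃ s' c M', Runs promote s₀ s' c ∧ c ≤ 100 * (I.numApplicants + 1) ∧
      I.IsMatching M' ∧ (∀ x, I.Allowed F lam f mu x (M' x)) ∧
      (∀ x : Fin I.numApplicants, s'.arr 3 x = encode (M' x)) ∧
      (∀ p : Fin I.numJobs, F p ≠ 0 → s'.arr 15 p ≠ 0 → ∃ x, f x = some p ∧ M' x = some p) ∧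
      ∀ x (p : Fin I.numJobs), f x = some p → I.FirstAllowed f mu x → s'.arr 15 p ≠ 0 := by
  obtain ⟨s', c, hr, ⟨M', hM', hall', h3', -, hfill, hdone⟩, hc⟩ := exists_runs_forLoop 0
    promoteStep
    (fun i s => ∃ M', I.IsMatching M' ∧ (∀ x, I.Allowed F lam f mu x (M' x)) ∧
      (∀ x : Fin I.numApplicants, s.arr 3 x = encode (M' x)) ∧
      (∀ x (p : Fin I.numJobs), M' x = some p → s.arr 15 p ≠ 0) ∧
      (∀ p : Fin I.numJobs, F p ≠ 0 → s.arr 15 p ≠ 0 → ∃ x, f x = some p ∧ M' x = some p) ∧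
      ∀ x, x.val < i → ∀ p : Fin I.numJobs, f x = some p → I.FirstAllowed f mu x → s.arr 15 p ≠ 0)
    (fun _ => 0) (fun _ => 40) s₀ (by decide) (by decide) (by decide)
    (fun _ _ _ h => h) (fun _ _ => rfl)
    ⟨M, hM, hall, h3, fun x p hx => (h15 p).2 ⟨x, hx⟩, fun p hp h => by
      obtain ⟨x, hx⟩ := (h15 p).1 h
      have := hall x
      rw [hx] at this
      exact ⟨x, (this.first hp).1, hx⟩, by simp⟩ (by
    rintro i s hs hi hsi ⟨M', hM', hall', h3', htaken, hfill, hdone⟩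
    rw [hn] at hi
    set x : Fin I.numApplicants := ⟨i, hi⟩ with hxdef
    have h4i : s.arr 4 i = encode (f x) := by rw [hs.arr 4 (by decide)]; exact h4 x
    have h6i : s.arr 6 i ≠ 0 ↔ f x ≠ none ∧ I.FirstAllowed f mu x := by
      rw [hs.arr 6 (by decide)]; exact h6 x
    have hlast : ∀ y : Fin I.numApplicants, y.val < i + 1 → y.val < i ∨ y = x := fun y hy =>
      (Nat.lt_succ_iff_lt_or_eq.1 hy).imp id fun h => Fin.ext h
    obtain ⟨s', c, hr, hc, hpost⟩ := exists_runs_of_wp (s := s)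
      (P := promoteStep)
      (post := fun s => ∃ M', I.IsMatching M' ∧ (∀ x, I.Allowed F lam f mu x (M' x)) ∧
        (∀ x : Fin I.numApplicants, s.arr 3 x = encode (M' x)) ∧
        (∀ x (p : Fin I.numJobs), M' x = some p → s.arr 15 p ≠ 0) ∧
        (∀ p : Fin I.numJobs, F p ≠ 0 → s.arr 15 p ≠ 0 → ∃ x, f x = some p ∧ M' x = some p) ∧
        ∀ x, x.val < i + 1 → ∀ p : Fin I.numJobs, f x = some p → I.FirstAllowed f mu x →
          s.arr 15 p ≠ 0) (by
      simp only [promoteStep, wp, Test.Holds, IntExp.eval, hsi, h4i]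
      refine ⟨fun ⟨h6x, hz⟩ => ?_, fun h => ?_⟩
      · obtain ⟨hne, hfirst⟩ := h6i.1 h6x
        obtain ⟨p, hp⟩ := Option.ne_none_iff_exists'.1 hne
        simp only [hp, encode, Nat.add_sub_cancel] at hz
        have hfree : ∀ y, M' y ≠ some p := fun y hy => htaken y p hy hz
        have hval : ∀ {q : Fin I.numJobs}, q ≠ p → q.val ≠ p.val :=
          fun hq hc => hq (Fin.ext hc)
        have hmono : ∀ q : Fin I.numJobs, s.arr 15 q ≠ 0 →
            Function.update (s.arr 15) p.val 1 q.val ≠ 0 := by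
          intro q hq
          by_cases hqp : q = p
          · subst hqp; simp
          · rwa [Function.update_of_ne (hval hqp)]
        refine ⟨Function.update M' x (some p), hM'.assign (hF.mem x p hp) fun y _ => hfree y,
          fun y => ?_, fun y => ?_, fun y q hy => ?_, fun q hFq hq => ?_, fun y hy q hq hyq => ?_⟩
        · by_cases hyx : y = x
          · subst hyx
            rw [Function.update_self]
            exact Or.inl ⟨by simp, hp.symm, hfirst⟩
          · rw [Function.update_of_ne hyx]; exact hall' y
        · by_cases hyx : y = x
          · subst hyx
            have hxi : x.val = i := rfl
            simp [hp, encode, h4i, hxi]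
          · have : y.val ≠ i := fun hc => hyx (Fin.ext hc)
            rw [Function.update_of_ne hyx]
            simpa [Function.update_of_ne this] using h3' y
        · simp only [hp, encode, Nat.add_sub_cancel, Function.update_self, ne_eq, not_false_eq_true,
            Function.update_of_ne, Nat.reduceEqDiff]
          by_cases hyx : y = x
          · subst hyx
            rw [Function.update_self] at hy
            cases hy
            simp
          · rw [Function.update_of_ne hyx] at hy
            exact hmono q (htaken y q hy)
        · by_cases hqp : q = p
          · subst hqp
            exact ⟨x, hp, by simp⟩
          · have hq' : s.arr 15 q ≠ 0 := by
              simpa [hp, encode, Function.update_of_ne (hval hqp)] using hq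
            obtain ⟨y, hfy, hy⟩ := hfill q hFq hq'
            refine ⟨y, hfy, ?_⟩
            rwa [Function.update_of_ne]
            rintro rfl
            rw [hp] at hfy
            cases hfy
            exact hqp rfl
        · simp only [hp, encode, Nat.add_sub_cancel, Function.update_self, ne_eq, not_false_eq_true,
            Function.update_of_ne, Nat.reduceEqDiff]
          rcases hlast y hy with hy | rfl
          · exact hmono q (hdone y hy q hq hyq)
          · rw [hp] at hq
            cases hq
            simp
      · refine ⟨M', hM', hall', h3', htaken, hfill, fun y hy q hq hyq => ?_⟩
        rcases hlast y hy with hy | rfl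
        · exact hdone y hy q hq hyq
        · intro hz
          refine h ⟨h6i.2 ⟨by simp [hq], hyq⟩, ?_⟩
          simpa [hq, encode] using hz)
    exact ⟨s', c, hr, hpost, by have := hc.trans (show _ ≤ 40 by decide); omega⟩)
  rw [hn] at hdone hc
  refine ⟨s', c, M', hr, ?_, hM', hall', h3', hfill, fun x => hdone x x.2⟩
  simp at hc; omega

theorem exists_runs_checkFilled (hn : s₀.var 0 = I.numApplicants) (h9 : s₀.var 9 = 0)
    (h4 : ∀ x : Fin I.numApplicants, s₀.arr 4 x = encode (f x)) :
    ∃ s' c, Runs checkFilled s₀ s' c ∧ c ≤ 100 * (I.numApplicants + 1) ∧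
      (s'.var 9 = 0 ↔ ∀ x (p : Fin I.numJobs), f x = some p → s₀.arr 15 p ≠ 0) := by
  obtain ⟨s', c, hr, hI, hc⟩ := exists_runs_forLoop 0
    checkStep
    (fun i s => s.var 9 = 0 ↔
      ∀ x, x.val < i → ∀ p : Fin I.numJobs, f x = some p → s₀.arr 15 p ≠ 0)
    (fun _ => 0) (fun _ => 30) s₀ (by decide) (by decide) (by decide)
    (fun i s n h => by simpa using h) (fun _ _ => rfl) (by simp [h9]) (by
    rintro i s hs hi hsi hI
    rw [hn] at hi
    set x : Fin I.numApplicants := ⟨i, hi⟩ with hxdef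
    have h4i : s.arr 4 i = encode (f x) := by rw [hs.arr 4 (by decide)]; exact h4 x
    have h15 : s.arr 15 = s₀.arr 15 := hs.arr 15 (by decide)
    obtain ⟨s', c, hr, hc, hpost⟩ := exists_runs_of_wp (s := s)
      (P := checkStep)
      (post := fun s => s.var 9 = 0 ↔
        ∀ x, x.val < i + 1 → ∀ p : Fin I.numJobs, f x = some p → s₀.arr 15 p ≠ 0) (by
      simp only [checkStep, wp, Test.Holds, IntExp.eval, hsi, h4i, h15, Function.update_self]
      refine ⟨fun ⟨hne, hz⟩ => ?_, fun h => ?_⟩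
      · obtain ⟨p, hp⟩ := Option.ne_none_iff_exists'.1 fun hc => hne (encode_eq_zero.2 hc)
        simp only [hp, encode, Nat.add_sub_cancel] at hz
        simp only [one_ne_zero, false_iff]
        exact fun hall => hall x (Nat.lt_succ_self i) p hp hz
      · rw [hI]
        refine ⟨fun hall y hy p hp => ?_, fun hall y hy => hall y (hy.trans (Nat.lt_succ_self i))⟩
        rcases Nat.lt_succ_iff_lt_or_eq.1 hy with hy | hy
        · exact hall y hy p hp
        · obtain rfl : y = x := Fin.ext hy
          intro hz
          refine h ⟨by simp [hp, encode], ?_⟩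
          simpa [hp, encode] using hz)
    exact ⟨s', c, hr, hpost, by have := hc.trans (show _ ≤ 30 by decide); omega⟩)
  rw [hn] at hI hc
  refine ⟨s', c, hr, ?_, hI.trans ⟨fun h x => h x x.2, fun h x _ => h x⟩⟩
  simp at hc; omega

/-- Promotions keep the outcomes allowed, and leave a first choice unfilled only if nobody may be
given it. -/
theorem exists_runs_fill (hF : I.FirstChoice F f) (hn : s₀.var 0 = I.numApplicants)
    (h9 : s₀.var 9 = 0) (h4 : ∀ x : Fin I.numApplicants, s₀.arr 4 x = encode (f x))
    (h6 : ∀ x : Fin I.numApplicants, s₀.arr 6 x ≠ 0 ↔ f x ≠ none ∧ I.FirstAllowed f mu x)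
    (hM : I.IsMatching M) (hall : ∀ x, I.Allowed F lam f mu x (M x))
    (h3 : ∀ x : Fin I.numApplicants, s₀.arr 3 x = encode (M x)) (h15 : ∀ i, s₀.arr 15 i = 0) :
    ∃ s' c, Runs fill s₀ s' c ∧ c ≤ 300 * (I.numApplicants + 1) ∧
      (s'.var 9 = 0 → ∃ M', I.IsMatching M' ∧ I.WellFormed F lam f mu M' ∧
        ∀ x : Fin I.numApplicants, s'.arr 3 x = encode (M' x)) ∧
      (s'.var 9 ≠ 0 → ∃ p, F p ≠ 0 ∧ ∀ x, f x = some p → ¬ I.FirstAllowed f mu x) := by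
  obtain ⟨s₁, c₁, hr₁, hc₁, h15₁⟩ := exists_runs_markTaken hn h3 h15
  have f₁ := hr₁.sameOutside
  obtain ⟨s₂, c₂, M', hr₂, hc₂, hM', hall', h3', hfill, hdone⟩ := exists_runs_promote (s₀ := s₁) hF
    (by rw [f₁.var 0 (by decide), hn]) (by rw [f₁.arr 4 (by decide)]; exact h4)
    (by rw [f₁.arr 6 (by decide)]; exact h6) hM hall (by rw [f₁.arr 3 (by decide)]; exact h3) h15₁
  have f₂ := hr₂.sameOutside
  obtain ⟨s₃, c₃, hr₃, hc₃, hcheck⟩ := exists_runs_checkFilled (s₀ := s₂) (f := f)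
    (by rw [f₂.var 0 (by decide), f₁.var 0 (by decide), hn])
    (by rw [f₂.var 9 (by decide), f₁.var 9 (by decide), h9])
    (by rw [f₂.arr 4 (by decide), f₁.arr 4 (by decide)]; exact h4)
  have f₃ := hr₃.sameOutside
  refine ⟨s₃, _, hr₁.seq _ _ _ _ _ _ _ (hr₂.seq _ _ _ _ _ _ _ hr₃), by omega, fun hz => ?_,
    fun hz => ?_⟩
  · refine ⟨M', hM', ⟨fun p hp => ?_, hall'⟩, by rw [f₃.arr 3 (by decide)]; exact h3'⟩
    obtain ⟨x, hx⟩ := hF.exists_of_ne p hp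
    exact hfill p hp (hcheck.1 hz x p hx)
  · have hnot := mt hcheck.2 hz
    push Not at hnot
    obtain ⟨x, p, hp, h0⟩ := hnot
    exact ⟨p, hF.rank_ne_zero hp, fun y hy hy' => hdone y p hy hy' h0⟩

end Instance

/-! ### The algorithm -/

/-- The whole algorithm; variable `9` is set as soon as it turns out that there is no popular
matching. -/
def solve : Program :=
  .seq findFirst (.seq findCosts (.seq findOptions
    (.seq (.ite (.eq (.var 9) (.const 0)) orient .skip)
    (.seq (.ite (.eq (.var 9) (.const 0)) fill .skip)
      (.ite (.eq (.var 9) (.const 0)) (.setVar 0 (.const 1)) (.setVar 0 (.const 0)))))))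

namespace Instance

variable {I : Instance} {σ : Equiv.Perm (Fin I.numApplicants)} {F lam : Fin I.numJobs → ℝ}
  {f : Fin I.numApplicants → Option (Fin I.numJobs)} {mu : Fin I.numApplicants → ℝ} {s₀ : State}

/-- The orientation stage, in terms of the instance. -/
theorem exists_runs_orient_options (hF : I.FirstChoice F f) (h₀ : I.HasInput σ s₀)
    (hv9 : s₀.var 9 = 0) (hopt : ∀ x, OptionsRecorded (I.Allowed F lam f mu) s₀ x)
    (h9 : ∀ i, I.numApplicants ≤ i → s₀.arr 9 i = 0) (h3 : ∀ v, s₀.arr 3 v = 0)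
    (h10 : ∀ v, s₀.arr 10 v = 0) (h12 : ∀ v, s₀.arr 12 v = 0) (h14 : ∀ v, s₀.arr 14 v = 0) :
    ∃ s' c, Runs orient s₀ s' c ∧ c ≤ 1100 * (I.numVertices + 1) ∧
      (s'.var 9 = 0 → ∃ M, I.IsMatching M ∧ (∀ x, I.Allowed F lam f mu x (M x)) ∧
        ∀ x : Fin I.numApplicants, s'.arr 3 x = encode (M x)) ∧
      (s'.var 9 ≠ 0 → ¬ ∃ M, I.IsMatching M ∧ ∀ x, I.Allowed F lam f mu x (M x)) := by
  set E := (Finset.range I.numApplicants).filter fun x => s₀.arr 9 x ≠ 0 with hE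
  have hlt : ∀ x ∈ E, x < I.numApplicants := fun x hx =>
    Finset.mem_range.1 (Finset.mem_filter.1 hx).1
  have hmem : ∀ x : Fin I.numApplicants, x.val ∈ E ↔ s₀.arr 9 x ≠ 0 := by
    intro x; simp [hE]
  have hedge : ∀ x : Fin I.numApplicants, x.val ∈ E → ∃ p q : Fin I.numJobs, s₀.arr 7 x = p ∧
      s₀.arr 8 x = q ∧ I.Allowed F lam f mu x (some p) ∧ I.Allowed F lam f mu x (some q) ∧
      ∀ o, I.Allowed F lam f mu x o → o = some p ∨ o = some q := by
    intro x hx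
    rcases hopt x with h | h
    · exact absurd h.1 ((hmem x).1 hx)
    · exact h.2
  obtain ⟨s', c, hr, hc, hyes, hno⟩ := exists_runs_orient (n := I.numApplicants) (m := I.numJobs)
    (E := E) h₀.var_zero h₀.var_one hv9 rfl rfl hlt
    (by
      intro x hx
      obtain ⟨p, q, hp, hq, -⟩ := hedge ⟨x, hlt x hx⟩ hx
      simp only at hp hq
      rw [hp, hq]
      exact ⟨p.2, q.2⟩)
    (by
      intro x
      by_cases hx : x < I.numApplicants
      · by_cases hxE : x ∈ E
        · rw [if_pos hxE]
          rcases hopt ⟨x, hx⟩ with h | h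
          · exact absurd h.1 ((hmem ⟨x, hx⟩).1 hxE)
          · exact h.1
        · rw [if_neg hxE]
          exact not_not.1 fun h => hxE ((hmem ⟨x, hx⟩).2 h)
      · rw [if_neg fun h => hx (hlt x h)]
        exact h9 x (not_lt.1 hx)) h3 h10 h12 h14
  refine ⟨s', c, hr, hc, fun hz => ?_, fun hz => ?_⟩
  · obtain ⟨hends, hout, hinj⟩ := hyes hz
    have key : ∀ x : Fin I.numApplicants, ∃ o, s'.arr 3 x = encode o ∧
        I.Allowed F lam f mu x o := by
      intro x
      by_cases hx : x.val ∈ E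
      · obtain ⟨p, q, hp, hq, hap, haq, -⟩ := hedge x hx
        rcases hends x hx with h | h
        · exact ⟨some p, by rw [h, hp]; rfl, hap⟩
        · exact ⟨some q, by rw [h, hq]; rfl, haq⟩
      · refine ⟨none, by rw [hout x hx]; rfl, ?_⟩
        rcases hopt x with h | h
        · exact h.2
        · exact absurd ((hmem x).2 (by rw [h.1]; exact one_ne_zero)) hx
    choose M hM hall using key
    refine ⟨M, ⟨fun x p hx => ?_, fun x y p hx hy => ?_⟩, hall, hM⟩
    · have := hall x
      rw [hx] at this
      exact this.mem hF
    · have inE : ∀ z, M z = some p → z.val ∈ E := by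
        intro z hz
        by_contra hzE
        have := hout z hzE
        rw [hM z, hz] at this
        exact Nat.succ_ne_zero _ this
      exact Fin.ext (hinj x (inE x hx) y (inE y hy) (by rw [hM x, hM y, hx, hy]))
  · rintro ⟨M, hM, hall⟩
    have hval : ∀ x : Fin I.numApplicants, x.val ∈ E → ∃ p, M x = some p ∧
        (p.val = s₀.arr 7 x ∨ p.val = s₀.arr 8 x) := by
      intro x hx
      obtain ⟨p, q, hp, hq, -, -, h⟩ := hedge x hx
      rcases h _ (hall x) with h | h
      · exact ⟨p, h, Or.inl hp.symm⟩
      · exact ⟨q, h, Or.inr hq.symm⟩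
    refine hno hz (fun x => if h : x < I.numApplicants then encode (M ⟨x, h⟩) - 1 else 0) ?_ ?_
    · intro x hx
      obtain ⟨p, hp, h⟩ := hval ⟨x, hlt x hx⟩ hx
      simpa [hlt x hx, hp, encode] using h
    · intro x hx y hy hxy
      obtain ⟨p, hp, -⟩ := hval ⟨x, hlt x hx⟩ hx
      obtain ⟨q, hq, -⟩ := hval ⟨y, hlt y hy⟩ hy
      simp only [hlt x hx, hlt y hy, dite_true, hp, hq, encode, Nat.add_sub_cancel] at hxy
      rw [← Fin.ext hxy] at hq
      exact congrArg Fin.val (hM.2 _ _ _ hp hq)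

theorem reports_of_encode {M : I.Assignment} {s : State} (h0 : s.var 0 = 1)
    (h3 : ∀ x : Fin I.numApplicants, s.arr 3 x = encode (M x)) : I.Reports s M := by
  refine ⟨h0, fun x => ?_⟩
  rw [h3]
  cases M x <;> rfl

theorem exists_runs_solve (hσ : I.ListsCategories σ) :
    ∃ s' c, Runs solve (I.input σ) s' c ∧ c ≤ 3000 * (I.numVertices + I.numEdges + 1) ∧
      I.CorrectAnswer s' := by
  have harr : ∀ k, 3 ≤ k → ∀ i, (I.input σ).arr k i = 0 := by
    intro k hk i
    simp [input, show k ≠ 0 by omega, show k ≠ 1 by omega, show k ≠ 2 by omega]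
  have hwarr : ∀ k, 1 ≤ k → ∀ i, (I.input σ).warr k i = 0 := by
    intro k hk i
    simp [input, show k ≠ 0 by omega]
  obtain ⟨s₁, c₁, F, f, hr₁, hc₁, hF, hw1, h4, h5⟩ := exists_runs_findFirst hσ (I.input σ)
    hasInput_input (harr 4 (by omega)) (harr 5 (by omega)) (hwarr 1 le_rfl)
  have f₁ := hr₁.sameOutside
  have hin₁ : I.HasInput σ s₁ := hasInput_input.of_sameOutside f₁
  obtain ⟨s₂, c₂, lam, mu, hr₂, hc₂, hl, hw2, h6⟩ := exists_runs_findCosts hσ hF s₁ hin₁ h4 h5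
    (by rw [f₁.arr 6 (by decide)]; exact harr 6 (by omega))
    (by rw [f₁.warr 2 (by decide)]; exact hwarr 2 (by omega))
  have f₂ := hr₂.sameOutside
  have hin₂ : I.HasInput σ s₂ := hin₁.of_sameOutside f₂
  have h4₂ : ∀ x : Fin I.numApplicants, s₂.arr 4 x = encode (f x) := by
    rw [f₂.arr 4 (by decide)]; exact h4
  obtain ⟨s₃, c₃, hr₃, hc₃, hopt, hbad, h9⟩ := exists_runs_findOptions hF s₂ hin₂ h4₂ h6
    (by rw [f₂.arr 9 (by decide), f₁.arr 9 (by decide)]; exact harr 9 (by omega))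
    (by rw [f₂.var 9 (by decide), f₁.var 9 (by decide)]; simp [input])
    (by rw [f₂.warr 1 (by decide)]; exact hw1) hw2
  have f₃ := hr₃.sameOutside
  have hin₃ : I.HasInput σ s₃ := hin₂.of_sameOutside f₃
  -- what has to be shown about the rest of the run
  suffices H : ∃ s' c,
      Runs (.seq (.ite (.eq (.var 9) (.const 0)) orient .skip)
        (.seq (.ite (.eq (.var 9) (.const 0)) fill .skip)
          (.ite (.eq (.var 9) (.const 0)) (.setVar 0 (.const 1)) (.setVar 0 (.const 0))))) s₃ s' c ∧
      c ≤ 2000 * (I.numVertices + 1) ∧ I.CorrectAnswer s' by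
    obtain ⟨s', c, hr, hc, hcorrect⟩ := H
    exact ⟨s', _, hr₁.seq _ _ _ _ _ _ _ (hr₂.seq _ _ _ _ _ _ _ (hr₃.seq _ _ _ _ _ _ _ hr)),
      by omega, hcorrect⟩
  -- the end of the run when there is no popular matching
  have failed : ∀ s, s.var 9 ≠ 0 → (¬ ∃ M, I.IsPopular M) → ∃ s',
      Runs (.ite (.eq (.var 9) (.const 0)) (.setVar 0 (.const 1)) (.setVar 0 (.const 0))) s s' 5 ∧
      I.CorrectAnswer s' := by
    intro s hs hno
    refine ⟨_, Runs.ite_false (.eq (.var 9) (.const 0)) _ _ _ _ _ hs (Runs.setVar _ _ _),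
      Or.inr ⟨?_, hno⟩⟩
    simp [ReportsNone, IntExp.eval]
  have test : ∀ s : State, s.var 9 = 0 ↔ (Test.eq (.var 9) (.const 0)).Holds s := fun s => Iff.rfl
  have hv : I.numApplicants ≤ I.numVertices := by unfold numVertices; omega
  by_cases hv₃ : s₃.var 9 = 0
  · have arr₃ : ∀ k, 3 ≤ k → k ∉ findFirst.arrs → k ∉ findCosts.arrs → k ∉ findOptions.arrs →
        ∀ i, s₃.arr k i = 0 := by
      intro k hk h1 h2 h3
      rw [f₃.arr k h3, f₂.arr k h2, f₁.arr k h1]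
      exact harr k hk
    obtain ⟨s₄, c₄, hr₄, hc₄, hyes, hno⟩ := exists_runs_orient_options hF hin₃ hv₃ (hopt hv₃) h9
      (arr₃ 3 (by decide) (by decide) (by decide) (by decide))
      (arr₃ 10 (by decide) (by decide) (by decide) (by decide))
      (arr₃ 12 (by decide) (by decide) (by decide) (by decide))
      (arr₃ 14 (by decide) (by decide) (by decide) (by decide))
    have f₄ := hr₄.sameOutside
    have hr₄' := Runs.ite_true _ _ Program.skip _ _ _ ((test s₃).1 hv₃) hr₄
    by_cases hv₄ : s₄.var 9 = 0
    · obtain ⟨M, hM, hall, h3⟩ := hyes hv₄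
      obtain ⟨s₅, c₅, hr₅, hc₅, hgood, hunfilled⟩ := exists_runs_fill (s₀ := s₄) hF
        (by rw [f₄.var 0 (by decide), hin₃.var_zero]) hv₄
        (by rw [f₄.arr 4 (by decide), f₃.arr 4 (by decide)]; exact h4₂)
        (by rw [f₄.arr 6 (by decide), f₃.arr 6 (by decide)]; exact h6) hM hall h3
        (by
          rw [f₄.arr 15 (by decide)]
          exact arr₃ 15 (by decide) (by decide) (by decide) (by decide))
      have hr₅' := Runs.ite_true _ _ Program.skip _ _ _ ((test s₄).1 hv₄) hr₅
      by_cases hv₅ : s₅.var 9 = 0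
      · obtain ⟨M', hM', hwf, h3'⟩ := hgood hv₅
        refine ⟨_, _, hr₄'.seq _ _ _ _ _ _ _ (hr₅'.seq _ _ _ _ _ _ _
          (Runs.ite_true _ _ _ _ _ _ ((test s₅).1 hv₅) (Runs.setVar _ _ _))), ?_,
          Or.inl ⟨M', hwf.isPopular hF hl hM', reports_of_encode ?_ h3'⟩⟩
        · simp only [Test.cost, IntExp.cost]
          omega
        · simp [IntExp.eval]
      · obtain ⟨s₆, hr₆, hcorrect⟩ := failed s₅ hv₅ (by
          rintro ⟨M', hM'⟩
          obtain ⟨p, hp, hnone⟩ := hunfilled hv₅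
          have hwf := hM'.wellFormed hF hl
          obtain ⟨x, hx, hMx⟩ := hwf.filled p hp
          have := hwf.allowed x
          rw [hMx] at this
          exact hnone x hx (this.first hp).2)
        refine ⟨s₆, _, hr₄'.seq _ _ _ _ _ _ _ (hr₅'.seq _ _ _ _ _ _ _ hr₆), ?_, hcorrect⟩
        simp only [Test.cost, IntExp.cost]
        omega
    · obtain ⟨s₆, hr₆, hcorrect⟩ := failed s₄ hv₄ (by
        rintro ⟨M', hM'⟩
        exact hno hv₄ ⟨M', hM'.1, (hM'.wellFormed hF hl).allowed⟩)
      refine ⟨s₆, _, hr₄'.seq _ _ _ _ _ _ _ ((Runs.ite_false _ _ _ _ _ _ (mt (test s₄).2 hv₄)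
        (Runs.skip _)).seq _ _ _ _ _ _ _ hr₆), ?_, hcorrect⟩
      simp only [Test.cost, IntExp.cost]
      omega
  · obtain ⟨s₆, hr₆, hcorrect⟩ := failed s₃ hv₃ (by
      rintro ⟨M', hM'⟩
      obtain ⟨x, hx⟩ := hbad hv₃
      exact hx _ ((hM'.wellFormed hF hl).allowed x))
    have hskip : ∀ P, Runs (.ite (.eq (.var 9) (.const 0)) P .skip) s₃ s₃
        ((Test.eq (.var 9) (.const 0)).cost + 1) := fun P =>
      Runs.ite_false _ _ _ _ _ _ (mt (test s₃).2 hv₃) (Runs.skip _)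
    refine ⟨s₆, _, (hskip _).seq _ _ _ _ _ _ _ ((hskip _).seq _ _ _ _ _ _ _ hr₆), ?_, hcorrect⟩
    simp only [Test.cost, IntExp.cost]
    omega

end Instance
end WeightedPopular

theorem mainTheorem4 :
    ∃ (P : WeightedPopular.Program) (C : ℕ),
      ∀ (I : WeightedPopular.Instance) (σ : Equiv.Perm (Fin I.numApplicants)),
        I.ListsCategories σ →
        ∃ (s : WeightedPopular.State) (c : ℕ),
          WeightedPopular.Runs P (I.input σ) s c ∧
          c ≤ C * (I.numVertices + I.numEdges + 1) ∧
          I.CorrectAnswer s :=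
  ⟨WeightedPopular.solve, 3000, fun _ _ hσ => WeightedPopular.Instance.exists_runs_solve hσ⟩
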